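/- Let $\{p_{\boldsymbol\theta} : \boldsymbol\theta\in\Theta\}$, $\Theta\subset\mathbb R^k$, be a family of probability densities on $\mathbb R^J$ with respect to a $\sigma$-finite measure $\nu$, and let $P_{\boldsymbol\theta}$ be the distribution with density $p_{\boldsymbol\theta}$. Let $\Theta_0\subset\Theta_1\subset\Theta$, let $\boldsymbol\theta^*\in\Theta_0$, and let $\mathbf X_1,\mathbf X_2,\dots$ be i.i.d. with distribution $P_{\boldsymbol\theta^*}$. Put $l_N(\boldsymbol\theta)=\sum_{i=1}^N\log p_{\boldsymbol\theta}(\mathbf X_i)\in[-\infty,\infty)$ and $$\lambda_N = 2\Big(\sup_{\boldsymbol\theta\in\Theta_1} l_N(\boldsymbol\theta)-\sup_{\boldsymbol\theta\in\Theta_0} l_N(\boldsymbol\theta)\Big).$$ For $i=0,1$ let $T_{\Theta_i}(\boldsymbol\theta^*)$ be the tangent cone, i.e. the set of all limits of sequences $\alpha_n(\boldsymbol\theta_n-\boldsymbol\theta^*)$ with $\alpha_n>0$, $\boldsymbol\theta_n\in\Theta_i$, $\boldsymbol\theta_n\to\boldsymbol\theta^*$. Assume: C1. $\boldsymbol\theta^*$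 is an interior point of $\Theta$. C2. There is a measurable $\dot l_{\boldsymbol\theta^*}:\mathbb R^J\to\mathbb R^k$ with $$\lim_{\mathbf h\to 0}\frac1{\|\mathbf h\|^2}\int_{\mathbb R^J}\Big(\sqrt{p_{\boldsymbol\theta^*+\mathbf h}}-\sqrt{p_{\boldsymbol\theta^*}}-\tfrac12\mathbf h^\top\dot l_{\boldsymbol\theta^*}\sqrt{p_{\boldsymbol\theta^*}}\Big)^2d\nu=0,$$ and the Fisher information matrix $I(\boldsymbol\theta^*)=\int \dot l_{\boldsymbol\theta^*}\dot l_{\boldsymbol\theta^*}^\top\,dP_{\boldsymbol\theta^*}$ is invertible. C3. There are a neighbourhood $U\subset\Theta$ of $\boldsymbol\theta^*$ and a measurable $\dot l:\mathbb R^J\to\mathbb R$ with $\int\dot l^2\,dP_{\boldsymbol\theta^*}<\infty$ such that $|\log p_{\boldsymbol\theta_1}(\mathbf x)-\log p_{\boldsymbol\theta_2}(\mathbf x)|\le\dot l(\mathbf x)\|\boldsymbol\theta_1-\boldsymbol\theta_2\|$ for all $\boldsymbol\theta_1,\boldsymbol\theta_2\in U$ and all $\mathbf x$ (no condition being imposed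 at points $\mathbf x$ where all $p_{\boldsymbol\theta}(\mathbf x)$, $\boldsymbol\theta\in U$, vanish; otherwise all of them are positive). C4. For each $S\in\{\Theta,\Theta_0,\Theta_1\}$ there is a consistent maximum likelihood estimator over $S$: points $\hat{\boldsymbol\theta}_{N,S}$ that, with probability tending to one, lie in $S$ and maximize $l_N$ over $S$, and that converge to $\boldsymbol\theta^*$ in probability. C5. For $i=0,1$ and every $\boldsymbol\tau\in T_{\Theta_i}(\boldsymbol\theta^*)$ there are $\epsilon>0$ and a map $\boldsymbol\alpha:[0,\epsilon)\to\Theta_i$ with $\boldsymbol\alpha(0)=\boldsymbol\theta^*$ and $\boldsymbol\tau=\lim_{t\to0+}[\boldsymbol\alpha(t)-\boldsymbol\alpha(0)]/t$. Then, as $N\to\infty$, $\lambda_N$ converges in distribution to $$\min_{\boldsymbol\tau\in T_{\Theta_0}(\boldsymbol\theta^*)}\|\mathbf Z-I(\boldsymbol\theta^*)^{1/2}\boldsymbol\tau\|^2-\min_{\boldsymbol\tau\in T_{\Theta_1}(\boldsymbol\theta^*)}\|\mathbf Z-I(\boldsymbol\theta^*)^{1/2}\boldsymbol\tau\|^2,$$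 where $\mathbf Z=(Z_1,\dots,Z_k)^\top$ is a vector of i.i.d. standard normal random variables; both minima are attained. -/

import Mathlib

open MeasureTheory ProbabilityTheory Filter Topology
open scoped NNReal ENNReal RealInnerProductSpace

noncomputable section

namespace LRT

/-- `p θ`, for `θ ∈ Θ`, are probability density functions with respect to `ν`. -/
def IsDensityFamily {k : ℕ} {𝓧 : Type*} [MeasurableSpace 𝓧] (ν : Measure 𝓧)
    (p : EuclideanSpace ℝ (Fin k) → 𝓧 → ℝ≥0) (Θ : Set (EuclideanSpace ℝ (Fin k))) : Prop :=
  ∀ θ ∈ Θ, Measurable (p θ) ∧ ∫⁻ x, (p θ x : ℝ≥0∞) ∂ν = 1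

/-- The probability distribution `P_θ` with density `p θ` with respect to `ν`. -/
def law {k : ℕ} {𝓧 : Type*} [MeasurableSpace 𝓧] (ν : Measure 𝓧)
    (p : EuclideanSpace ℝ (Fin k) → 𝓧 → ℝ≥0) (θ : EuclideanSpace ℝ (Fin k)) : Measure 𝓧 :=
  ν.withDensity fun x => (p θ x : ℝ≥0∞)

/-- The log-likelihood `l_N(θ) = ∑_{i<N} log p_θ(X_i)`, with values in `[-∞, ∞)`
(the value `-∞` occurs when some `p_θ(X_i)` vanishes). -/
def logLik {k : ℕ} {Ω 𝓧 : Type*} (p : EuclideanSpace ℝ (Fin k) → 𝓧 → ℝ≥0)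
    (X : ℕ → Ω → 𝓧) (N : ℕ) (ω : Ω) (θ : EuclideanSpace ℝ (Fin k)) : EReal :=
  ∑ i ∈ Finset.range N, ENNReal.log (p θ (X i ω))

/-- The likelihood ratio statistic `2 (sup_{Θ₁} l_N - sup_{Θ₀} l_N)`; the suprema are taken in
the extended reals. -/
def lrtStat {k : ℕ} {Ω 𝓧 : Type*} (p : EuclideanSpace ℝ (Fin k) → 𝓧 → ℝ≥0)
    (X : ℕ → Ω → 𝓧) (Θ₀ Θ₁ : Set (EuclideanSpace ℝ (Fin k))) (N : ℕ) (ω : Ω) : EReal :=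
  2 * ((⨆ θ ∈ Θ₁, logLik p X N ω θ) - ⨆ θ ∈ Θ₀, logLik p X N ω θ)

/-- Differentiability in quadratic mean of `θ ↦ p θ` at `θ`, with score function `s`. -/
def DiffQuadMean {k : ℕ} {𝓧 : Type*} [MeasurableSpace 𝓧] (ν : Measure 𝓧)
    (p : EuclideanSpace ℝ (Fin k) → 𝓧 → ℝ≥0) (θ : EuclideanSpace ℝ (Fin k))
    (s : 𝓧 → EuclideanSpace ℝ (Fin k)) : Prop :=
  Tendsto
    (fun h : EuclideanSpace ℝ (Fin k) =>
      (∫⁻ x, ENNReal.ofReal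
        ((√(p (θ + h) x : ℝ) - √(p θ x : ℝ) - 1 / 2 * ⟪h, s x⟫ * √(p θ x : ℝ)) ^ 2) ∂ν)
      / ENNReal.ofReal (‖h‖ ^ 2))
    (𝓝[≠] 0) (𝓝 0)

/-- The Fisher information matrix at `θ`: the second moment matrix `E_θ[s sᵀ]` of the score `s`
at `θ`. -/
def fisherInfo {k : ℕ} {𝓧 : Type*} [MeasurableSpace 𝓧] (ν : Measure 𝓧)
    (p : EuclideanSpace ℝ (Fin k) → 𝓧 → ℝ≥0) (θ : EuclideanSpace ℝ (Fin k))
    (s : 𝓧 → EuclideanSpace ℝ (Fin k)) : Matrix (Fin k) (Fin k) ℝ :=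
  Matrix.of fun i j => ∫ x, s x i * s x j ∂(law ν p θ)

/-- Local Lipschitz condition on the log-density: on a neighbourhood `U ⊆ Θ` of `θs`,
`|log p_θ₁(x) - log p_θ₂(x)| ≤ m(x) ‖θ₁ - θ₂‖` with `m` measurable and square integrable under
`P_θs`. The absolute value bound is written as a one-sided bound that holds for `(θ₁, θ₂)` and for
`(θ₂, θ₁)`, which makes sense with `log 0 = -∞`: at a given `x`, either all `p θ x` with
`θ ∈ U` vanish or all are positive. -/
def LipschitzLogDensity {k : ℕ} {𝓧 : Type*} [MeasurableSpace 𝓧] (ν : Measure 𝓧)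
    (p : EuclideanSpace ℝ (Fin k) → 𝓧 → ℝ≥0) (Θ : Set (EuclideanSpace ℝ (Fin k)))
    (θs : EuclideanSpace ℝ (Fin k)) : Prop :=
  ∃ U ∈ 𝓝 θs, U ⊆ Θ ∧ ∃ m : 𝓧 → ℝ, Measurable m ∧
    Integrable (fun x => m x ^ 2) (law ν p θs) ∧
    ∀ x, ∀ θ₁ ∈ U, ∀ θ₂ ∈ U,
      ENNReal.log (p θ₁ x) ≤ ENNReal.log (p θ₂ x) + ((m x * ‖θ₁ - θ₂‖ : ℝ) : EReal)

/-- The maximum likelihood estimator over `S` is consistent for `θs`: there are `θhat N`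
(random points) which, with probability tending to one, maximize the log-likelihood over
`S`, and which converge to `θs` in probability. -/
def ConsistentMLE {k : ℕ} {Ω 𝓧 : Type*} [MeasurableSpace Ω] (P : Measure Ω)
    (p : EuclideanSpace ℝ (Fin k) → 𝓧 → ℝ≥0) (X : ℕ → Ω → 𝓧)
    (S : Set (EuclideanSpace ℝ (Fin k))) (θs : EuclideanSpace ℝ (Fin k)) : Prop :=
  ∃ θhat : ℕ → Ω → EuclideanSpace ℝ (Fin k),
    Tendsto (fun N => P {ω | ¬ (θhat N ω ∈ S ∧ IsMaxOn (logLik p X N ω) S (θhat N ω))})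
      atTop (𝓝 0) ∧
    TendstoInMeasure P θhat atTop (fun _ => θs)

/-- The tangent cone of `S` at `θs`: all limits of sequences `a n • (θ n - θs)` with `a n > 0`,
`θ n ∈ S` and `θ n → θs`. -/
def tangentCone {k : ℕ} (S : Set (EuclideanSpace ℝ (Fin k))) (θs : EuclideanSpace ℝ (Fin k)) :
    Set (EuclideanSpace ℝ (Fin k)) :=
  {τ | ∃ (a : ℕ → ℝ) (θ : ℕ → EuclideanSpace ℝ (Fin k)), (∀ n, 0 < a n) ∧ (∀ n, θ n ∈ S) ∧
    Tendsto θ atTop (𝓝 θs) ∧ Tendsto (fun n => a n • (θ n - θs)) atTop (𝓝 τ)}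

/-- Chernoff regularity of `S` at `θs`. (Only the values of `α` on `[0, ε)` matter.) -/
def ChernoffRegular {k : ℕ} (S : Set (EuclideanSpace ℝ (Fin k)))
    (θs : EuclideanSpace ℝ (Fin k)) : Prop :=
  ∀ τ ∈ tangentCone S θs, ∃ ε > (0 : ℝ), ∃ α : ℝ → EuclideanSpace ℝ (Fin k),
    (∀ t ∈ Set.Ico 0 ε, α t ∈ S) ∧ α 0 = θs ∧
    Tendsto (fun t : ℝ => t⁻¹ • (α t - α 0)) (𝓝[>] 0) (𝓝 τ)

open scoped MatrixOrder in
/-- The positive semidefinite square root `M^{1/2}` of a positive semidefinite matrix `M`, acting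
on the Euclidean space. -/
def sqrtMap {k : ℕ} (M : Matrix (Fin k) (Fin k) ℝ) :
    EuclideanSpace ℝ (Fin k) →L[ℝ] EuclideanSpace ℝ (Fin k) :=
  Matrix.toEuclideanCLM (𝕜 := ℝ) (CFC.sqrt M)

/-- The set of values `‖z - M^{1/2} τ‖²`, `τ ∈ T`. -/
def sqDistSet {k : ℕ} (M : Matrix (Fin k) (Fin k) ℝ) (T : Set (EuclideanSpace ℝ (Fin k)))
    (z : EuclideanSpace ℝ (Fin k)) : Set ℝ :=
  (fun τ => ‖z - sqrtMap M τ‖ ^ 2) '' T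

/-- `min_{τ ∈ T} ‖z - M^{1/2} τ‖²` (as an infimum). -/
def minSqDist {k : ℕ} (M : Matrix (Fin k) (Fin k) ℝ) (T : Set (EuclideanSpace ℝ (Fin k)))
    (z : EuclideanSpace ℝ (Fin k)) : ℝ :=
  sInf (sqDistSet M T z)

end LRT

end

/-! Write h = √N (θ - θs) for the local parameter, Δ for the normalized score sum, A for the square
root of the Fisher information and Z = A⁻¹Δ. Uniformly for bounded h, the log-likelihood ratio at h
is ⟪h, Δ⟫ - ½‖A h‖² = ½(‖Z‖² - ‖Z - A h‖²) up to an error vanishing in probability. Maximizing over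
Θᵢ thus amounts to projecting Z onto the image under A of the rescaled set √N (Θᵢ - θs). By Chernoff
regularity the distance to this image converges to the distance to the image of the tangent cone
(`tendsto_infDist_localSet`). In the difference of the two suprema the terms ‖Z‖² and l_N(θs)
cancel, and the central limit theorem with the continuous mapping theorem gives the limit.

The analytic input is `IsLocalModel`, which `exists_isLocalModel` extracts from the densities. With
w = exp(L/2) - 1, normalization of the densities reads 2∫w + ∫w² = 0. Together with
differentiability in quadratic mean and the Lipschitz envelope, this yields the mean-square
expansion of L (`isLittleO_integral_sq_sub_inner`) and its mean -½ E⟪h, s⟫² + o(‖h‖²)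
(`isLittleO_integral_add`), with no second derivatives.

Uniformity in h comes from chaining (`measure_dyadic_modulus_le`). The envelope m is only square
integrable, so L is truncated to {m ≤ √n}. The centred increments are then bounded with bounded
total variance, hence have polynomial tails of every order, while the probability that some
observation is affected tends to 0. Chaining is used twice: on a fixed cube it upgrades the
pointwise Chebyshev estimate to uniform local asymptotic normality
(`tendsto_measure_exists_lt_abs`), and over dyadic shells it shows that the negative quadratic drift
dominates outside a ball of radius M/√n (`exists_measure_nonneg_le`). The latter turns consistency
of the maximizer into √N-consistency, so the expansion applies to it.
`tendsto_measure_not_iSup_logLik_close` combines these facts for a single parameter set. -/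

namespace LRT

open Asymptotics

/-! ### Dyadic grids and chaining on the unit cube -/

/-- The half-open unit cube. -/
def unitCube (k : ℕ) : Set (Fin k → ℝ) := {v | ∀ j, 0 ≤ v j ∧ v j < 1}

/-- Coordinatewise rounding down to the dyadic grid of mesh `2⁻ⁱ`. -/
noncomputable def dyadicFloor {k : ℕ} (i : ℕ) (v : Fin k → ℝ) : Fin k → ℝ :=
  fun j => (⌊(2 : ℝ) ^ i * v j⌋₊ : ℝ) / 2 ^ i

lemma dyadicFloor_zero {k : ℕ} {v : Fin k → ℝ} (hv : v ∈ unitCube k) :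
    dyadicFloor 0 v = 0 := by
  ext j
  have : ⌊v j⌋₊ = 0 := Nat.floor_eq_zero.2 (hv j).2
  simp [dyadicFloor, this]

lemma dyadicFloor_mem {k : ℕ} (i : ℕ) {v : Fin k → ℝ} (hv : v ∈ unitCube k) :
    dyadicFloor i v ∈ unitCube k := by
  intro j
  refine ⟨by unfold dyadicFloor; positivity, ?_⟩
  have h1 : (⌊(2 : ℝ) ^ i * v j⌋₊ : ℝ) ≤ 2 ^ i * v j :=
    Nat.floor_le (mul_nonneg (by positivity) (hv j).1)
  unfold dyadicFloor
  rw [div_lt_one (by positivity)]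
  nlinarith [(hv j).2, show (0 : ℝ) < 2 ^ i by positivity]

lemma norm_dyadicFloor_sub_le {k : ℕ} (i : ℕ) {v : Fin k → ℝ} (hv : v ∈ unitCube k) :
    ‖v - dyadicFloor i v‖ ≤ (1 / 2) ^ i := by
  rw [pi_norm_le_iff_of_nonneg (by positivity)]
  intro j
  have h2 : (0 : ℝ) < 2 ^ i := by positivity
  have h1 : (⌊(2 : ℝ) ^ i * v j⌋₊ : ℝ) ≤ 2 ^ i * v j :=
    Nat.floor_le (mul_nonneg (by positivity) (hv j).1)
  have h3 := (Nat.lt_floor_add_one ((2 : ℝ) ^ i * v j)).le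
  simp only [Pi.sub_apply, dyadicFloor, Real.norm_eq_abs]
  rw [abs_le, one_div, inv_pow]
  constructor
  · have : (⌊(2 : ℝ) ^ i * v j⌋₊ : ℝ) / 2 ^ i ≤ v j := by
      rw [div_le_iff₀ h2]; linarith
    have : 0 ≤ ((2 : ℝ) ^ i)⁻¹ := by positivity
    linarith
  · rw [sub_le_iff_le_add, ← one_div, ← add_div, le_div_iff₀ h2]
    linarith

lemma tendsto_dyadicFloor {k : ℕ} {v : Fin k → ℝ} (hv : v ∈ unitCube k) :
    Tendsto (fun i => dyadicFloor i v) atTop (𝓝 v) := by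
  rw [tendsto_iff_norm_sub_tendsto_zero]
  refine squeeze_zero (fun _ => norm_nonneg _)
    (fun i => by rw [norm_sub_rev]; exact norm_dyadicFloor_sub_le i hv)
    (tendsto_pow_atTop_nhds_zero_of_lt_one (by norm_num) (by norm_num))

/-- The point of the dyadic grid of mesh `2⁻ⁱ` with the given indices. -/
noncomputable def gridPoint {k : ℕ} (i : ℕ) (b : Fin k → Fin (2 ^ i)) : Fin k → ℝ :=
  fun j => ((b j : ℕ) : ℝ) / 2 ^ i

lemma gridPoint_mem {k : ℕ} (i : ℕ) (b : Fin k → Fin (2 ^ i)) : gridPoint i b ∈ unitCube k := by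
  intro j
  refine ⟨by unfold gridPoint; positivity, ?_⟩
  unfold gridPoint
  rw [div_lt_one (by positivity)]
  exact_mod_cast (b j).2

lemma dyadicFloor_gridPoint_succ {k : ℕ} (i : ℕ) (b : Fin k → Fin (2 ^ (i + 1))) :
    dyadicFloor i (gridPoint (i + 1) b) = fun j => (((b j : ℕ) / 2 : ℕ) : ℝ) / 2 ^ i := by
  ext j
  have : (2 : ℝ) ^ i * (((b j : ℕ) : ℝ) / 2 ^ (i + 1)) = ((b j : ℕ) : ℝ) / (2 : ℕ) := by
    rw [pow_succ (2 : ℝ)]; push_cast; field_simp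
  simp only [dyadicFloor, gridPoint, this, Nat.floor_div_eq_div]

lemma exists_gridPoint_eq {k : ℕ} (i : ℕ) {v : Fin k → ℝ} (hv : v ∈ unitCube k) :
    ∃ b : Fin k → Fin (2 ^ i), gridPoint i b = dyadicFloor i v := by
  have h : ∀ j, ⌊(2 : ℝ) ^ i * v j⌋₊ < 2 ^ i := by
    intro j
    rw [Nat.floor_lt (mul_nonneg (by positivity) (hv j).1)]
    push_cast
    nlinarith [(hv j).2, show (0 : ℝ) < 2 ^ i by positivity]
  exact ⟨fun j => ⟨_, h j⟩, by ext j; simp [gridPoint, dyadicFloor]⟩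

/-- The grids are nested, so the roundings of v at successive levels form a chain in which each
point is the parent of the next. Only one increment per grid point then has to be controlled at each
level. -/
lemma dyadicFloor_dyadicFloor_succ {k : ℕ} (i : ℕ) (v : Fin k → ℝ) :
    dyadicFloor i (dyadicFloor (i + 1) v) = dyadicFloor i v := by
  ext j
  have h1 : (2 : ℝ) ^ i * ((⌊(2 : ℝ) ^ (i + 1) * v j⌋₊ : ℝ) / 2 ^ (i + 1))
      = (⌊(2 : ℝ) ^ (i + 1) * v j⌋₊ : ℝ) / (2 : ℕ) := by
    rw [pow_succ (2 : ℝ)]; push_cast; field_simp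
  have h2 : (2 : ℝ) ^ i * v j = (2 : ℝ) ^ (i + 1) * v j / (2 : ℕ) := by
    rw [pow_succ]; push_cast; ring
  simp only [dyadicFloor, h1]
  rw [Nat.floor_div_eq_div, h2, Nat.floor_div_natCast]

/-- **Chaining** on the unit cube: polynomial tail bounds for the increments of a continuous
process give a polynomial tail bound for its modulus of continuity along the dyadic grids. -/
theorem measure_dyadic_modulus_le {k : ℕ} {Ω : Type*} [MeasurableSpace Ω] (P : Measure Ω)
    (Y : (Fin k → ℝ) → Ω → ℝ) {K : ℝ} (hK : 0 ≤ K)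
    (hcont : ∀ ω, ContinuousOn (fun v => Y v ω) (unitCube k))
    (hinc : ∀ v ∈ unitCube k, ∀ w ∈ unitCube k, ∀ t > 0,
      P {ω | t * ‖v - w‖ < |Y v ω - Y w ω|} ≤ ENNReal.ofReal (K / t ^ (2 * k + 2)))
    {t : ℝ} (ht : 0 < t) :
    P {ω | ¬ ∀ v ∈ unitCube k, ∀ i, |Y v ω - Y (dyadicFloor i v) ω| ≤ t * (3 / 4) ^ i}
      ≤ ENNReal.ofReal (2 ^ (3 * k + 3) * K / t ^ (2 * k + 2)) := by
  let bad : (i : ℕ) → (Fin k → Fin (2 ^ (i + 1))) → Set Ω := fun i b =>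
    {ω | t / 4 * (3 / 4) ^ i <
      |Y (gridPoint (i + 1) b) ω - Y (dyadicFloor i (gridPoint (i + 1) b)) ω|}
  -- A link at level i has length at most 2⁻⁽ⁱ⁺¹⁾, so the allowance (t/4)(3/4)ⁱ is (t/2)(3/2)ⁱ times
  -- that length.
  have hbad : ∀ i b, P (bad i b) ≤ ENNReal.ofReal (K / (t / 2 * (3 / 2) ^ i) ^ (2 * k + 2)) := by
    intro i b
    have hv := gridPoint_mem (i + 1) b
    refine (measure_mono ?_).trans (hinc _ hv _ (dyadicFloor_mem i hv) (t / 2 * (3 / 2) ^ i)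
      (by positivity))
    intro ω hω
    simp only [bad, Set.mem_ofPred_eq] at hω ⊢
    refine lt_of_le_of_lt ?_ hω
    have hn : ‖gridPoint (i + 1) b - dyadicFloor i (gridPoint (i + 1) b)‖ ≤ (1 / 2) ^ (i + 1) := by
      rw [dyadicFloor_gridPoint_succ, pi_norm_le_iff_of_nonneg (by positivity)]
      intro j
      simp only [Pi.sub_apply, gridPoint, Real.norm_eq_abs]
      have hb : (((b j : ℕ) : ℝ)) = 2 * (((b j : ℕ) / 2 : ℕ) : ℝ) + (((b j : ℕ) % 2 : ℕ) : ℝ) := by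
        exact_mod_cast (Nat.div_add_mod (b j : ℕ) 2).symm
      have hm : ((((b j : ℕ) % 2 : ℕ)) : ℝ) ≤ 1 := by
        exact_mod_cast Nat.le_of_lt_succ (Nat.mod_lt _ two_pos)
      rw [hb]
      have : (2 * (((b j : ℕ) / 2 : ℕ) : ℝ) + (((b j : ℕ) % 2 : ℕ) : ℝ)) / 2 ^ (i + 1)
          - (((b j : ℕ) / 2 : ℕ) : ℝ) / 2 ^ i = (((b j : ℕ) % 2 : ℕ) : ℝ) / 2 ^ (i + 1) := by
        rw [pow_succ (2 : ℝ)]; field_simp; ring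
      rw [this, abs_of_nonneg (by positivity), one_div, inv_pow, div_eq_mul_inv]
      exact mul_le_of_le_one_left (by positivity) hm
    calc t / 2 * (3 / 2) ^ i * ‖gridPoint (i + 1) b - dyadicFloor i (gridPoint (i + 1) b)‖
        ≤ t / 2 * (3 / 2) ^ i * (1 / 2) ^ (i + 1) := by gcongr
      _ = t / 4 * ((3 / 2) ^ i * (1 / 2) ^ i) := by rw [pow_succ]; ring
      _ = t / 4 * (3 / 4) ^ i := by rw [← mul_pow]; norm_num
  have hsub : {ω | ¬ ∀ v ∈ unitCube k, ∀ i, |Y v ω - Y (dyadicFloor i v) ω| ≤ t * (3 / 4) ^ i}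
      ⊆ ⋃ i, ⋃ b, bad i b := by
    intro ω hω
    by_contra hgood
    apply hω
    simp only [Set.mem_iUnion, not_exists, bad, Set.mem_ofPred_eq, not_lt] at hgood
    intro v hv i
    have hstep : ∀ n, |Y (dyadicFloor (n + 1) v) ω - Y (dyadicFloor n v) ω|
        ≤ t / 4 * (3 / 4) ^ n := by
      intro n
      obtain ⟨b, hb⟩ := exists_gridPoint_eq (n + 1) hv
      have := hgood n b
      rwa [hb, dyadicFloor_dyadicFloor_succ] at this
    -- The allowances telescope exactly: (t/4)(3/4)ⁿ = t(3/4)ⁿ - t(3/4)ⁿ⁺¹.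
    have hsum : ∀ n, i ≤ n → |Y (dyadicFloor n v) ω - Y (dyadicFloor i v) ω|
        ≤ t * (3 / 4) ^ i - t * (3 / 4) ^ n := by
      intro n hn
      induction n, hn using Nat.le_induction with
      | base => simp
      | succ n hn ih =>
        have h1 := hstep n
        have h2 := abs_sub_le (Y (dyadicFloor (n + 1) v) ω) (Y (dyadicFloor n v) ω)
          (Y (dyadicFloor i v) ω)
        rw [pow_succ]
        linarith
    have hlim : Tendsto (fun n => |Y (dyadicFloor n v) ω - Y (dyadicFloor i v) ω|) atTop
        (𝓝 |Y v ω - Y (dyadicFloor i v) ω|) := by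
      have hc := (hcont ω v hv).tendsto
      have h1 : Tendsto (fun n => dyadicFloor n v) atTop (𝓝[unitCube k] v) :=
        tendsto_nhdsWithin_iff.2 ⟨tendsto_dyadicFloor hv,
          Eventually.of_forall fun n => dyadicFloor_mem n hv⟩
      exact ((hc.comp h1).sub_const _).abs
    refine le_of_tendsto hlim ?_
    filter_upwards [eventually_ge_atTop i] with n hn
    have : 0 ≤ t * (3 / 4 : ℝ) ^ n := by positivity
    linarith [hsum n hn]
  calc _ ≤ P (⋃ i, ⋃ b, bad i b) := measure_mono hsub
    _ ≤ ∑' i, P (⋃ b, bad i b) := measure_iUnion_le _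
    _ ≤ ∑' i, ENNReal.ofReal (2 ^ (3 * k + 2) * K / t ^ (2 * k + 2) * (4 / 9) ^ i) := by
        refine ENNReal.tsum_le_tsum fun i => ?_
        refine (measure_iUnion_fintype_le P _).trans ?_
        refine (Finset.sum_le_sum fun b _ => hbad i b).trans ?_
        rw [Finset.sum_const, nsmul_eq_mul, ← ENNReal.ofReal_natCast,
          ← ENNReal.ofReal_mul (by positivity)]
        refine ENNReal.ofReal_le_ofReal ?_
        have hcard : ((Finset.univ : Finset (Fin k → Fin (2 ^ (i + 1)))).card : ℝ)
            = 2 ^ k * (2 ^ k) ^ i := by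
          simp [Fintype.card_pi]
          rw [← pow_mul, ← pow_mul, ← pow_add]; congr 1; ring
        rw [hcard]
        have e1 : (t / 2 * (3 / 2) ^ i) ^ (2 * k + 2)
            = t ^ (2 * k + 2) / 2 ^ (2 * k + 2) * ((9 / 4) ^ (k + 1)) ^ i := by
          have : ((9 : ℝ) / 4) = (3 / 2) ^ 2 := by norm_num
          rw [this, mul_pow, div_pow, ← pow_mul, ← pow_mul, ← pow_mul]
          congr 2; ring
        rw [e1]
        have e2 : (2 : ℝ) ^ k * (2 ^ k) ^ i *
            (K / (t ^ (2 * k + 2) / 2 ^ (2 * k + 2) * ((9 / 4) ^ (k + 1)) ^ i))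
            = 2 ^ (3 * k + 2) * K / t ^ (2 * k + 2) * (2 ^ k / (9 / 4) ^ (k + 1)) ^ i := by
          have hc : (0 : ℝ) < (9 / 4) ^ (k + 1) := by positivity
          generalize ((9 : ℝ) / 4) ^ (k + 1) = c at hc
          rw [div_pow, show 3 * k + 2 = k + (2 * k + 2) by ring, pow_add 2 k]
          field_simp
        rw [e2]
        -- Here the exponent 2k + 2 pays off: from one level to the next the number of grid points
        -- grows by 2ᵏ, while each probability bound shrinks by (9/4)ᵏ⁺¹, leaving a ratio of at most
        -- 4/9.
        refine mul_le_mul_of_nonneg_left (pow_le_pow_left₀ (by positivity) ?_ i) (by positivity)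
        rw [div_le_div_iff₀ (by positivity) (by norm_num), pow_succ]
        have : (2 : ℝ) ^ k ≤ (9 / 4) ^ k := by gcongr; norm_num
        linarith
    _ ≤ _ := by
        rw [← ENNReal.ofReal_tsum_of_nonneg (fun i => by positivity)
          ((summable_geometric_of_lt_one (by norm_num) (by norm_num)).mul_left _)]
        refine ENNReal.ofReal_le_ofReal ?_
        rw [tsum_mul_left, tsum_geometric_of_lt_one (by norm_num) (by norm_num),
          show 3 * k + 3 = 3 * k + 2 + 1 by ring, pow_succ _ (3 * k + 2)]
        have : 0 ≤ 2 ^ (3 * k + 2) * K / t ^ (2 * k + 2) := by positivity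
        calc 2 ^ (3 * k + 2) * K / t ^ (2 * k + 2) * (1 - 4 / 9 : ℝ)⁻¹
            ≤ 2 ^ (3 * k + 2) * K / t ^ (2 * k + 2) * 2 := by gcongr; norm_num
          _ = _ := by ring

/-! ### Tail bounds for i.i.d. sums -/

section IIDSums

set_option linter.unusedSectionVars false

variable {Ω 𝓧 : Type*} [MeasurableSpace Ω] [MeasurableSpace 𝓧] {P : Measure Ω}
  [IsProbabilityMeasure P] {Q : Measure 𝓧} [IsProbabilityMeasure Q] {X : ℕ → Ω → 𝓧}

lemma integral_comp_of_hasLaw {i : ℕ} (hlaw : ∀ i, HasLaw (X i) Q P) {f : 𝓧 → ℝ}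
    (hf : Measurable f) : ∫ ω, f (X i ω) ∂P = ∫ x, f x ∂Q :=
  (hlaw i).integral_comp hf.aestronglyMeasurable

lemma memLp_comp_of_hasLaw {i : ℕ} (hlaw : ∀ i, HasLaw (X i) Q P) {f : 𝓧 → ℝ}
    (hf : MemLp f 2 Q) : MemLp (fun ω => f (X i ω)) 2 P := by
  rw [← (hlaw i).map_eq] at hf
  exact hf.comp_of_map (hlaw i).aemeasurable

/-- **Chebyshev's inequality** for centred sums of i.i.d. random variables. -/
lemma measure_le_abs_sum_sub_le (hindep : iIndepFun X P) (hlaw : ∀ i, HasLaw (X i) Q P)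
    {f : 𝓧 → ℝ} (hf : Measurable f) (hf2 : MemLp f 2 Q) (n : ℕ) {a : ℝ} (ha : 0 < a) :
    P {ω | a ≤ |∑ i ∈ Finset.range n, (f (X i ω) - ∫ x, f x ∂Q)|}
      ≤ ENNReal.ofReal (n * (∫ x, f x ^ 2 ∂Q) / a ^ 2) := by
  have hL : ∀ i, MemLp (fun ω => f (X i ω)) 2 P := fun i => memLp_comp_of_hasLaw hlaw hf2
  have hI : iIndepFun (fun i ω => f (X i ω)) P := hindep.comp (fun _ => f) (fun _ => hf)
  have hv : variance (∑ i ∈ Finset.range n, fun ω => f (X i ω)) P ≤ n * ∫ x, f x ^ 2 ∂Q := by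
    rw [IndepFun.variance_sum (fun i _ => hL i) (fun i _ j _ hij => hI.indepFun hij)]
    calc ∑ i ∈ Finset.range n, variance (fun ω => f (X i ω)) P
        ≤ ∑ i ∈ Finset.range n, ∫ x, f x ^ 2 ∂Q := by
          refine Finset.sum_le_sum fun i _ => ?_
          refine (variance_le_expectation_sq (hL i).1).trans_eq ?_
          exact integral_comp_of_hasLaw hlaw (f := fun x => f x ^ 2) (hf.pow_const 2)
      _ = _ := by simp
  have hs : MemLp (∑ i ∈ Finset.range n, fun ω => f (X i ω)) 2 P :=
    memLp_finsetSum' _ fun i _ => hL i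
  have hE : P[∑ i ∈ Finset.range n, fun ω => f (X i ω)] = n * ∫ x, f x ∂Q := by
    simp only [Finset.sum_apply]
    rw [integral_finsetSum _ fun i _ => (hL i).integrable (by norm_num)]
    simp [integral_comp_of_hasLaw hlaw hf]
  refine (le_of_eq ?_).trans ((meas_ge_le_variance_div_sq hs ha).trans
    (ENNReal.ofReal_le_ofReal (by gcongr)))
  rw [hE]
  simp [Finset.sum_sub_distrib]

/-- An exponential inequality for sums of bounded centred i.i.d. random variables. -/
lemma measure_le_sum_le_exp (hindep : iIndepFun X P) (hlaw : ∀ i, HasLaw (X i) Q P)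
    {z : 𝓧 → ℝ} (hz : Measurable z) (hz1 : ∀ x, |z x| ≤ 1) (hz0 : ∫ x, z x ∂Q = 0)
    {n : ℕ} {v : ℝ} (hv : n * ∫ x, z x ^ 2 ∂Q ≤ v) (a : ℝ) :
    P {ω | a ≤ ∑ i ∈ Finset.range n, z (X i ω)} ≤ ENNReal.ofReal (Real.exp (v - a)) := by
  have hI : iIndepFun (fun i ω => z (X i ω)) P := hindep.comp (fun _ => z) (fun _ => hz)
  have hm : ∀ i, AEMeasurable (fun ω => z (X i ω)) P :=
    fun i => hz.comp_aemeasurable (hlaw i).aemeasurable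
  have hzi : Integrable z Q := Integrable.of_bound hz.aestronglyMeasurable 1 (ae_of_all _ hz1)
  have hz2 : ∀ x, z x ^ 2 ≤ 1 := fun x => by
    rw [← sq_abs]; exact pow_le_one₀ (abs_nonneg _) (hz1 x)
  have hzi2 : Integrable (fun x => z x ^ 2) Q :=
    Integrable.of_bound (hz.pow_const 2).aestronglyMeasurable 1
      (ae_of_all _ fun x => by rw [Real.norm_eq_abs, abs_of_nonneg (sq_nonneg _)]; exact hz2 x)
  have hexp : Integrable (fun x => Real.exp (z x)) Q :=
    Integrable.of_bound hz.exp.aestronglyMeasurable (Real.exp 1) (ae_of_all _ fun x => by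
      rw [Real.norm_eq_abs, abs_of_pos (Real.exp_pos _)]
      exact Real.exp_le_exp.2 ((le_abs_self _).trans (hz1 x)))
  -- For |z| ≤ 1 one has exp z ≤ 1 + z + z², and the linear term integrates to 0.
  have h1 : ∫ x, Real.exp (z x) ∂Q ≤ Real.exp (∫ x, z x ^ 2 ∂Q) := by
    calc ∫ x, Real.exp (z x) ∂Q ≤ ∫ x, (1 + z x + z x ^ 2) ∂Q := by
          refine integral_mono hexp (((integrable_const 1).add hzi).add hzi2) fun x => ?_
          have := (abs_le.1 (Real.abs_exp_sub_one_sub_id_le (hz1 x))).2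
          simp only; linarith
      _ = 1 + ∫ x, z x ^ 2 ∂Q := by
          have h := integral_add ((integrable_const (1 : ℝ)).add hzi) hzi2
          have h' := integral_add (integrable_const (1 : ℝ)) hzi
          simp only [Pi.add_apply] at h
          rw [h, h', hz0]
          simp
      _ ≤ _ := by rw [add_comm]; exact Real.add_one_le_exp _
  have hmgf : mgf (∑ i ∈ Finset.range n, fun ω => z (X i ω)) P 1 ≤ Real.exp v := by
    rw [hI.mgf_sum₀ hm]
    calc ∏ i ∈ Finset.range n, mgf (fun ω => z (X i ω)) P 1
        = ∏ i ∈ Finset.range n, ∫ x, Real.exp (z x) ∂Q := by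
          refine Finset.prod_congr rfl fun i _ => ?_
          simp only [mgf, one_mul]
          exact integral_comp_of_hasLaw hlaw (f := fun x => Real.exp (z x)) hz.exp
      _ ≤ ∏ i ∈ Finset.range n, Real.exp (∫ x, z x ^ 2 ∂Q) :=
          Finset.prod_le_prod (fun _ _ => integral_nonneg fun _ => (Real.exp_pos _).le)
            fun _ _ => h1
      _ = Real.exp (n * ∫ x, z x ^ 2 ∂Q) := by simp [← Real.exp_nat_mul]
      _ ≤ _ := Real.exp_le_exp.2 hv
  have hint : Integrable
      (fun ω => Real.exp (1 * (∑ i ∈ Finset.range n, fun ω => z (X i ω)) ω)) P := by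
    refine Integrable.of_bound ?_ (Real.exp n) (ae_of_all _ fun ω => ?_)
    · refine (Real.measurable_exp.comp_aemeasurable ?_).aestronglyMeasurable
      exact (Finset.aemeasurable_sum _ fun i _ => hm i).const_mul 1
    · rw [Real.norm_eq_abs, abs_of_pos (Real.exp_pos _), one_mul, Finset.sum_apply]
      refine Real.exp_le_exp.2 ((Finset.sum_le_sum fun i _ =>
        (le_abs_self _).trans (hz1 (X i ω))).trans ?_)
      simp
  have := measure_ge_le_exp_mul_mgf (μ := P) a zero_le_one hint
  have hmgf := mgf_nonneg (X := ∑ i ∈ Finset.range n, fun ω => z (X i ω)) (μ := P) (t := 1)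
  rw [measureReal_def, ← ENNReal.ofReal_le_ofReal_iff (mul_nonneg (Real.exp_pos _).le hmgf),
    ENNReal.ofReal_toReal (measure_ne_top _ _)] at this
  simp only [Finset.sum_apply] at this
  refine this.trans (ENNReal.ofReal_le_ofReal ?_)
  rw [sub_eq_add_neg, add_comm, Real.exp_add, neg_one_mul]
  gcongr

/-- A polynomial tail bound for centred i.i.d. sums of functions bounded by a multiple of a
square-integrable envelope truncated at level `√n`. -/
lemma measure_lt_abs_sum_sub_le (hindep : iIndepFun X P) (hlaw : ∀ i, HasLaw (X i) Q P)
    {n : ℕ} (hn : 0 < n) {f g : 𝓧 → ℝ} (hf : Measurable f)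
    (hgn : ∀ x, g x ≤ √n) {σ d : ℝ} (hg2 : Integrable (fun x => g x ^ 2) Q)
    (hσ : ∫ x, g x ^ 2 ∂Q ≤ σ)
    (hd : 0 ≤ d) (hfg : ∀ x, |f x| ≤ g x * (d / √n)) (q : ℕ) {t : ℝ} (ht : 0 < t) :
    P {ω | t * d < |∑ i ∈ Finset.range n, (f (X i ω) - ∫ x, f x ∂Q)|}
      ≤ ENNReal.ofReal (2 * Real.exp σ * (q.factorial * 2 ^ q) / t ^ q) := by
  have hsn : 0 < √(n : ℝ) := Real.sqrt_pos.2 (by exact_mod_cast hn)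
  rcases hd.eq_or_lt with rfl | hd
  · have hf0 : ∀ x, f x = 0 := fun x => by simpa using hfg x
    simp [hf0]
  have hfd : ∀ x, |f x| ≤ d := fun x => (hfg x).trans <| by
    calc g x * (d / √n) ≤ √n * (d / √n) := by gcongr; exact hgn x
      _ = d := by field_simp
  have hfi : Integrable f Q := Integrable.of_bound hf.aestronglyMeasurable d (ae_of_all _ hfd)
  have hfi2 : MemLp f 2 Q := MemLp.of_bound hf.aestronglyMeasurable d (ae_of_all _ hfd)
  set c := ∫ x, f x ∂Q with hc
  have hcd : |c| ≤ d := by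
    simpa using norm_integral_le_of_norm_le_const (μ := Q) (f := f) (ae_of_all _ hfd)
  -- Since |f| ≤ d and |c| ≤ d, this centring and scaling gives |z| ≤ 1. The event becomes |∑ z| >
  -- t/2.
  set z : 𝓧 → ℝ := fun x => (f x - c) / (2 * d) with hzdef
  have hzm : Measurable z := (hf.sub_const c).div_const _
  have hz1 : ∀ x, |z x| ≤ 1 := fun x => by
    rw [hzdef, abs_div, abs_of_pos (by positivity : 0 < 2 * d), div_le_one (by positivity)]
    linarith [abs_sub (f x) c, hfd x]
  have hz0 : ∫ x, z x ∂Q = 0 := by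
    rw [hzdef, integral_div, integral_sub hfi (integrable_const _)]
    simp [hc]
  have hz2 : n * ∫ x, z x ^ 2 ∂Q ≤ σ := by
    have h1 : ∫ x, z x ^ 2 ∂Q = (∫ x, (f x - c) ^ 2 ∂Q) / (2 * d) ^ 2 := by
      simp only [hzdef, div_pow]; rw [integral_div]
    have h2 : ∫ x, (f x - c) ^ 2 ∂Q ≤ ∫ x, f x ^ 2 ∂Q := by
      rw [hc, ← variance_eq_integral hf.aemeasurable]
      exact variance_le_expectation_sq hf.aestronglyMeasurable
    have h3 : ∫ x, f x ^ 2 ∂Q ≤ d ^ 2 / n * ∫ x, g x ^ 2 ∂Q := by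
      rw [← integral_const_mul]
      refine integral_mono hfi2.integrable_sq (hg2.const_mul _) fun x => ?_
      have := pow_le_pow_left₀ (abs_nonneg _) (hfg x) 2
      rw [sq_abs, mul_pow, div_pow, Real.sq_sqrt (Nat.cast_nonneg n)] at this
      simp only; linarith
    have hσ0 : 0 ≤ ∫ x, g x ^ 2 ∂Q := integral_nonneg fun _ => sq_nonneg _
    have hn' : (0 : ℝ) < n := by exact_mod_cast hn
    rw [h1]
    calc n * ((∫ x, (f x - c) ^ 2 ∂Q) / (2 * d) ^ 2)
        ≤ n * ((d ^ 2 / n * ∫ x, g x ^ 2 ∂Q) / (2 * d) ^ 2) := by gcongr; exact h2.trans h3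
      _ = (∫ x, g x ^ 2 ∂Q) / 4 := by field_simp; norm_num
      _ ≤ σ := by linarith
  have hup := measure_le_sum_le_exp hindep hlaw hzm hz1 hz0 hz2 (t / 2)
  have hlo := measure_le_sum_le_exp hindep hlaw (z := fun x => - z x) hzm.neg
    (by simpa using hz1) (by rw [integral_neg, hz0, neg_zero]) (by simpa using hz2) (t / 2)
  have hsub : {ω | t * d < |∑ i ∈ Finset.range n, (f (X i ω) - c)|} ⊆
      {ω | t / 2 ≤ ∑ i ∈ Finset.range n, z (X i ω)} ∪
      {ω | t / 2 ≤ ∑ i ∈ Finset.range n, - z (X i ω)} := by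
    intro ω hω
    have hs : ∑ i ∈ Finset.range n, (f (X i ω) - c) = 2 * d * ∑ i ∈ Finset.range n, z (X i ω) := by
      rw [Finset.mul_sum]
      refine Finset.sum_congr rfl fun i _ => ?_
      simp only [hzdef]; field_simp
    simp only [Set.mem_ofPred_eq, hs, Set.mem_union, Finset.sum_neg_distrib] at hω ⊢
    rw [abs_mul, abs_of_pos (by positivity : 0 < 2 * d)] at hω
    have : t / 2 < |∑ i ∈ Finset.range n, z (X i ω)| := by
      by_contra h
      push Not at h
      nlinarith
    rcases lt_abs.1 this with h | h
    · exact Or.inl h.le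
    · exact Or.inr h.le
  refine (measure_mono hsub).trans ((measure_union_le _ _).trans ((add_le_add hup hlo).trans ?_))
  rw [← ENNReal.ofReal_add (Real.exp_pos _).le (Real.exp_pos _).le]
  refine ENNReal.ofReal_le_ofReal ?_
  -- The exponential bound exp(σ - t/2) is weakened to a power of t, which is all that chaining
  -- needs.
  have h1 := Real.pow_div_factorial_le_exp (t / 2) (by positivity) q
  rw [div_le_iff₀ (by positivity), div_pow, div_le_iff₀ (by positivity)] at h1
  rw [le_div_iff₀ (by positivity), Real.exp_sub]
  have he := Real.exp_pos (t / 2)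
  calc (Real.exp σ / Real.exp (t / 2) + Real.exp σ / Real.exp (t / 2)) * t ^ q
      = 2 * Real.exp σ * (t ^ q / Real.exp (t / 2)) := by ring
    _ ≤ 2 * Real.exp σ * (q.factorial * 2 ^ q) := by
        gcongr
        rw [div_le_iff₀ he]
        linarith

end IIDSums

/-! ### Tangent cones and distances to rescaled parameter sets -/

section TangentCone

variable {k : ℕ} {S : Set (EuclideanSpace ℝ (Fin k))} {θs : EuclideanSpace ℝ (Fin k)}

/-- Replacing sequences by an ε-criterion spares the diagonal argument in the proof of closedness.
-/
lemma mem_tangentCone_iff {τ : EuclideanSpace ℝ (Fin k)} :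
    τ ∈ tangentCone S θs ↔
      ∀ ε > (0 : ℝ), ∃ a > (0 : ℝ), ∃ θ ∈ S, dist θ θs < ε ∧ dist (a • (θ - θs)) τ < ε := by
  constructor
  · rintro ⟨a, θ, ha, hθ, h1, h2⟩ ε hε
    obtain ⟨n, hn1, hn2⟩ := ((Metric.tendsto_nhds.1 h1 ε hε).and
      (Metric.tendsto_nhds.1 h2 ε hε)).exists
    exact ⟨a n, ha n, θ n, hθ n, hn1, hn2⟩
  · intro h
    have h' : ∀ n : ℕ, ∃ a > (0 : ℝ), ∃ θ ∈ S, dist θ θs < 1 / ((n : ℝ) + 1) ∧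
        dist (a • (θ - θs)) τ < 1 / ((n : ℝ) + 1) := fun n => h _ (by positivity)
    choose a ha θ hθ h1 h2 using h'
    refine ⟨a, θ, ha, hθ, ?_, ?_⟩
    · rw [tendsto_iff_dist_tendsto_zero]
      exact squeeze_zero (fun _ => dist_nonneg) (fun n => (h1 n).le)
        tendsto_one_div_add_atTop_nhds_zero_nat
    · rw [tendsto_iff_dist_tendsto_zero]
      exact squeeze_zero (fun _ => dist_nonneg) (fun n => (h2 n).le)
        tendsto_one_div_add_atTop_nhds_zero_nat

lemma isClosed_tangentCone : IsClosed (tangentCone S θs) := by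
  refine isClosed_of_closure_subset fun τ hτ => mem_tangentCone_iff.2 fun ε hε => ?_
  obtain ⟨τ', hτ', hd⟩ := Metric.mem_closure_iff.1 hτ (ε / 2) (by positivity)
  obtain ⟨a, ha, θ, hθ, h1, h2⟩ := mem_tangentCone_iff.1 hτ' (ε / 2) (by positivity)
  refine ⟨a, ha, θ, hθ, by linarith, ?_⟩
  have := dist_triangle (a • (θ - θs)) τ' τ
  rw [dist_comm τ' τ] at this
  linarith

lemma zero_mem_tangentCone (h : θs ∈ S) : (0 : EuclideanSpace ℝ (Fin k)) ∈ tangentCone S θs :=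
  ⟨fun _ => 1, fun _ => θs, fun _ => one_pos, fun _ => h, tendsto_const_nhds, by simp⟩

/-- The set of rescaled parameters `√N (θ - θs)`, `θ ∈ S`. -/
def localSet (S : Set (EuclideanSpace ℝ (Fin k))) (θs : EuclideanSpace ℝ (Fin k)) (N : ℕ) :
    Set (EuclideanSpace ℝ (Fin k)) :=
  {h | θs + (√(N : ℝ))⁻¹ • h ∈ S}

lemma zero_mem_localSet (h : θs ∈ S) (N : ℕ) :
    (0 : EuclideanSpace ℝ (Fin k)) ∈ localSet S θs N := by
  simpa [localSet] using h

lemma tendsto_inv_sqrt_natCast : Tendsto (fun N : ℕ => (√(N : ℝ))⁻¹) atTop (𝓝 0) :=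
  tendsto_inv_atTop_zero.comp (Real.tendsto_sqrt_atTop.comp tendsto_natCast_atTop_atTop)

variable {A : EuclideanSpace ℝ (Fin k) →L[ℝ] EuclideanSpace ℝ (Fin k)} {c : ℝ}

lemma isClosed_image_of_le_norm (hc : 0 < c) (hA : ∀ x, c * ‖x‖ ≤ ‖A x‖)
    {T : Set (EuclideanSpace ℝ (Fin k))} (hT : IsClosed T) : IsClosed (A '' T) := by
  have hanti : AntilipschitzWith (Real.toNNReal c)⁻¹ A := by
    refine AddMonoidHomClass.antilipschitz_of_bound A fun x => ?_
    rw [NNReal.coe_inv, Real.coe_toNNReal c hc.le, inv_mul_eq_div, le_div_iff₀ hc]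
    linarith [hA x]
  exact (hanti.isClosedEmbedding A.uniformContinuous).isClosedMap _ hT

/-- The tangent cone is closed, and a linear map bounded below keeps its image closed, so a nearest
point exists in finite dimension. The cone need not be convex and the minimizer need not be unique.
-/
lemma minSqDist_eq_and_isLeast (hθs : θs ∈ S) (M : Matrix (Fin k) (Fin k) ℝ) (hc : 0 < c)
    (hA : ∀ x, c * ‖x‖ ≤ ‖sqrtMap M x‖) (z : EuclideanSpace ℝ (Fin k)) :
    minSqDist M (tangentCone S θs) z = Metric.infDist z (sqrtMap M '' tangentCone S θs) ^ 2 ∧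
    IsLeast (sqDistSet M (tangentCone S θs) z) (minSqDist M (tangentCone S θs) z) := by
  have hne : (sqrtMap M '' tangentCone S θs).Nonempty := ⟨_, 0, zero_mem_tangentCone hθs, rfl⟩
  obtain ⟨_, ⟨τ, hτ, rfl⟩, hd⟩ :=
    (isClosed_image_of_le_norm hc hA isClosed_tangentCone).exists_infDist_eq_dist hne z
  have hl : IsLeast (sqDistSet M (tangentCone S θs) z)
      (Metric.infDist z (sqrtMap M '' tangentCone S θs) ^ 2) := by
    refine ⟨⟨τ, hτ, by rw [hd, dist_eq_norm]⟩, ?_⟩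
    rintro _ ⟨τ', hτ', rfl⟩
    simp only [← dist_eq_norm]
    exact pow_le_pow_left₀ Metric.infDist_nonneg
      (Metric.infDist_le_dist_of_mem (Set.mem_image_of_mem _ hτ')) 2
  have he : minSqDist M (tangentCone S θs) z
      = Metric.infDist z (sqrtMap M '' tangentCone S θs) ^ 2 := hl.csInf_eq
  exact ⟨he, he ▸ hl⟩

/-- The two bounds have different sources. Points of the rescaled sets that stay close to z are
bounded, and their subsequential limits are tangent vectors by definition, so the distance cannot
drop below that to the cone. Conversely, a tangent vector must be approximated at every scale 1/√N
and not merely along some sequence of scales; this is exactly what Chernoff regularity provides. -/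
lemma tendsto_infDist_localSet (hθs : θs ∈ S) (hS : ChernoffRegular S θs) (hc : 0 < c)
    (hA : ∀ x, c * ‖x‖ ≤ ‖A x‖) (z : EuclideanSpace ℝ (Fin k)) :
    Tendsto (fun N => Metric.infDist z (A '' localSet S θs N)) atTop
      (𝓝 (Metric.infDist z (A '' tangentCone S θs))) := by
  have hne : (A '' tangentCone S θs).Nonempty := ⟨_, 0, zero_mem_tangentCone hθs, rfl⟩
  refine tendsto_order.2 ⟨fun r hr => ?_, fun r hr => ?_⟩
  · by_contra hcon
    rw [not_eventually] at hcon
    -- Indices are kept positive because √N serves as the multiplier in the tangent cone.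
    obtain ⟨φ, hφ, hlow⟩ := extraction_of_frequently_atTop
      (hcon.and_eventually (eventually_gt_atTop 0))
    obtain ⟨r', hr', hr'2⟩ := exists_between hr
    have hex : ∀ n, ∃ h ∈ localSet S θs (φ n), dist z (A h) < r' := by
      intro n
      have h1 := (not_lt.1 (hlow n).1).trans_lt hr'
      obtain ⟨_, ⟨h, hh, rfl⟩, hlt⟩ := (Metric.infDist_lt_iff
        (Set.Nonempty.image A ⟨0, zero_mem_localSet hθs (φ n)⟩)).1 h1
      exact ⟨h, hh, hlt⟩
    choose h hh hlt using hex
    have hbdd : ∀ n, h n ∈ Metric.closedBall (0 : EuclideanSpace ℝ (Fin k)) ((‖z‖ + r') / c) := by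
      intro n
      rw [mem_closedBall_zero_iff, le_div_iff₀ hc]
      have h1 := hA (h n)
      have h2 := norm_le_norm_add_norm_sub' (A (h n)) z
      have h3 := hlt n
      rw [dist_comm, dist_eq_norm] at h3
      linarith
    obtain ⟨τ, -, ψ, hψ, hlim⟩ := tendsto_subseq_of_bounded Metric.isBounded_closedBall hbdd
    have hψt : Tendsto (fun n => (√(φ (ψ n) : ℝ))⁻¹) atTop (𝓝 0) :=
      tendsto_inv_sqrt_natCast.comp (hφ.comp hψ).tendsto_atTop
    have hpos : ∀ n, 0 < √(φ (ψ n) : ℝ) := fun n =>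
      Real.sqrt_pos.2 (by exact_mod_cast (hlow (ψ n)).2)
    have hτ : τ ∈ tangentCone S θs := by
      refine ⟨fun n => √(φ (ψ n) : ℝ), fun n => θs + (√(φ (ψ n) : ℝ))⁻¹ • h (ψ n), hpos,
        fun n => hh (ψ n), ?_, ?_⟩
      · simpa using (hψt.smul hlim).const_add θs
      · refine hlim.congr fun n => ?_
        simp [smul_smul, (hpos n).ne']
    have hle : dist z (A τ) ≤ r' := by
      refine le_of_tendsto (Tendsto.dist tendsto_const_nhds ((A.continuous.tendsto τ).comp hlim))
        (Eventually.of_forall fun n => (hlt (ψ n)).le)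
    exact absurd (Metric.infDist_le_dist_of_mem (x := z) (Set.mem_image_of_mem A hτ))
      (not_le.2 (hle.trans_lt hr'2))
  · obtain ⟨_, ⟨τ, hτ, rfl⟩, hd⟩ :=
      (Metric.infDist_lt_iff hne).1 hr
    obtain ⟨ε, hε, α, hαS, hα0, hα⟩ := hS τ hτ
    have hpos : ∀ᶠ N : ℕ in atTop, 0 < (√(N : ℝ))⁻¹ := by
      filter_upwards [eventually_gt_atTop 0] with N hN
      exact inv_pos.2 (Real.sqrt_pos.2 (by exact_mod_cast hN))
    have ht : Tendsto (fun N : ℕ => (√(N : ℝ))⁻¹) atTop (𝓝[>] 0) :=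
      tendsto_nhdsWithin_iff.2 ⟨tendsto_inv_sqrt_natCast, hpos⟩
    have hlim := hα.comp ht
    have hdist : Tendsto (fun N : ℕ => dist z (A ((√(N : ℝ))⁻¹⁻¹ • (α (√(N : ℝ))⁻¹ - α 0)))) atTop
        (𝓝 (dist z (A τ))) :=
      Tendsto.dist tendsto_const_nhds ((A.continuous.tendsto τ).comp hlim)
    filter_upwards [(tendsto_order.1 hdist).2 r hd, hpos,
      (tendsto_order.1 tendsto_inv_sqrt_natCast).2 ε hε] with N h1 h2 h3
    refine (Metric.infDist_le_dist_of_mem (Set.mem_image_of_mem A ?_)).trans_lt h1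
    simp only [localSet, Set.mem_ofPred_eq]
    rw [smul_smul, mul_inv_cancel₀ h2.ne', one_smul, hα0, add_sub_cancel]
    exact hαS _ ⟨h2.le, h3⟩

/-- Distance functions are 1-Lipschitz, so pointwise convergence on a finite ε/3-net of the ball is
already uniform. Uniformity is needed because the lemma is later evaluated at a random point. -/
lemma eventually_forall_infDist_localSet (hθs : θs ∈ S) (hS : ChernoffRegular S θs) (hc : 0 < c)
    (hA : ∀ x, c * ‖x‖ ≤ ‖A x‖) (R : ℝ) {ε : ℝ} (hε : 0 < ε) :
    ∀ᶠ N in atTop, ∀ z, ‖z‖ ≤ R →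
      |Metric.infDist z (A '' localSet S θs N) - Metric.infDist z (A '' tangentCone S θs)| < ε := by
  obtain ⟨t, ht, hcov⟩ := Metric.totallyBounded_iff.1
    (isCompact_closedBall (0 : EuclideanSpace ℝ (Fin k)) R).totallyBounded (ε / 3) (by positivity)
  have h1 : ∀ᶠ N in atTop, ∀ y ∈ t,
      dist (Metric.infDist y (A '' localSet S θs N)) (Metric.infDist y (A '' tangentCone S θs))
        < ε / 3 :=
    (eventually_all_finite ht).2 fun y _ =>
      Metric.tendsto_nhds.1 (tendsto_infDist_localSet hθs hS hc hA y) _ (by positivity)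
  filter_upwards [h1] with N hN z hz
  obtain ⟨y, hy, hzy⟩ := Set.mem_iUnion₂.1 (hcov (mem_closedBall_zero_iff.2 hz))
  have e1 := (Metric.lipschitz_infDist_pt (A '' localSet S θs N)).dist_le_mul z y
  have e2 := (Metric.lipschitz_infDist_pt (A '' tangentCone S θs)).dist_le_mul z y
  have e3 := hN y hy
  rw [Metric.mem_ball] at hzy
  simp only [NNReal.coe_one, one_mul, Real.dist_eq] at e1 e2 e3
  rw [abs_le] at e1 e2
  rw [abs_lt] at e3 ⊢
  constructor <;> linarith [e1.1, e1.2, e2.1, e2.2, e3.1, e3.2]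

lemma infDist_image_le_norm {T : Set (EuclideanSpace ℝ (Fin k))}
    (hT : (0 : EuclideanSpace ℝ (Fin k)) ∈ T) (z : EuclideanSpace ℝ (Fin k)) :
    Metric.infDist z (A '' T) ≤ ‖z‖ := by
  simpa using Metric.infDist_le_dist_of_mem (x := z) (Set.mem_image_of_mem A hT)

lemma eventually_forall_sq_infDist_localSet (hθs : θs ∈ S) (hS : ChernoffRegular S θs)
    (hc : 0 < c) (hA : ∀ x, c * ‖x‖ ≤ ‖A x‖) (R : ℝ) {ε : ℝ} (hε : 0 < ε) :
    ∀ᶠ N in atTop, ∀ z, ‖z‖ ≤ R →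
      |Metric.infDist z (A '' localSet S θs N) ^ 2
        - Metric.infDist z (A '' tangentCone S θs) ^ 2| < ε := by
  have hR : 0 < 2 * |R| + 1 := by positivity
  filter_upwards [eventually_forall_infDist_localSet hθs hS hc hA R (div_pos hε hR)] with N hN z hz
  have h1 := infDist_image_le_norm (A := A) (zero_mem_localSet hθs N) z
  have h2 := infDist_image_le_norm (A := A) (zero_mem_tangentCone hθs) z
  have h3 := hN z hz
  have h4 := Metric.infDist_nonneg (x := z) (s := A '' localSet S θs N)
  have h5 := Metric.infDist_nonneg (x := z) (s := A '' tangentCone S θs)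
  rw [sq_sub_sq, abs_mul, abs_of_nonneg (by positivity)]
  rw [lt_div_iff₀ hR] at h3
  refine lt_of_le_of_lt ?_ h3
  rw [mul_comm]
  refine mul_le_mul_of_nonneg_left ?_ (abs_nonneg _)
  linarith [le_abs_self R]

end TangentCone

/-! ### Multivariate central limit theorem -/

section CentralLimit

variable {Ω Ω' 𝓧 : Type*} [MeasurableSpace Ω] [MeasurableSpace 𝓧] [MeasurableSpace Ω']
  {P : Measure Ω} [IsProbabilityMeasure P] {P' : Measure Ω'} [IsProbabilityMeasure P']
  {Q : Measure 𝓧} [IsProbabilityMeasure Q] {X : ℕ → Ω → 𝓧}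

/-- The multivariate **central limit theorem** for standardized random vectors. -/
theorem tendstoInDistribution_inv_sqrt_smul_sum {E : Type*} [NormedAddCommGroup E]
    [InnerProductSpace ℝ E] [FiniteDimensional ℝ E] [MeasurableSpace E] [BorelSpace E]
    (hindep : iIndepFun X P) (hlaw : ∀ i, HasLaw (X i) Q P) {Y : 𝓧 → E} (hY : Measurable Y)
    (hY2 : ∀ t, MemLp (fun x => ⟪t, Y x⟫) 2 Q)
    (hY0 : ∀ t, ∫ x, ⟪t, Y x⟫ ∂Q = 0) (hY1 : ∀ t, ∫ x, ⟪t, Y x⟫ ^ 2 ∂Q = ‖t‖ ^ 2)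
    {Z : Ω' → E} (hZ : HasLaw Z (stdGaussian E) P') :
    TendstoInDistribution (fun (n : ℕ) ω => (√(n : ℝ))⁻¹ • ∑ i ∈ Finset.range n, Y (X i ω))
      atTop Z (fun _ => P) P' where
  forall_aemeasurable n :=
    (Finset.aemeasurable_fun_sum _ fun i _ =>
      hY.comp_aemeasurable (hlaw i).aemeasurable).const_smul _
  aemeasurable_limit := hZ.aemeasurable
  tendsto := by
    refine ProbabilityMeasure.tendsto_iff_tendsto_charFun.2 fun t => ?_
    have hm : Measurable fun x => ⟪t, Y x⟫ := by fun_prop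
    have hI : iIndepFun (fun i ω => ⟪t, Y (X i ω)⟫) P :=
      hindep.comp (fun _ x => ⟪t, Y x⟫) (fun _ => hm)
    have hid : ∀ i, IdentDistrib (fun ω => ⟪t, Y (X i ω)⟫) (fun ω => ⟪t, Y (X 0 ω)⟫) P P := by
      intro i
      have : IdentDistrib (X i) (X 0) P P :=
        ⟨(hlaw i).aemeasurable, (hlaw 0).aemeasurable, by rw [(hlaw i).map_eq, (hlaw 0).map_eq]⟩
      exact this.comp hm
    have hE : ∫ ω, ⟪t, Y (X 0 ω)⟫ ∂P = 0 :=
      (integral_comp_of_hasLaw hlaw hm).trans (hY0 t)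
    have hvar : Var[fun ω => ⟪t, Y (X 0 ω)⟫; P] = ‖t‖ ^ 2 := by
      rw [variance_of_integral_eq_zero (X := fun ω => ⟪t, Y (X 0 ω)⟫)
        (hm.comp_aemeasurable (hlaw 0).aemeasurable) hE]
      exact (integral_comp_of_hasLaw hlaw (f := fun x => ⟪t, Y x⟫ ^ 2) (hm.pow_const 2)).trans
        (hY1 t)
    have hclt := tendstoInDistribution_inv_sqrt_mul_sum_sub (P := P)
      (X := fun i ω => ⟪t, Y (X i ω)⟫) (Y := id)
      (P' := gaussianReal 0 (Var[fun ω => ⟪t, Y (X 0 ω)⟫; P]).toNNReal) HasLaw.id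
      (memLp_comp_of_hasLaw hlaw (hY2 t)) hI hid
    -- Cramér–Wold: the characteristic function of the vector sum at t is that of the scalar sum of
    -- ⟪t, Y⟫ at frequency 1.
    have hlim := ProbabilityMeasure.tendsto_iff_tendsto_charFun.1 hclt.tendsto 1
    simp only [ProbabilityMeasure.coe_mk, Measure.map_id, hE, mul_zero, sub_zero] at hlim ⊢
    rw [hZ.map_eq, charFun_stdGaussian]
    rw [charFun_gaussianReal, hvar] at hlim
    have e : (Complex.exp (-(‖t‖ : ℂ) ^ 2 / 2)) = Complex.exp (((1 : ℝ) : ℂ) * ((0 : ℝ) : ℂ) * Complex.I -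
        (((‖t‖ ^ 2).toNNReal : ℝ) : ℂ) * ((1 : ℝ) : ℂ) ^ 2 / 2) := by
      rw [Real.coe_toNNReal _ (by positivity)]
      push_cast
      congr 1; ring
    rw [e]
    refine hlim.congr fun n => ?_
    have hS : AEMeasurable (fun ω => ∑ i ∈ Finset.range n, Y (X i ω)) P :=
      Finset.aemeasurable_fun_sum _ fun i _ => hY.comp_aemeasurable (hlaw i).aemeasurable
    have hS' : AEMeasurable (fun ω => ∑ i ∈ Finset.range n, ⟪t, Y (X i ω)⟫) P :=
      Finset.aemeasurable_fun_sum _ fun i _ => hm.comp_aemeasurable (hlaw i).aemeasurable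
    rw [charFun_apply, charFun_apply, integral_map (hS'.const_mul _) (by fun_prop),
      integral_map (φ := fun ω => (√(n : ℝ))⁻¹ • ∑ i ∈ Finset.range n, Y (X i ω))
        (hS.const_smul _) (by fun_prop)]
    congr 1
    ext ω
    rw [real_inner_comm t, inner_smul_right, inner_sum]
    simp

end CentralLimit

/-! ### Local models: integrability and mean of the score -/

section LocalModel

set_option linter.unusedSectionVars false

variable {k : ℕ} {𝓧 : Type*} [MeasurableSpace 𝓧]

/-- A local family of log-likelihood ratios `L h`, with respect to a probability measure `Q`,
that is Lipschitz in `h` with square-integrable Lipschitz constant `m` and whose densities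
`exp (L h)` are differentiable in quadratic mean at `0` with score `s`. -/
structure IsLocalModel (Q : Measure 𝓧) (L : EuclideanSpace ℝ (Fin k) → 𝓧 → ℝ) (m : 𝓧 → ℝ)
    (s : 𝓧 → EuclideanSpace ℝ (Fin k)) (ρ : ℝ) : Prop where
  pos : 0 < ρ
  meas : ∀ h ∈ Metric.ball (0 : EuclideanSpace ℝ (Fin k)) ρ, Measurable (L h)
  lip : ∀ h ∈ Metric.ball (0 : EuclideanSpace ℝ (Fin k)) ρ,
    ∀ h' ∈ Metric.ball (0 : EuclideanSpace ℝ (Fin k)) ρ,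
    ∀ x, |L h x - L h' x| ≤ m x * ‖h - h'‖
  zero : ∀ x, L 0 x = 0
  meas_m : Measurable m
  m_nonneg : ∀ x, 0 ≤ m x
  memLp_m : MemLp m 2 Q
  meas_s : Measurable s
  mass : ∀ h ∈ Metric.ball (0 : EuclideanSpace ℝ (Fin k)) ρ,
    ∫⁻ x, ENNReal.ofReal (Real.exp (L h x)) ∂Q = 1
  dqm : ∀ ε > (0 : ℝ), ∀ᶠ h in 𝓝 (0 : EuclideanSpace ℝ (Fin k)),
    ∫⁻ x, ENNReal.ofReal ((Real.exp (L h x / 2) - 1 - 1 / 2 * ⟪h, s x⟫) ^ 2) ∂Q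
      ≤ ENNReal.ofReal (ε * ‖h‖ ^ 2)

lemma tendsto_integral_indicator_lt {Q : Measure 𝓧} {m G : 𝓧 → ℝ} (hm : Measurable m)
    (hG : Integrable G Q) :
    Tendsto (fun K : ℝ => ∫ x, {x | K < m x}.indicator G x ∂Q) atTop (𝓝 0) := by
  have h := tendsto_integral_filter_of_dominated_convergence (μ := Q) (l := atTop)
    (F := fun (K : ℝ) x => {x | K < m x}.indicator G x) (f := fun _ => 0) (fun x => ‖G x‖)
    (Eventually.of_forall fun K =>
      hG.aestronglyMeasurable.indicator (measurableSet_lt measurable_const hm))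
    (Eventually.of_forall fun K => ae_of_all _ fun x => norm_indicator_le_norm_self _ _)
    hG.norm
    (ae_of_all _ fun x => by
      refine tendsto_const_nhds.congr' ?_
      filter_upwards [eventually_ge_atTop (m x)] with K hK
      simp [hK])
  simpa using h

lemma sq_integral_le {Q : Measure 𝓧} [IsProbabilityMeasure Q] {f : 𝓧 → ℝ} (hf : MemLp f 2 Q) :
    (∫ x, f x ∂Q) ^ 2 ≤ ∫ x, f x ^ 2 ∂Q := by
  have h := variance_nonneg f Q
  rw [variance_eq_sub hf] at h
  simpa using h

/-- By Young's inequality |f² - g²| ≤ (1 + 1/ε)(f - g)² + ε g². Mean-square closeness to a linear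
term thus transfers to second moments. -/
lemma isLittleO_integral_sq_sub {E : Type*} [NormedAddCommGroup E] {Q : Measure 𝓧}
    {f g : E → 𝓧 → ℝ} {l : Filter E} {C : ℝ}
    (hf : ∀ᶠ h in l, MemLp (f h) 2 Q) (hg : ∀ᶠ h in l, MemLp (g h) 2 Q)
    (hC : ∀ᶠ h in l, ∫ x, g h x ^ 2 ∂Q ≤ C * ‖h‖ ^ 2)
    (hfg : (fun h => ∫ x, (f h x - g h x) ^ 2 ∂Q) =o[l] fun h => ‖h‖ ^ 2) :
    (fun h => ∫ x, f h x ^ 2 ∂Q - ∫ x, g h x ^ 2 ∂Q) =o[l] fun h => ‖h‖ ^ 2 := by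
  refine isLittleO_iff.2 fun c hc => ?_
  have hC1 : 0 < |C| + 1 := by positivity
  set ε := c / 2 / (|C| + 1) with hε
  have hε0 : 0 < ε := by positivity
  have hc' : 0 < c / 2 / (1 + 1 / ε) := by positivity
  filter_upwards [hf, hg, hC, isLittleO_iff.1 hfg hc'] with h hfh hgh hCh hD
  have hd : MemLp (fun x => f h x - g h x) 2 Q := hfh.sub hgh
  rw [Real.norm_eq_abs, Real.norm_eq_abs, abs_of_nonneg (integral_nonneg fun _ => sq_nonneg _),
    abs_of_nonneg (sq_nonneg ‖h‖)] at hD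
  rw [Real.norm_eq_abs, Real.norm_eq_abs, abs_of_nonneg (sq_nonneg ‖h‖),
    ← integral_sub hfh.integrable_sq hgh.integrable_sq]
  have hpt : ∀ x, |f h x ^ 2 - g h x ^ 2|
      ≤ (1 + 1 / ε) * (f h x - g h x) ^ 2 + ε * g h x ^ 2 := by
    intro x
    have h1 : 0 ≤ (1 / ε) * ((f h x - g h x) - ε * g h x) ^ 2 := by positivity
    have h2 : 0 ≤ (1 / ε) * ((f h x - g h x) + ε * g h x) ^ 2 := by positivity
    have e1 : (1 / ε) * ((f h x - g h x) - ε * g h x) ^ 2 = 1 / ε * (f h x - g h x) ^ 2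
      - 2 * (f h x - g h x) * g h x + ε * g h x ^ 2 := by field_simp; ring
    have e2 : (1 / ε) * ((f h x - g h x) + ε * g h x) ^ 2 = 1 / ε * (f h x - g h x) ^ 2
      + 2 * (f h x - g h x) * g h x + ε * g h x ^ 2 := by field_simp; ring
    rw [abs_le]
    constructor <;> nlinarith [sq_nonneg (f h x - g h x)]
  calc |∫ x, (f h x ^ 2 - g h x ^ 2) ∂Q|
      ≤ ∫ x, |f h x ^ 2 - g h x ^ 2| ∂Q := abs_integral_le_integral_abs
    _ ≤ ∫ x, ((1 + 1 / ε) * (f h x - g h x) ^ 2 + ε * g h x ^ 2) ∂Q :=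
        integral_mono (hfh.integrable_sq.sub hgh.integrable_sq).abs
          ((hd.integrable_sq.const_mul _).add (hgh.integrable_sq.const_mul _)) hpt
    _ = (1 + 1 / ε) * ∫ x, (f h x - g h x) ^ 2 ∂Q + ε * ∫ x, g h x ^ 2 ∂Q := by
        rw [integral_add (hd.integrable_sq.const_mul _) (hgh.integrable_sq.const_mul _),
          integral_const_mul, integral_const_mul]
    _ ≤ (1 + 1 / ε) * (c / 2 / (1 + 1 / ε) * ‖h‖ ^ 2) + ε * ((|C| + 1) * ‖h‖ ^ 2) := by
        have : C * ‖h‖ ^ 2 ≤ (|C| + 1) * ‖h‖ ^ 2 := by gcongr; linarith [le_abs_self C]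
        gcongr
        exact hCh.trans this
    _ = c * ‖h‖ ^ 2 := by
        have h1 : (1 + 1 / ε) ≠ 0 := by positivity
        rw [hε]; field_simp; ring

variable {Q : Measure 𝓧} [IsProbabilityMeasure Q] {L : EuclideanSpace ℝ (Fin k) → 𝓧 → ℝ}
  {m : 𝓧 → ℝ} {s : 𝓧 → EuclideanSpace ℝ (Fin k)} {ρ : ℝ}

namespace IsLocalModel

lemma abs_le (H : IsLocalModel Q L m s ρ) {h : EuclideanSpace ℝ (Fin k)}
    (hh : h ∈ Metric.ball (0 : EuclideanSpace ℝ (Fin k)) ρ) (x : 𝓧) :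
    |L h x| ≤ m x * ‖h‖ := by
  simpa [H.zero] using H.lip h hh 0 (Metric.mem_ball_self H.pos) x

lemma memLp_L (H : IsLocalModel Q L m s ρ) {h : EuclideanSpace ℝ (Fin k)}
    (hh : h ∈ Metric.ball (0 : EuclideanSpace ℝ (Fin k)) ρ) : MemLp (L h) 2 Q :=
  (H.memLp_m.mul_const ‖h‖).mono (H.meas h hh).aestronglyMeasurable (ae_of_all _ fun x => by
    rw [Real.norm_eq_abs, Real.norm_eq_abs]
    exact (H.abs_le hh x).trans (le_abs_self _))

lemma memLp_exp (H : IsLocalModel Q L m s ρ) {h : EuclideanSpace ℝ (Fin k)}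
    (hh : h ∈ Metric.ball (0 : EuclideanSpace ℝ (Fin k)) ρ) :
    MemLp (fun x => Real.exp (L h x / 2)) 2 Q := by
  have hme : Measurable fun x => Real.exp (L h x / 2) := ((H.meas h hh).div_const 2).exp
  rw [memLp_two_iff_integrable_sq hme.aestronglyMeasurable]
  refine ⟨(hme.pow_const 2).aestronglyMeasurable, ?_⟩
  rw [hasFiniteIntegral_iff_ofReal (ae_of_all _ fun _ => sq_nonneg _)]
  have : ∀ x, Real.exp (L h x / 2) ^ 2 = Real.exp (L h x) := fun x => by
    rw [← Real.exp_nat_mul]; congr 1; push_cast; ring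
  simp only [this, H.mass h hh]
  exact ENNReal.one_lt_top

lemma memLp_w (H : IsLocalModel Q L m s ρ) {h : EuclideanSpace ℝ (Fin k)}
    (hh : h ∈ Metric.ball (0 : EuclideanSpace ℝ (Fin k)) ρ) :
    MemLp (fun x => Real.exp (L h x / 2) - 1) 2 Q :=
  (H.memLp_exp hh).sub (memLp_const 1)

/-- With w = exp(L/2) - 1 one has exp L = 1 + 2w + w², and exp L has integral 1. The first-order
quantity ∫w is therefore of second order. -/
lemma integral_w (H : IsLocalModel Q L m s ρ) {h : EuclideanSpace ℝ (Fin k)}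
    (hh : h ∈ Metric.ball (0 : EuclideanSpace ℝ (Fin k)) ρ) :
    ∫ x, (Real.exp (L h x / 2) - 1) ∂Q = - (1 / 2) * ∫ x, (Real.exp (L h x / 2) - 1) ^ 2 ∂Q := by
  have hw := H.memLp_w hh
  have h1 : ∫ x, Real.exp (L h x) ∂Q = 1 := by
    rw [integral_eq_lintegral_of_nonneg_ae (ae_of_all _ fun _ => (Real.exp_pos _).le)
      (H.meas h hh).exp.aestronglyMeasurable, H.mass h hh, ENNReal.toReal_one]
  have h2 : ∀ x, Real.exp (L h x) = 1 + (2 * (Real.exp (L h x / 2) - 1)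
      + (Real.exp (L h x / 2) - 1) ^ 2) := fun x => by
    have : Real.exp (L h x) = Real.exp (L h x / 2) ^ 2 := by
      rw [← Real.exp_nat_mul]; congr 1; push_cast; ring
    rw [this]; ring
  have hi := hw.integrable (by norm_num)
  simp only [h2] at h1
  have h3 := integral_add (integrable_const (1 : ℝ)) ((hi.const_mul 2).add hw.integrable_sq)
  have h4 := integral_add (hi.const_mul 2) hw.integrable_sq
  simp only [Pi.add_apply, integral_const, probReal_univ, smul_eq_mul, mul_one,
    integral_const_mul] at h3 h4
  linarith

lemma eventually_mem_ball (H : IsLocalModel Q L m s ρ) :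
    ∀ᶠ h in 𝓝 (0 : EuclideanSpace ℝ (Fin k)),
      h ∈ Metric.ball (0 : EuclideanSpace ℝ (Fin k)) ρ :=
  Metric.ball_mem_nhds _ H.pos

/-- Square integrability of the score is not assumed. At one small nonzero multiple of a basis
vector both w and w - ½⟪h, s⟫ are in L², and their difference is a multiple of a coordinate of s. -/
lemma memLp_s (H : IsLocalModel Q L m s ρ) : MemLp s 2 Q := by
  refine MemLp.of_eval_piLp fun i => ?_
  obtain ⟨δ, hδ, hball⟩ := Metric.eventually_nhds_iff_ball.1
    ((H.dqm 1 one_pos).and H.eventually_mem_ball)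
  set h : EuclideanSpace ℝ (Fin k) := EuclideanSpace.single i (δ / 2) with hh
  have hhδ : h ∈ Metric.ball (0 : EuclideanSpace ℝ (Fin k)) δ := by
    rw [mem_ball_zero_iff, hh, PiLp.norm_single, Real.norm_eq_abs,
      abs_of_pos (by positivity)]
    linarith
  obtain ⟨h1, h2⟩ := hball h hhδ
  have hmq : Measurable fun x => 1 / 2 * ⟪h, s x⟫ := (measurable_const.inner H.meas_s).const_mul _
  have hmd : Measurable fun x => Real.exp (L h x / 2) - 1 - 1 / 2 * ⟪h, s x⟫ :=
    ((((H.meas h h2).div_const 2).exp).sub_const 1).sub hmq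
  have hd : MemLp (fun x => Real.exp (L h x / 2) - 1 - 1 / 2 * ⟪h, s x⟫) 2 Q := by
    rw [memLp_two_iff_integrable_sq hmd.aestronglyMeasurable]
    refine ⟨(hmd.pow_const 2).aestronglyMeasurable, ?_⟩
    rw [hasFiniteIntegral_iff_ofReal (ae_of_all _ fun _ => sq_nonneg _)]
    exact h1.trans_lt ENNReal.ofReal_lt_top
  have hq := ((H.memLp_w h2).sub hd).const_mul (4 / δ)
  refine hq.congr_norm ?_ (ae_of_all _ fun x => ?_)
  · exact ((EuclideanSpace.proj i).measurable.comp H.meas_s).aestronglyMeasurable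
  · congr 1
    simp only [Pi.sub_apply, sub_sub_cancel, hh, EuclideanSpace.inner_single_left]
    simp
    field_simp
    norm_num

lemma memLp_inner (H : IsLocalModel Q L m s ρ) (h : EuclideanSpace ℝ (Fin k)) :
    MemLp (fun x => ⟪h, s x⟫) 2 Q :=
  H.memLp_s.const_inner h

lemma isLittleO_dqm (H : IsLocalModel Q L m s ρ) :
    (fun h => ∫ x, (Real.exp (L h x / 2) - 1 - 1 / 2 * ⟪h, s x⟫) ^ 2 ∂Q)
      =o[𝓝 0] fun h => ‖h‖ ^ 2 := by
  refine isLittleO_iff.2 fun c hc => ?_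
  filter_upwards [H.dqm c hc, H.eventually_mem_ball] with h hd hh
  have hd2 : MemLp (fun x => Real.exp (L h x / 2) - 1 - 1 / 2 * ⟪h, s x⟫) 2 Q :=
    (H.memLp_w hh).sub ((H.memLp_inner h).const_mul _)
  rw [Real.norm_eq_abs, Real.norm_eq_abs, abs_of_nonneg (integral_nonneg fun _ => sq_nonneg _),
    abs_of_nonneg (sq_nonneg ‖h‖), integral_eq_lintegral_of_nonneg_ae
    (ae_of_all _ fun _ => sq_nonneg _) hd2.integrable_sq.1]
  exact ENNReal.toReal_le_of_le_ofReal (by positivity) hd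

lemma integral_inner_sq_le (H : IsLocalModel Q L m s ρ) (h : EuclideanSpace ℝ (Fin k)) :
    ∫ x, ⟪h, s x⟫ ^ 2 ∂Q ≤ (∫ x, ‖s x‖ ^ 2 ∂Q) * ‖h‖ ^ 2 := by
  rw [mul_comm, ← integral_const_mul]
  refine integral_mono (H.memLp_inner h).integrable_sq
    (H.memLp_s.norm.integrable_sq.const_mul _) fun x => ?_
  simp only
  rw [← sq_abs, ← mul_pow]
  exact pow_le_pow_left₀ (abs_nonneg _) (abs_real_inner_le_norm _ _) 2

/-- The mean of w - ½⟪h, s⟫ is o(‖h‖) by Cauchy–Schwarz, and the mean of w is -½∫w² = O(‖h‖²). So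
the linear functional ⟪h, E s⟫ is o(‖h‖) and vanishes. -/
lemma integral_inner_s (H : IsLocalModel Q L m s ρ) (h : EuclideanSpace ℝ (Fin k)) :
    ∫ x, ⟪h, s x⟫ ∂Q = 0 := by
  have hint : Integrable s Q := H.memLp_s.integrable (by norm_num)
  have hE : ∀ h, ∫ x, ⟪h, s x⟫ ∂Q = ⟪h, ∫ x, s x ∂Q⟫ := fun h => integral_inner hint h
  have hlin : (fun h => ⟪h, ∫ x, s x ∂Q⟫) =o[𝓝 0] fun h : EuclideanSpace ℝ (Fin k) => h := by
    refine isLittleO_iff.2 fun c hc => ?_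
    have hsmall : ∀ᶠ h in 𝓝 (0 : EuclideanSpace ℝ (Fin k)),
        ((∫ x, ‖s x‖ ^ 2 ∂Q) + 2) * ‖h‖ < c / 2 := by
      have : Tendsto (fun h : EuclideanSpace ℝ (Fin k) => ((∫ x, ‖s x‖ ^ 2 ∂Q) + 2) * ‖h‖) (𝓝 0)
          (𝓝 (((∫ x, ‖s x‖ ^ 2 ∂Q) + 2) * 0)) := tendsto_norm_zero.const_mul _
      rw [mul_zero] at this
      exact (tendsto_order.1 this).2 _ (by positivity)
    filter_upwards [hsmall, isLittleO_iff.1 H.isLittleO_dqm one_pos,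
      isLittleO_iff.1 H.isLittleO_dqm (show 0 < (c / 4) ^ 2 by positivity),
      H.eventually_mem_ball] with h h1 h2 h3 hh
    have hw := H.memLp_w hh
    have hq := (H.memLp_inner h).const_mul (1 / 2)
    have hd : MemLp (fun x => Real.exp (L h x / 2) - 1 - 1 / 2 * ⟪h, s x⟫) 2 Q := hw.sub hq
    set D := ∫ x, (Real.exp (L h x / 2) - 1 - 1 / 2 * ⟪h, s x⟫) ^ 2 ∂Q with hD
    rw [Real.norm_eq_abs, Real.norm_eq_abs, abs_of_nonneg (integral_nonneg fun _ => sq_nonneg _),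
      abs_of_nonneg (sq_nonneg ‖h‖)] at h2 h3
    have e1 : ∫ x, (Real.exp (L h x / 2) - 1 - 1 / 2 * ⟪h, s x⟫) ∂Q
        = - (1 / 2) * ∫ x, (Real.exp (L h x / 2) - 1) ^ 2 ∂Q - 1 / 2 * ⟪h, ∫ x, s x ∂Q⟫ := by
      rw [integral_sub (hw.integrable (by norm_num)) (hq.integrable (by norm_num)),
        H.integral_w hh, integral_const_mul, hE]
    have e2 : |∫ x, (Real.exp (L h x / 2) - 1 - 1 / 2 * ⟪h, s x⟫) ∂Q| ≤ c / 4 * ‖h‖ := by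
      refine abs_le_of_sq_le_sq ?_ (by positivity)
      rw [mul_pow]
      exact (sq_integral_le hd).trans h3
    have e3 : ∫ x, (Real.exp (L h x / 2) - 1) ^ 2 ∂Q ≤ ((∫ x, ‖s x‖ ^ 2 ∂Q) + 2) * ‖h‖ ^ 2 := by
      calc ∫ x, (Real.exp (L h x / 2) - 1) ^ 2 ∂Q
          ≤ ∫ x, (2 * (Real.exp (L h x / 2) - 1 - 1 / 2 * ⟪h, s x⟫) ^ 2
              + 1 / 2 * ⟪h, s x⟫ ^ 2) ∂Q := by
            refine integral_mono hw.integrable_sq ((hd.integrable_sq.const_mul _).add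
              ((H.memLp_inner h).integrable_sq.const_mul _)) fun x => ?_
            simp only
            nlinarith [sq_nonneg (Real.exp (L h x / 2) - 1 - ⟪h, s x⟫)]
        _ = 2 * D + 1 / 2 * ∫ x, ⟪h, s x⟫ ^ 2 ∂Q := by
            rw [integral_add (hd.integrable_sq.const_mul _)
              ((H.memLp_inner h).integrable_sq.const_mul _), integral_const_mul,
              integral_const_mul]
        _ ≤ _ := by
            have := H.integral_inner_sq_le h
            have h0 : 0 ≤ ∫ x, ⟪h, s x⟫ ^ 2 ∂Q := integral_nonneg fun _ => sq_nonneg _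
            linarith
    have e4 : 0 ≤ ∫ x, (Real.exp (L h x / 2) - 1) ^ 2 ∂Q := integral_nonneg fun _ => sq_nonneg _
    have e5 : ((∫ x, ‖s x‖ ^ 2 ∂Q) + 2) * ‖h‖ ^ 2 ≤ c / 2 * ‖h‖ := by
      rw [sq, ← mul_assoc]; gcongr
    rw [Real.norm_eq_abs]
    rw [_root_.abs_le] at e2 ⊢
    constructor <;> linarith [e2.1, e2.2]
  have hfd1 : HasFDerivAt (fun h : EuclideanSpace ℝ (Fin k) => ⟪h, ∫ x, s x ∂Q⟫)
      (0 : EuclideanSpace ℝ (Fin k) →L[ℝ] ℝ) 0 := by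
    rw [hasFDerivAt_iff_isLittleO_nhds_zero]
    simpa using hlin
  have hfd2 : HasFDerivAt (fun h : EuclideanSpace ℝ (Fin k) => ⟪h, ∫ x, s x ∂Q⟫)
      (innerSL ℝ (∫ x, s x ∂Q)) 0 := by
    have := (innerSL ℝ (∫ x, s x ∂Q)).hasFDerivAt (x := (0 : EuclideanSpace ℝ (Fin k)))
    refine this.congr_of_eventuallyEq (Eventually.of_forall fun h => ?_)
    simp [real_inner_comm]
  have := congrArg (fun f => f h) (hfd2.unique hfd1)
  rw [hE, real_inner_comm]
  simpa using this

end IsLocalModel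

end LocalModel

/-! ### Pointwise exponential estimates -/

/-- A bound valid for all u, used where the envelope exceeds the truncation level. It rests on 0 ≤
exp u - 1 - u ≤ u(exp u - 1). Only quantities integrable under the local model appear on the right.
-/
lemma abs_exp_sub_one_sub_id_sub_half_sq_le (u : ℝ) :
    |Real.exp u - 1 - u - u ^ 2 / 2| ≤ u ^ 2 + (Real.exp u - 1) ^ 2 := by
  have h1 := Real.add_one_le_exp u
  have h2 : (Real.exp u - 1) - u ≤ u * (Real.exp u - 1) := by
    have h3 := Real.add_one_le_exp (-u)
    have h4 : Real.exp u * Real.exp (-u) = 1 := by rw [← Real.exp_add]; simp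
    nlinarith [mul_le_mul_of_nonneg_left h3 (Real.exp_pos u).le]
  rw [abs_le]
  constructor
  · nlinarith [sq_nonneg (Real.exp u - 1), sq_nonneg u]
  · nlinarith [sq_nonneg (Real.exp u - 1 - u), sq_nonneg u, sq_nonneg (Real.exp u - 1)]

lemma abs_exp_sub_one_sub_id_sub_half_sq_le_cube {u : ℝ} (hu : |u| ≤ 1) :
    |Real.exp u - 1 - u - u ^ 2 / 2| ≤ |u| ^ 3 := by
  have h := Real.exp_bound hu (n := 3) (by norm_num)
  simp only [Finset.sum_range_succ, Finset.sum_range_zero] at h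
  norm_num [Nat.factorial] at h
  have h0 : 0 ≤ |u| ^ 3 := by positivity
  calc |Real.exp u - 1 - u - u ^ 2 / 2| = |Real.exp u - (1 + u + u ^ 2 / 2)| := by congr 1; ring
    _ ≤ _ := h
    _ ≤ |u| ^ 3 := by linarith

/-- Pointwise bound for the error of the linear approximation of the log-likelihood ratio. -/
lemma sq_sub_inner_le {l μ η σ q K : ℝ} (hμ : 0 ≤ μ) (hη : 0 ≤ η) (hl : |l| ≤ μ * η)
    (hq : |q| ≤ η * σ) (hK : K * η ≤ 2) (b : Prop) [Decidable b] (hb : b ↔ K < μ) :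
    (l - q) ^ 2 ≤ 8 * (Real.exp (l / 2) - 1 - 1 / 2 * q) ^ 2 + K ^ 2 * η ^ 4 * μ ^ 2
      + 2 * η ^ 2 * (if b then μ ^ 2 + σ ^ 2 else 0) := by
  have hl2 : l ^ 2 ≤ (μ * η) ^ 2 := by
    rw [← sq_abs]; exact pow_le_pow_left₀ (abs_nonneg _) hl 2
  by_cases h : K < μ
  · rw [if_pos (hb.2 h)]
    have hq2 : q ^ 2 ≤ (η * σ) ^ 2 := by
      rw [← sq_abs]; exact pow_le_pow_left₀ (abs_nonneg _) hq 2
    have h1 : 0 ≤ 8 * (Real.exp (l / 2) - 1 - 1 / 2 * q) ^ 2 + K ^ 2 * η ^ 4 * μ ^ 2 := by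
      positivity
    nlinarith [sq_nonneg (l + q)]
  · rw [if_neg (fun hh => h (hb.1 hh))]
    push Not at h
    have hu : |l / 2| ≤ 1 := by
      rw [abs_div, abs_two, div_le_one two_pos]
      exact hl.trans ((mul_le_mul_of_nonneg_right h hη).trans hK)
    have h1 := Real.abs_exp_sub_one_sub_id_le hu
    set w := Real.exp (l / 2) - 1
    -- Below the level, |w - l/2| ≤ (l/2)². The claim then follows from (l - q)² ≤ 2(l - 2w)² + 2(2w
    -- - q)².
    have h2 : (l - 2 * w) ^ 2 ≤ l ^ 4 / 4 := by
      have h3 := pow_le_pow_left₀ (abs_nonneg _) h1 2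
      rw [sq_abs] at h3
      nlinarith
    have h4 : l ^ 4 ≤ K ^ 2 * η ^ 4 * μ ^ 2 := by
      have h5 : l ^ 2 ≤ (K * η) ^ 2 :=
        hl2.trans (pow_le_pow_left₀ (by positivity) (by gcongr) 2)
      calc l ^ 4 = l ^ 2 * l ^ 2 := by ring
        _ ≤ (K * η) ^ 2 * (μ * η) ^ 2 := by gcongr
        _ = _ := by ring
    nlinarith [sq_nonneg ((l - 2 * w) - (2 * w - q))]

/-- Pointwise bound for the error of the quadratic approximation of the log-likelihood ratio. -/
lemma abs_exp_remainder_le {l μ η σ q K : ℝ} (hμ : 0 ≤ μ) (hη : 0 ≤ η) (hl : |l| ≤ μ * η)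
    (hq : |q| ≤ η * σ) (hK : K * η ≤ 2) (hK0 : 0 ≤ K) (b : Prop) [Decidable b] (hb : b ↔ K < μ) :
    |Real.exp (l / 2) - 1 - l / 2 - (l / 2) ^ 2 / 2|
      ≤ 2 * (Real.exp (l / 2) - 1 - 1 / 2 * q) ^ 2 + K * η ^ 3 * μ ^ 2
      + η ^ 2 * (if b then μ ^ 2 + σ ^ 2 else 0) := by
  have hl2 : l ^ 2 ≤ (μ * η) ^ 2 := by
    rw [← sq_abs]; exact pow_le_pow_left₀ (abs_nonneg _) hl 2
  by_cases h : K < μ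
  · rw [if_pos (hb.2 h)]
    have hq2 : q ^ 2 ≤ (η * σ) ^ 2 := by
      rw [← sq_abs]; exact pow_le_pow_left₀ (abs_nonneg _) hq 2
    have h1 := abs_exp_sub_one_sub_id_sub_half_sq_le (l / 2)
    set w := Real.exp (l / 2) - 1
    have h2 : 0 ≤ K * η ^ 3 * μ ^ 2 := by positivity
    nlinarith [sq_nonneg (w - q)]
  · rw [if_neg (fun hh => h (hb.1 hh))]
    push Not at h
    have hu : |l / 2| ≤ 1 := by
      rw [abs_div, abs_two, div_le_one two_pos]
      exact hl.trans ((mul_le_mul_of_nonneg_right h hη).trans hK)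
    have h1 := abs_exp_sub_one_sub_id_sub_half_sq_le_cube hu
    have h2 : |l / 2| ^ 3 ≤ K * η ^ 3 * μ ^ 2 := by
      have h3 : |l / 2| ≤ K * η := by
        rw [abs_div, abs_two]
        have : |l| ≤ K * η := hl.trans (by gcongr)
        have : 0 ≤ K * η := by positivity
        linarith
      have h4 : |l / 2| ≤ μ * η := by
        rw [abs_div, abs_two]
        have : 0 ≤ μ * η := by positivity
        linarith
      calc |l / 2| ^ 3 = |l / 2| * |l / 2| ^ 2 := by ring
        _ ≤ (K * η) * (μ * η) ^ 2 := by gcongr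
        _ = _ := by ring
    have : 0 ≤ 2 * (Real.exp (l / 2) - 1 - 1 / 2 * q) ^ 2 := by positivity
    linarith

/-! ### Second-order expansions of the log-likelihood ratio -/

namespace IsLocalModel

set_option linter.unusedSectionVars false

variable {k : ℕ} {𝓧 : Type*} [MeasurableSpace 𝓧] {Q : Measure 𝓧} [IsProbabilityMeasure Q]
  {L : EuclideanSpace ℝ (Fin k) → 𝓧 → ℝ} {m : 𝓧 → ℝ} {s : 𝓧 → EuclideanSpace ℝ (Fin k)} {ρ : ℝ}

/-- A quantity dominated, at every truncation level, by the mean-square error of the linear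
approximation and a truncation error is negligible. -/
lemma isLittleO_of_le (H : IsLocalModel Q L m s ρ) {F : EuclideanSpace ℝ (Fin k) → ℝ}
    (hF : ∀ K : ℝ, 0 ≤ K → ∀ h ∈ Metric.ball (0 : EuclideanSpace ℝ (Fin k)) ρ, K * ‖h‖ ≤ 2 →
      ‖h‖ ≤ 1 →
      |F h| ≤ 8 * ∫ x, (Real.exp (L h x / 2) - 1 - 1 / 2 * ⟪h, s x⟫) ^ 2 ∂Q
        + (K ^ 2 + K) * ‖h‖ ^ 3 * ∫ x, m x ^ 2 ∂Q
        + 2 * ‖h‖ ^ 2 * ∫ x, {x | K < m x}.indicator (fun x => m x ^ 2 + ‖s x‖ ^ 2) x ∂Q) :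
    F =o[𝓝 0] fun h => ‖h‖ ^ 2 := by
  refine isLittleO_iff.2 fun c hc => ?_
  have hG : Integrable (fun x => m x ^ 2 + ‖s x‖ ^ 2) Q :=
    H.memLp_m.integrable_sq.add H.memLp_s.norm.integrable_sq
  -- The level K is fixed first, making the truncation term at most (c/3)‖h‖². Only then is h taken
  -- small depending on K, and each of the other two terms receives another c/3.
  obtain ⟨K, hK, hK0⟩ := (((tendsto_order.1 (tendsto_integral_indicator_lt H.meas_m hG)).2 (c / 6)
    (by positivity)).and (eventually_ge_atTop (0 : ℝ))).exists
  have hsmall : ∀ a : ℝ, ∀ δ > (0 : ℝ), ∀ᶠ h in 𝓝 (0 : EuclideanSpace ℝ (Fin k)),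
      a * ‖h‖ ≤ δ := by
    intro a δ hδ
    have : Tendsto (fun h : EuclideanSpace ℝ (Fin k) => a * ‖h‖) (𝓝 0) (𝓝 (a * 0)) :=
      tendsto_norm_zero.const_mul _
    rw [mul_zero] at this
    exact this.eventually_le_const hδ
  filter_upwards [isLittleO_iff.1 H.isLittleO_dqm (show 0 < c / 24 by positivity),
    H.eventually_mem_ball, hsmall K 2 two_pos, hsmall 1 1 one_pos,
    hsmall ((K ^ 2 + K) * ∫ x, m x ^ 2 ∂Q) (c / 3) (by positivity)] with h h1 h2 h3 h4 h5
  rw [one_mul] at h4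
  have h6 := hF K hK0 h h2 h3 h4
  rw [Real.norm_eq_abs, Real.norm_eq_abs, abs_of_nonneg (sq_nonneg ‖h‖)] at h1 ⊢
  have h7 := (le_abs_self _).trans h1
  refine h6.trans ?_
  have h8 : (K ^ 2 + K) * ‖h‖ ^ 3 * ∫ x, m x ^ 2 ∂Q ≤ c / 3 * ‖h‖ ^ 2 := by
    calc (K ^ 2 + K) * ‖h‖ ^ 3 * ∫ x, m x ^ 2 ∂Q
        = ((K ^ 2 + K) * (∫ x, m x ^ 2 ∂Q) * ‖h‖) * ‖h‖ ^ 2 := by ring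
      _ ≤ _ := by gcongr
  have h9 : 2 * ‖h‖ ^ 2 * ∫ x, {x | K < m x}.indicator (fun x => m x ^ 2 + ‖s x‖ ^ 2) x ∂Q
      ≤ 2 * ‖h‖ ^ 2 * (c / 6) := by gcongr
  linarith

lemma integrable_indicator (H : IsLocalModel Q L m s ρ) (K : ℝ) :
    Integrable ({x | K < m x}.indicator fun x => m x ^ 2 + ‖s x‖ ^ 2) Q :=
  (H.memLp_m.integrable_sq.add H.memLp_s.norm.integrable_sq).indicator
    (measurableSet_lt measurable_const H.meas_m)

/-- The log-likelihood ratio is differentiable in quadratic mean. -/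
lemma isLittleO_integral_sq_sub_inner (H : IsLocalModel Q L m s ρ) :
    (fun h => ∫ x, (L h x - ⟪h, s x⟫) ^ 2 ∂Q) =o[𝓝 0] fun h => ‖h‖ ^ 2 := by
  classical
  refine H.isLittleO_of_le fun K hK0 h hh hK h1 => ?_
  have hd : MemLp (fun x => Real.exp (L h x / 2) - 1 - 1 / 2 * ⟪h, s x⟫) 2 Q :=
    (H.memLp_w hh).sub ((H.memLp_inner h).const_mul _)
  have hm2 := H.memLp_m.integrable_sq
  have hi := H.integrable_indicator K
  rw [abs_of_nonneg (integral_nonneg fun _ => sq_nonneg _)]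
  have hI : Integrable (fun x => 8 * (Real.exp (L h x / 2) - 1 - 1 / 2 * ⟪h, s x⟫) ^ 2
      + K ^ 2 * ‖h‖ ^ 4 * m x ^ 2) Q :=
    (hd.integrable_sq.const_mul _).add (hm2.const_mul _)
  calc ∫ x, (L h x - ⟪h, s x⟫) ^ 2 ∂Q
      ≤ ∫ x, (8 * (Real.exp (L h x / 2) - 1 - 1 / 2 * ⟪h, s x⟫) ^ 2 + K ^ 2 * ‖h‖ ^ 4 * m x ^ 2
        + 2 * ‖h‖ ^ 2 * {x | K < m x}.indicator (fun x => m x ^ 2 + ‖s x‖ ^ 2) x) ∂Q := by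
        refine integral_mono ((H.memLp_L hh).sub (H.memLp_inner h)).integrable_sq
          (hI.add (hi.const_mul _)) fun x => ?_
        simp only [Set.indicator_apply]
        exact sq_sub_inner_le (H.m_nonneg x) (norm_nonneg h) (H.abs_le hh x)
          (abs_real_inner_le_norm _ _) hK _ Iff.rfl
    _ = 8 * ∫ x, (Real.exp (L h x / 2) - 1 - 1 / 2 * ⟪h, s x⟫) ^ 2 ∂Q
        + K ^ 2 * ‖h‖ ^ 4 * ∫ x, m x ^ 2 ∂Q
        + 2 * ‖h‖ ^ 2 * ∫ x, {x | K < m x}.indicator (fun x => m x ^ 2 + ‖s x‖ ^ 2) x ∂Q := by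
        rw [integral_add hI (hi.const_mul _), integral_add (hd.integrable_sq.const_mul _)
          (hm2.const_mul _), integral_const_mul, integral_const_mul, integral_const_mul]
    _ ≤ _ := by
        have h0 : 0 ≤ ∫ x, m x ^ 2 ∂Q := integral_nonneg fun _ => sq_nonneg _
        have h3 : ‖h‖ ^ 4 ≤ ‖h‖ ^ 3 := pow_le_pow_of_le_one (norm_nonneg _) h1 (by norm_num)
        have h5 : K ^ 2 * ‖h‖ ^ 4 ≤ (K ^ 2 + K) * ‖h‖ ^ 3 :=
          mul_le_mul (by linarith) h3 (by positivity) (by positivity)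
        have h6 := mul_le_mul_of_nonneg_right h5 h0
        linarith

/-- The second-order expansion of the Kullback–Leibler divergence. -/
lemma isLittleO_integral_add (H : IsLocalModel Q L m s ρ) :
    (fun h => ∫ x, L h x ∂Q + 1 / 2 * ∫ x, ⟪h, s x⟫ ^ 2 ∂Q) =o[𝓝 0] fun h => ‖h‖ ^ 2 := by
  classical
  have hrem : (fun h => ∫ x, (Real.exp (L h x / 2) - 1 - L h x / 2 - (L h x / 2) ^ 2 / 2) ∂Q)
      =o[𝓝 0] fun h => ‖h‖ ^ 2 := by
    refine H.isLittleO_of_le fun K hK0 h hh hK h1 => ?_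
    have hd : MemLp (fun x => Real.exp (L h x / 2) - 1 - 1 / 2 * ⟪h, s x⟫) 2 Q :=
      (H.memLp_w hh).sub ((H.memLp_inner h).const_mul _)
    have hm2 := H.memLp_m.integrable_sq
    have hi := H.integrable_indicator K
    have hI : Integrable (fun x => 2 * (Real.exp (L h x / 2) - 1 - 1 / 2 * ⟪h, s x⟫) ^ 2
        + K * ‖h‖ ^ 3 * m x ^ 2) Q :=
      (hd.integrable_sq.const_mul _).add (hm2.const_mul _)
    have hL2 : MemLp (fun x => L h x / 2) 2 Q := by
      simpa [div_eq_mul_inv] using (H.memLp_L hh).mul_const 2⁻¹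
    have hr : Integrable
        (fun x => Real.exp (L h x / 2) - 1 - L h x / 2 - (L h x / 2) ^ 2 / 2) Q :=
      (((H.memLp_w hh).integrable (by norm_num)).sub (hL2.integrable (by norm_num))).sub
        (hL2.integrable_sq.div_const 2)
    calc |∫ x, (Real.exp (L h x / 2) - 1 - L h x / 2 - (L h x / 2) ^ 2 / 2) ∂Q|
        ≤ ∫ x, |Real.exp (L h x / 2) - 1 - L h x / 2 - (L h x / 2) ^ 2 / 2| ∂Q :=
          abs_integral_le_integral_abs
      _ ≤ ∫ x, (2 * (Real.exp (L h x / 2) - 1 - 1 / 2 * ⟪h, s x⟫) ^ 2 + K * ‖h‖ ^ 3 * m x ^ 2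
          + ‖h‖ ^ 2 * {x | K < m x}.indicator (fun x => m x ^ 2 + ‖s x‖ ^ 2) x) ∂Q := by
          refine integral_mono hr.abs (hI.add (hi.const_mul _)) fun x => ?_
          simp only [Set.indicator_apply]
          exact abs_exp_remainder_le (H.m_nonneg x) (norm_nonneg h) (H.abs_le hh x)
            (abs_real_inner_le_norm _ _) hK hK0 _ Iff.rfl
      _ = 2 * ∫ x, (Real.exp (L h x / 2) - 1 - 1 / 2 * ⟪h, s x⟫) ^ 2 ∂Q
          + K * ‖h‖ ^ 3 * ∫ x, m x ^ 2 ∂Q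
          + ‖h‖ ^ 2 * ∫ x, {x | K < m x}.indicator (fun x => m x ^ 2 + ‖s x‖ ^ 2) x ∂Q := by
          rw [integral_add hI (hi.const_mul _), integral_add (hd.integrable_sq.const_mul _)
            (hm2.const_mul _), integral_const_mul, integral_const_mul, integral_const_mul]
      _ ≤ _ := by
          have h0 : 0 ≤ ∫ x, m x ^ 2 ∂Q := integral_nonneg fun _ => sq_nonneg _
          have h3 : 0 ≤ ∫ x, (Real.exp (L h x / 2) - 1 - 1 / 2 * ⟪h, s x⟫) ^ 2 ∂Q :=
            integral_nonneg fun _ => sq_nonneg _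
          have h4 : 0 ≤ ∫ x, {x | K < m x}.indicator (fun x => m x ^ 2 + ‖s x‖ ^ 2) x ∂Q :=
            integral_nonneg fun x => Set.indicator_nonneg (fun x _ => by positivity) x
          gcongr ?_ * _ + ?_ * _ * _ + ?_ * _
          · norm_num
          · nlinarith
          · nlinarith [sq_nonneg ‖h‖]
  have hC := H.integral_inner_sq_le
  have hL2 := isLittleO_integral_sq_sub (Q := Q) (f := L) (g := fun h x => ⟪h, s x⟫)
    (H.eventually_mem_ball.mono fun h hh => H.memLp_L hh)
    (Eventually.of_forall H.memLp_inner) (Eventually.of_forall hC) H.isLittleO_integral_sq_sub_inner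
  have hw2 := isLittleO_integral_sq_sub (Q := Q) (f := fun h x => Real.exp (L h x / 2) - 1)
    (g := fun h x => 1 / 2 * ⟪h, s x⟫) (C := ∫ x, ‖s x‖ ^ 2 ∂Q)
    (H.eventually_mem_ball.mono fun h hh => H.memLp_w hh)
    (Eventually.of_forall fun h => (H.memLp_inner h).const_mul _)
    (Eventually.of_forall fun h => by
      refine le_trans ?_ (hC h)
      simp only [mul_pow]
      rw [integral_const_mul]
      have : 0 ≤ ∫ x, ⟪h, s x⟫ ^ 2 ∂Q := integral_nonneg fun _ => sq_nonneg _
      norm_num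
      linarith) H.isLittleO_dqm
  -- With r = w - L/2 - L²/8 and ∫w = -½∫w², one gets ∫L = -∫w² - ¼∫L² - 2∫r. Both ∫w² and ¼∫L² are
  -- ¼∫⟪h, s⟫² + o(‖h‖²), whence the constant ½.
  have hcomb := ((hw2.neg_left).sub (hL2.const_mul_left (1 / 4))).sub (hrem.const_mul_left 2)
  refine hcomb.congr' ?_ EventuallyEq.rfl
  filter_upwards [H.eventually_mem_ball] with h hh
  have hL := H.memLp_L hh
  have hL' : MemLp (fun x => L h x / 2) 2 Q := by
    simpa [div_eq_mul_inv] using hL.mul_const 2⁻¹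
  have hwi := (H.memLp_w hh).integrable (by norm_num)
  have e1 : ∫ x, (Real.exp (L h x / 2) - 1 - L h x / 2 - (L h x / 2) ^ 2 / 2) ∂Q
      = ∫ x, (Real.exp (L h x / 2) - 1) ∂Q - (∫ x, L h x ∂Q) / 2 - (∫ x, L h x ^ 2 ∂Q) / 8 := by
    have h1 := integral_sub (hwi.sub (hL'.integrable (by norm_num))) (hL'.integrable_sq.div_const 2)
    have h2 := integral_sub hwi (hL'.integrable (by norm_num))
    simp only [Pi.sub_apply] at h1 h2
    rw [h1, h2, integral_div, integral_div]
    simp only [div_pow]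
    rw [integral_div]
    ring
  have e2 : ∫ x, (1 / 2 * ⟪h, s x⟫) ^ 2 ∂Q = 1 / 4 * ∫ x, ⟪h, s x⟫ ^ 2 ∂Q := by
    simp only [mul_pow]
    rw [integral_const_mul]
    norm_num
  have e3 := H.integral_w hh
  rw [e1, e2, e3]
  ring

end IsLocalModel

/-! ### Auxiliary limits and the passage from the unit cube to balls -/

lemma ENNReal_tendsto_zero_of_ofReal {f : ℕ → ℝ≥0∞}
    (h : ∀ η > (0 : ℝ), ∀ᶠ n in atTop, f n ≤ ENNReal.ofReal η) : Tendsto f atTop (𝓝 0) := by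
  refine ENNReal.tendsto_nhds_zero.2 fun ε hε => ?_
  rcases eq_or_ne ε ⊤ with rfl | hε'
  · exact Eventually.of_forall fun _ => le_top
  · have := h ε.toReal (ENNReal.toReal_pos hε.ne' hε')
    rwa [ENNReal.ofReal_toReal hε'] at this

lemma eventually_le_ofReal_of_tendsto_zero {f : ℕ → ℝ≥0∞} (h : Tendsto f atTop (𝓝 0)) {η : ℝ}
    (hη : 0 < η) : ∀ᶠ n in atTop, f n ≤ ENNReal.ofReal η :=
  h.eventually_le_const (ENNReal.ofReal_pos.2 hη)

/-- The affine map from the unit cube to the cube with centre `0` and half-side `R`. -/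
noncomputable def cubeMap {k : ℕ} (R : ℝ) (v : Fin k → ℝ) : EuclideanSpace ℝ (Fin k) :=
  WithLp.toLp 2 fun j => R * (2 * v j - 1)

lemma norm_toLp_le {k : ℕ} (v : Fin k → ℝ) :
    ‖(WithLp.toLp 2 v : EuclideanSpace ℝ (Fin k))‖ ≤ (k + 1) * ‖v‖ := by
  rw [EuclideanSpace.norm_eq, Real.sqrt_le_left (by positivity)]
  calc ∑ i, ‖(WithLp.toLp 2 v : EuclideanSpace ℝ (Fin k)) i‖ ^ 2
      ≤ ∑ _i : Fin k, ‖v‖ ^ 2 := by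
        refine Finset.sum_le_sum fun i _ => ?_
        gcongr
        exact norm_le_pi_norm v i
    _ = k * ‖v‖ ^ 2 := by simp
    _ ≤ ((k + 1) * ‖v‖) ^ 2 := by
        rw [mul_pow]
        gcongr
        nlinarith [(Nat.cast_nonneg k : (0 : ℝ) ≤ k)]

lemma norm_cubeMap_sub_le {k : ℕ} {R : ℝ} (hR : 0 ≤ R) (v w : Fin k → ℝ) :
    ‖cubeMap R v - cubeMap R w‖ ≤ 2 * R * (k + 1) * ‖v - w‖ := by
  have : cubeMap R v - cubeMap R w = (2 * R) • WithLp.toLp 2 (v - w) := by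
    ext j; simp [cubeMap]; ring
  rw [this, norm_smul, Real.norm_eq_abs, abs_of_nonneg (by positivity),
    mul_assoc (2 * R)]
  exact mul_le_mul_of_nonneg_left (norm_toLp_le _) (by positivity)

lemma norm_cubeMap_le {k : ℕ} {R : ℝ} (hR : 0 ≤ R) {v : Fin k → ℝ} (hv : v ∈ unitCube k) :
    ‖cubeMap R v‖ ≤ R * (k + 1) := by
  refine (norm_toLp_le _).trans ?_
  rw [mul_comm R]
  gcongr
  rw [pi_norm_le_iff_of_nonneg hR]
  intro j
  rw [norm_mul, Real.norm_eq_abs, abs_of_nonneg hR]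
  refine mul_le_of_le_one_right hR ?_
  rw [Real.norm_eq_abs, abs_le]
  constructor <;> linarith [(hv j).1, (hv j).2]

lemma exists_cubeMap_eq {k : ℕ} {R : ℝ} (hR : 0 < R) {h : EuclideanSpace ℝ (Fin k)}
    (hh : ‖h‖ < R) : ∃ v ∈ unitCube k, cubeMap R v = h := by
  refine ⟨fun j => (h j / R + 1) / 2, fun j => ?_, ?_⟩
  · have h1 : |h j| < R := (PiLp.norm_apply_le h j).trans_lt hh
    rw [abs_lt] at h1
    have h2 : -1 < h j / R := by rw [lt_div_iff₀ hR]; linarith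
    have h3 : h j / R < 1 := by rw [div_lt_iff₀ hR]; linarith
    constructor <;> linarith
  · ext j
    simp only [cubeMap]
    field_simp
    ring

/-! ### The truncated log-likelihood ratio process -/

namespace IsLocalModel

set_option linter.unusedSectionVars false

variable {k : ℕ} {Ω 𝓧 : Type*} [MeasurableSpace Ω] [MeasurableSpace 𝓧] {P : Measure Ω}
  [IsProbabilityMeasure P] {Q : Measure 𝓧} [IsProbabilityMeasure Q]
  {L : EuclideanSpace ℝ (Fin k) → 𝓧 → ℝ} {m : 𝓧 → ℝ} {s : 𝓧 → EuclideanSpace ℝ (Fin k)} {ρ : ℝ}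
  {X : ℕ → Ω → 𝓧}

/-- The log-likelihood ratio, truncated to the points with Lipschitz constant at most `√n`. -/
noncomputable def trunc (L : EuclideanSpace ℝ (Fin k) → 𝓧 → ℝ) (m : 𝓧 → ℝ) (n : ℕ)
    (h : EuclideanSpace ℝ (Fin k)) : 𝓧 → ℝ :=
  {x | m x ≤ √(n : ℝ)}.indicator (L h)

/-- The centred truncated log-likelihood ratio process in the local parameter. -/
noncomputable def truncIncrement (Q : Measure 𝓧) (L : EuclideanSpace ℝ (Fin k) → 𝓧 → ℝ)
    (m : 𝓧 → ℝ) (X : ℕ → Ω → 𝓧) (n : ℕ) (h : EuclideanSpace ℝ (Fin k)) (ω : Ω) : ℝ :=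
  ∑ i ∈ Finset.range n, (trunc L m n ((√(n : ℝ))⁻¹ • h) (X i ω)
    - ∫ x, trunc L m n ((√(n : ℝ))⁻¹ • h) x ∂Q)

lemma measurable_trunc (H : IsLocalModel Q L m s ρ) (n : ℕ) {h : EuclideanSpace ℝ (Fin k)}
    (hh : h ∈ Metric.ball (0 : EuclideanSpace ℝ (Fin k)) ρ) : Measurable (trunc L m n h) :=
  (H.meas h hh).indicator (measurableSet_le H.meas_m measurable_const)

lemma abs_trunc_sub_le (H : IsLocalModel Q L m s ρ) (n : ℕ) {h h' : EuclideanSpace ℝ (Fin k)}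
    (hh : h ∈ Metric.ball (0 : EuclideanSpace ℝ (Fin k)) ρ)
    (hh' : h' ∈ Metric.ball (0 : EuclideanSpace ℝ (Fin k)) ρ) (x : 𝓧) :
    |trunc L m n h x - trunc L m n h' x|
      ≤ {x | m x ≤ √(n : ℝ)}.indicator m x * ‖h - h'‖ := by
  by_cases hx : m x ≤ √(n : ℝ)
  · simpa [trunc, hx] using H.lip h hh h' hh' x
  · simp [trunc, hx]

lemma integrable_trunc (H : IsLocalModel Q L m s ρ) (n : ℕ) {h : EuclideanSpace ℝ (Fin k)}
    (hh : h ∈ Metric.ball (0 : EuclideanSpace ℝ (Fin k)) ρ) : Integrable (trunc L m n h) Q :=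
  ((H.memLp_L hh).integrable (by norm_num)).indicator
    (measurableSet_le H.meas_m measurable_const)

/-- After truncation at √n each summand of an increment is at most ‖h - h'‖, and the total variance
is at most E[m²]‖h - h'‖². This gives tails of any polynomial order q, uniformly in n, although m
itself has only two moments. -/
lemma measure_lt_abs_truncIncrement_sub_le (H : IsLocalModel Q L m s ρ) (hindep : iIndepFun X P)
    (hlaw : ∀ i, HasLaw (X i) Q P) {n : ℕ} (hn : 0 < n) {h h' : EuclideanSpace ℝ (Fin k)}
    (hh : (√(n : ℝ))⁻¹ • h ∈ Metric.ball (0 : EuclideanSpace ℝ (Fin k)) ρ)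
    (hh' : (√(n : ℝ))⁻¹ • h' ∈ Metric.ball (0 : EuclideanSpace ℝ (Fin k)) ρ) (q : ℕ)
    {t : ℝ} (ht : 0 < t) :
    P {ω | t * ‖h - h'‖ < |truncIncrement Q L m X n h ω - truncIncrement Q L m X n h' ω|}
      ≤ ENNReal.ofReal (2 * Real.exp (∫ x, m x ^ 2 ∂Q) * (q.factorial * 2 ^ q) / t ^ q) := by
  set f : 𝓧 → ℝ := fun x => trunc L m n ((√(n : ℝ))⁻¹ • h) x
    - trunc L m n ((√(n : ℝ))⁻¹ • h') x with hf
  have hS : MeasurableSet {x | m x ≤ √(n : ℝ)} := measurableSet_le H.meas_m measurable_const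
  have hg2 : (fun x => ({x | m x ≤ √(n : ℝ)}.indicator m x) ^ 2)
      = {x | m x ≤ √(n : ℝ)}.indicator fun x => m x ^ 2 := by
    ext x
    by_cases hx : m x ≤ √(n : ℝ) <;> simp [hx]
  have key := measure_lt_abs_sum_sub_le hindep hlaw hn (f := f)
    (g := {x | m x ≤ √(n : ℝ)}.indicator m) (σ := ∫ x, m x ^ 2 ∂Q) (d := ‖h - h'‖)
    ((H.measurable_trunc n hh).sub (H.measurable_trunc n hh'))
    (fun x => by
      by_cases hx : m x ≤ √(n : ℝ)
      · simp [hx]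
      · simp [hx])
    (by rw [hg2]; exact H.memLp_m.integrable_sq.indicator hS)
    (by
      rw [hg2]
      exact integral_mono (H.memLp_m.integrable_sq.indicator hS) H.memLp_m.integrable_sq
        (Set.indicator_le_self' fun x _ => sq_nonneg _))
    (norm_nonneg _)
    (fun x => by
      refine (H.abs_trunc_sub_le n hh hh' x).trans_eq ?_
      rw [← smul_sub, norm_smul, norm_inv, Real.norm_eq_abs, abs_of_nonneg (Real.sqrt_nonneg _)]
      ring) q ht
  refine (le_of_eq ?_).trans key
  congr 1
  ext ω
  simp only [Set.mem_ofPred_eq, truncIncrement]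
  rw [← Finset.sum_sub_distrib, hf,
    integral_sub (H.integrable_trunc n hh) (H.integrable_trunc n hh')]
  congr! 3
  ring_nf

/-- Chaining controls the process on dyadic points only; continuity extends the bound to every h,
and so avoids measurability questions for an uncountable supremum. -/
lemma continuousOn_truncIncrement (H : IsLocalModel Q L m s ρ) (n : ℕ) (ω : Ω) :
    ContinuousOn (fun h => truncIncrement Q L m X n h ω)
      {h | (√(n : ℝ))⁻¹ • h ∈ Metric.ball (0 : EuclideanSpace ℝ (Fin k)) ρ} := by
  have hind : ∀ x, {x | m x ≤ √(n : ℝ)}.indicator m x ≤ m x := fun x =>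
    Set.indicator_le_self' (fun x _ => H.m_nonneg x) x
  have hmi : Integrable m Q := H.memLp_m.integrable (by norm_num)
  refine continuousOn_finsetSum _ fun i _ => ?_
  have hlip : ∀ (F : EuclideanSpace ℝ (Fin k) → ℝ) (C : ℝ),
      (∀ h ∈ Metric.ball (0 : EuclideanSpace ℝ (Fin k)) ρ,
        ∀ h' ∈ Metric.ball (0 : EuclideanSpace ℝ (Fin k)) ρ, |F h - F h'| ≤ C * ‖h - h'‖) →
      ContinuousOn (fun h => F ((√(n : ℝ))⁻¹ • h))
        {h | (√(n : ℝ))⁻¹ • h ∈ Metric.ball (0 : EuclideanSpace ℝ (Fin k)) ρ} := by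
    intro F C hF
    have h1 : ContinuousOn F (Metric.ball (0 : EuclideanSpace ℝ (Fin k)) ρ) := by
      refine (LipschitzOnWith.of_dist_le_mul (K := C.toNNReal) fun h hh h' hh' => ?_).continuousOn
      rw [Real.dist_eq, dist_eq_norm]
      refine (hF h hh h' hh').trans ?_
      gcongr
      exact Real.le_coe_toNNReal C
    exact h1.comp (by fun_prop) fun h hh => hh
  refine ContinuousOn.sub (hlip (fun h => trunc L m n h (X i ω)) (m (X i ω)) fun h hh h' hh' => ?_)
    (hlip (fun h => ∫ x, trunc L m n h x ∂Q) (∫ x, m x ∂Q) fun h hh h' hh' => ?_)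
  · exact (H.abs_trunc_sub_le n hh hh' _).trans (by gcongr; exact hind _)
  · rw [← integral_sub (H.integrable_trunc n hh) (H.integrable_trunc n hh'), ← integral_mul_const]
    refine abs_integral_le_integral_abs.trans (integral_mono
      ((H.integrable_trunc n hh).sub (H.integrable_trunc n hh')).abs (hmi.mul_const _) fun x => ?_)
    exact (H.abs_trunc_sub_le n hh hh' _).trans (by gcongr; exact hind _)

lemma smul_mem_ball {n : ℕ} (hn : 0 < n) {δ : ℝ} {h : EuclideanSpace ℝ (Fin k)}
    (hh : ‖h‖ < δ * √(n : ℝ)) :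
    (√(n : ℝ))⁻¹ • h ∈ Metric.ball (0 : EuclideanSpace ℝ (Fin k)) δ := by
  have hsn : 0 < √(n : ℝ) := Real.sqrt_pos.2 (by exact_mod_cast hn)
  rw [mem_ball_zero_iff, norm_smul, norm_inv, Real.norm_eq_abs, abs_of_pos hsn,
    inv_mul_lt_iff₀ hsn, mul_comm]
  exact hh

/-- The constant in the tail bounds for the truncated log-likelihood ratio process. -/
noncomputable def tailConst (k : ℕ) (Q : Measure 𝓧) (m : 𝓧 → ℝ) : ℝ :=
  2 ^ (3 * k + 3) * (2 * Real.exp (∫ x, m x ^ 2 ∂Q) * ((2 * k + 2).factorial * 2 ^ (2 * k + 2)))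

lemma tailConst_nonneg : 0 ≤ tailConst k Q m := by unfold tailConst; positivity

/-- The modulus of continuity of the truncated log-likelihood ratio process on a cube. -/
lemma measure_truncIncrement_modulus_le (H : IsLocalModel Q L m s ρ) (hindep : iIndepFun X P)
    (hlaw : ∀ i, HasLaw (X i) Q P) {n : ℕ} (hn : 0 < n) {R : ℝ} (hR : 0 < R)
    (hRn : R * (k + 1) < ρ * √(n : ℝ)) {t : ℝ} (ht : 0 < t) :
    P {ω | ¬ ∀ v ∈ unitCube k, ∀ i, |truncIncrement Q L m X n (cubeMap R v) ω
        - truncIncrement Q L m X n (cubeMap R (dyadicFloor i v)) ω|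
          ≤ t * (2 * R * (k + 1)) * (3 / 4) ^ i}
      ≤ ENNReal.ofReal (tailConst k Q m / t ^ (2 * k + 2)) := by
  have hmem : ∀ v ∈ unitCube k,
      (√(n : ℝ))⁻¹ • cubeMap R v ∈ Metric.ball (0 : EuclideanSpace ℝ (Fin k)) ρ :=
    fun v hv => smul_mem_ball hn ((norm_cubeMap_le hR.le hv).trans_lt hRn)
  have hB : 0 < 2 * R * (k + 1) := by positivity
  set K := 2 * Real.exp (∫ x, m x ^ 2 ∂Q) * ((2 * k + 2).factorial * 2 ^ (2 * k + 2)) with hK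
  have hcm : Continuous fun v : Fin k → ℝ => cubeMap R v := by
    unfold cubeMap; fun_prop
  refine (measure_dyadic_modulus_le P (fun v ω => truncIncrement Q L m X n (cubeMap R v) ω)
    -- The factor 2R(k + 1) is a Lipschitz constant of `cubeMap R` from the sup norm to the
    -- Euclidean norm.
    (K := K * (2 * R * (k + 1)) ^ (2 * k + 2)) (by positivity)
    (fun ω => (H.continuousOn_truncIncrement n ω).comp hcm.continuousOn hmem) ?_
    (mul_pos ht hB)).trans_eq ?_
  · intro v hv w hw r hr
    refine (measure_mono fun ω hω => ?_).trans
      ((H.measure_lt_abs_truncIncrement_sub_le hindep hlaw hn (hmem v hv) (hmem w hw) (2 * k + 2)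
      (div_pos hr hB)).trans_eq ?_)
    · simp only [Set.mem_ofPred_eq] at hω ⊢
      refine lt_of_le_of_lt ?_ hω
      calc r / (2 * R * (k + 1)) * ‖cubeMap R v - cubeMap R w‖
          ≤ r / (2 * R * (k + 1)) * (2 * R * (k + 1) * ‖v - w‖) := by
            gcongr; exact norm_cubeMap_sub_le hR.le v w
        _ = r * ‖v - w‖ := by field_simp
    · rw [div_pow, ← hK]; field_simp
  · rw [tailConst, ← hK, mul_pow t, ← mul_assoc, mul_div_mul_right _ _ (pow_pos hB _).ne']

/-- A maximal inequality for the truncated log-likelihood ratio process. -/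
lemma measure_exists_lt_abs_truncIncrement_le (H : IsLocalModel Q L m s ρ) (hindep : iIndepFun X P)
    (hlaw : ∀ i, HasLaw (X i) Q P) {n : ℕ} (hn : 0 < n) {R : ℝ} (hR : 0 < R)
    (hRn : R * (k + 1) < ρ * √(n : ℝ)) {t : ℝ} (ht : 0 < t) :
    P {ω | ∃ h : EuclideanSpace ℝ (Fin k), ‖h‖ < R ∧
        t * (4 * R * (k + 1)) < |truncIncrement Q L m X n h ω|}
      ≤ ENNReal.ofReal (tailConst k Q m / t ^ (2 * k + 2)) := by
  refine (measure_mono fun ω hω => ?_).trans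
    (H.measure_truncIncrement_modulus_le hindep hlaw hn hR hRn ht)
  obtain ⟨h, hhR, hlt⟩ := hω
  intro hcon
  obtain ⟨v, hv, rfl⟩ := exists_cubeMap_eq hR hhR
  -- The level-0 grid point is a corner of the cube, whereas the process vanishes at the centre.
  -- Both h and 0 are compared with the corner, which doubles the constant.
  obtain ⟨v₀, hv₀, hv₀0⟩ := exists_cubeMap_eq (k := k) hR (h := 0) (by simpa using hR)
  have h1 := hcon v hv 0
  have h2 := hcon v₀ hv₀ 0
  have h3 : truncIncrement Q L m X n 0 ω = 0 := by
    have : ∀ x, trunc L m n (0 : EuclideanSpace ℝ (Fin k)) x = 0 := fun x => by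
      simp only [trunc, Set.indicator_apply, H.zero]; simp
    simp [truncIncrement, this]
  rw [dyadicFloor_zero hv, pow_zero, mul_one] at h1
  rw [dyadicFloor_zero hv₀, pow_zero, mul_one, hv₀0, h3, zero_sub, abs_neg] at h2
  have h4 := abs_sub_abs_le_abs_sub (truncIncrement Q L m X n (cubeMap R v) ω)
    (truncIncrement Q L m X n (cubeMap R 0) ω)
  linarith

end IsLocalModel

/-! ### Rate of convergence and uniform local asymptotic normality -/

namespace IsLocalModel

set_option linter.unusedSectionVars false

variable {k : ℕ} {Ω 𝓧 : Type*} [MeasurableSpace Ω] [MeasurableSpace 𝓧] {P : Measure Ω}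
  [IsProbabilityMeasure P] {Q : Measure 𝓧} [IsProbabilityMeasure Q]
  {L : EuclideanSpace ℝ (Fin k) → 𝓧 → ℝ} {m : 𝓧 → ℝ} {s : 𝓧 → EuclideanSpace ℝ (Fin k)} {ρ : ℝ}
  {X : ℕ → Ω → 𝓧}

/-- The second moment of the Lipschitz constant beyond the truncation level. -/
noncomputable def tailMoment (Q : Measure 𝓧) (m : 𝓧 → ℝ) (n : ℕ) : ℝ :=
  ∫ x, {x | √(n : ℝ) < m x}.indicator (fun x => m x ^ 2) x ∂Q

lemma tailMoment_nonneg (n : ℕ) : 0 ≤ tailMoment Q m n :=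
  integral_nonneg fun _ => Set.indicator_nonneg (fun _ _ => sq_nonneg _) _

lemma tendsto_tailMoment (H : IsLocalModel Q L m s ρ) :
    Tendsto (tailMoment Q m) atTop (𝓝 0) :=
  (tendsto_integral_indicator_lt H.meas_m H.memLp_m.integrable_sq).comp
    (Real.tendsto_sqrt_atTop.comp tendsto_natCast_atTop_atTop)

lemma integrable_tail (H : IsLocalModel Q L m s ρ) (n : ℕ) :
    Integrable ({x | √(n : ℝ) < m x}.indicator fun x => m x ^ 2) Q :=
  H.memLp_m.integrable_sq.indicator (measurableSet_lt measurable_const H.meas_m)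

/-- A union bound followed by Markov: n Q(m > √n) ≤ E[m²; m > √n]. The level √n is thus low enough
for the increment bounds and high enough to be harmless. -/
lemma measure_exists_lt_le (H : IsLocalModel Q L m s ρ) (hlaw : ∀ i, HasLaw (X i) Q P) {n : ℕ} :
    P {ω | ¬ ∀ i < n, m (X i ω) ≤ √(n : ℝ)} ≤ ENNReal.ofReal (tailMoment Q m n) := by
  have hS : MeasurableSet {x | √(n : ℝ) < m x} := measurableSet_lt measurable_const H.meas_m
  have h1 : {ω | ¬ ∀ i < n, m (X i ω) ≤ √(n : ℝ)}
      ⊆ ⋃ i ∈ Finset.range n, {ω | √(n : ℝ) < m (X i ω)} := by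
    intro ω hω
    simp only [Set.mem_ofPred_eq, not_forall, not_le] at hω
    obtain ⟨i, hi, h⟩ := hω
    simp only [Set.mem_iUnion, Finset.mem_range]
    exact ⟨i, hi, h⟩
  refine (measure_mono h1).trans ((measure_biUnion_finset_le _ _).trans ?_)
  have h2 : ∀ i, P {ω | √(n : ℝ) < m (X i ω)} = Q {x | √(n : ℝ) < m x} :=
    fun i => (hlaw i).measure_eq (p := fun x => √(n : ℝ) < m x) hS
  simp only [h2, Finset.sum_const, Finset.card_range, nsmul_eq_mul]
  rw [tailMoment, ofReal_integral_eq_lintegral_ofReal (H.integrable_tail n)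
    (ae_of_all _ fun x => Set.indicator_nonneg (fun x _ => sq_nonneg _) x)]
  calc (n : ℝ≥0∞) * Q {x | √(n : ℝ) < m x}
      = ∫⁻ x, {x | √(n : ℝ) < m x}.indicator (fun _ => (n : ℝ≥0∞)) x ∂Q := by
        rw [lintegral_indicator_const hS]
    _ ≤ _ := by
        refine lintegral_mono fun x => ?_
        by_cases hx : √(n : ℝ) < m x
        · simp only [Set.indicator, Set.mem_ofPred_eq, hx, if_true]
          rw [← ENNReal.ofReal_natCast]
          refine ENNReal.ofReal_le_ofReal ?_
          rw [← Real.sq_sqrt (Nat.cast_nonneg n)]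
          exact pow_le_pow_left₀ (Real.sqrt_nonneg _) hx.le 2
        · simp [hx]

/-- The discarded part of the mean is at most √n ‖h‖ E[m; m > √n], and on that event √n ≤ m. -/
lemma natCast_mul_integral_trunc_sub_le (H : IsLocalModel Q L m s ρ) {n : ℕ} (hn : 0 < n)
    {h : EuclideanSpace ℝ (Fin k)}
    (hh : (√(n : ℝ))⁻¹ • h ∈ Metric.ball (0 : EuclideanSpace ℝ (Fin k)) ρ) :
    |n * ∫ x, trunc L m n ((√(n : ℝ))⁻¹ • h) x ∂Q - n * ∫ x, L ((√(n : ℝ))⁻¹ • h) x ∂Q|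
      ≤ tailMoment Q m n * ‖h‖ := by
  have hsn : 0 < √(n : ℝ) := Real.sqrt_pos.2 (by exact_mod_cast hn)
  have hL : Integrable (L ((√(n : ℝ))⁻¹ • h)) Q := (H.memLp_L hh).integrable (by norm_num)
  rw [← mul_sub, abs_mul, Nat.abs_cast, ← integral_sub (H.integrable_trunc n hh) hL, tailMoment,
    ← integral_mul_const]
  refine (mul_le_mul_of_nonneg_left abs_integral_le_integral_abs (Nat.cast_nonneg n)).trans ?_
  rw [← integral_const_mul]
  refine integral_mono (((H.integrable_trunc n hh).sub hL).abs.const_mul _)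
    ((H.integrable_tail n).mul_const _) fun x => ?_
  by_cases hx : √(n : ℝ) < m x
  · have h1 : ¬ m x ≤ √(n : ℝ) := not_le.2 hx
    simp only [trunc, Set.indicator, Set.mem_ofPred_eq, h1, hx, if_true, if_false, zero_sub,
      abs_neg]
    have h2 := H.abs_le hh x
    rw [norm_smul, norm_inv, Real.norm_eq_abs, abs_of_pos hsn] at h2
    calc n * |L ((√(n : ℝ))⁻¹ • h) x| ≤ n * (m x * ((√(n : ℝ))⁻¹ * ‖h‖)) := by gcongr
      _ = √(n : ℝ) * m x * ‖h‖ := by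
          nth_rewrite 1 [← Real.mul_self_sqrt (Nat.cast_nonneg n)]
          field_simp
      _ ≤ m x ^ 2 * ‖h‖ := by
          rw [sq]
          have := H.m_nonneg x
          gcongr
  · have h1 : m x ≤ √(n : ℝ) := not_lt.1 hx
    simp [trunc, h1, hx]

/-- The log-likelihood ratio of the sample, on the event that no observation is truncated, is the
truncated process plus its quadratic drift. -/
lemma exists_forall_abs_sum_sub_le (H : IsLocalModel Q L m s ρ) {ε : ℝ} (hε : 0 < ε) :
    ∃ δ > 0, δ ≤ ρ ∧ ∀ n : ℕ, 0 < n → ∀ ω : Ω, (∀ i < n, m (X i ω) ≤ √(n : ℝ)) →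
      ∀ h : EuclideanSpace ℝ (Fin k), ‖h‖ < δ * √(n : ℝ) →
      |∑ i ∈ Finset.range n, L ((√(n : ℝ))⁻¹ • h) (X i ω) - truncIncrement Q L m X n h ω
        + 1 / 2 * ∫ x, ⟪h, s x⟫ ^ 2 ∂Q| ≤ ε * ‖h‖ ^ 2 + tailMoment Q m n * ‖h‖ := by
  obtain ⟨δ, hδ, hball⟩ := Metric.eventually_nhds_iff_ball.1
    (isLittleO_iff.1 H.isLittleO_integral_add hε)
  refine ⟨min δ ρ, lt_min hδ H.pos, min_le_right _ _, fun n hn ω hω h hh => ?_⟩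
  have hsn : 0 < √(n : ℝ) := Real.sqrt_pos.2 (by exact_mod_cast hn)
  have hnn : (n : ℝ) = √(n : ℝ) ^ 2 := (Real.sq_sqrt (Nat.cast_nonneg n)).symm
  have hmem := smul_mem_ball hn hh
  have hρ : (√(n : ℝ))⁻¹ • h ∈ Metric.ball (0 : EuclideanSpace ℝ (Fin k)) ρ :=
    Metric.ball_subset_ball (min_le_right _ _) hmem
  have h1 := hball _ (Metric.ball_subset_ball (min_le_left _ _) hmem)
  rw [Real.norm_eq_abs, Real.norm_eq_abs, abs_of_nonneg (sq_nonneg ‖(√(n : ℝ))⁻¹ • h‖), norm_smul,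
    norm_inv, Real.norm_eq_abs, abs_of_pos hsn] at h1
  have h2 := H.natCast_mul_integral_trunc_sub_le hn hρ
  have h3 : ∑ i ∈ Finset.range n, L ((√(n : ℝ))⁻¹ • h) (X i ω) - truncIncrement Q L m X n h ω
      = n * ∫ x, trunc L m n ((√(n : ℝ))⁻¹ • h) x ∂Q := by
    rw [truncIncrement, Finset.sum_sub_distrib]
    have : ∑ i ∈ Finset.range n, trunc L m n ((√(n : ℝ))⁻¹ • h) (X i ω)
        = ∑ i ∈ Finset.range n, L ((√(n : ℝ))⁻¹ • h) (X i ω) :=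
      Finset.sum_congr rfl fun i hi => by
        simp [trunc, hω i (Finset.mem_range.1 hi)]
    rw [this]
    simp
  have h4 : ∫ x, ⟪(√(n : ℝ))⁻¹ • h, s x⟫ ^ 2 ∂Q = (n : ℝ)⁻¹ * ∫ x, ⟪h, s x⟫ ^ 2 ∂Q := by
    rw [← integral_const_mul]
    refine integral_congr_ae (ae_of_all _ fun x => ?_)
    simp only [inner_smul_left, mul_pow, RCLike.conj_to_real]
    rw [inv_pow, Real.sq_sqrt (Nat.cast_nonneg n)]
  have h5 : |n * ∫ x, L ((√(n : ℝ))⁻¹ • h) x ∂Q + 1 / 2 * ∫ x, ⟪h, s x⟫ ^ 2 ∂Q| ≤ ε * ‖h‖ ^ 2 := by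
    have hn' : (0 : ℝ) < n := by exact_mod_cast hn
    have h6 := mul_le_mul_of_nonneg_left h1 hn'.le
    rw [h4, ← abs_of_pos hn', ← abs_mul, abs_of_pos hn'] at h6
    refine (le_of_eq ?_).trans (h6.trans_eq ?_)
    · congr 1; field_simp
    · rw [mul_pow, inv_pow, ← hnn]; field_simp
  rw [h3]
  calc _ = |(n * ∫ x, L ((√(n : ℝ))⁻¹ • h) x ∂Q + 1 / 2 * ∫ x, ⟪h, s x⟫ ^ 2 ∂Q)
        + (n * ∫ x, trunc L m n ((√(n : ℝ))⁻¹ • h) x ∂Q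
          - n * ∫ x, L ((√(n : ℝ))⁻¹ • h) x ∂Q)| := by congr 1; ring
    _ ≤ _ := (abs_add_le _ _).trans (add_le_add h5 h2)

/-- The log-likelihood ratio is negative outside a ball of radius `M / √n`, within a fixed
neighbourhood, with high probability. -/
theorem exists_measure_nonneg_le (H : IsLocalModel Q L m s ρ) (hindep : iIndepFun X P)
    (hlaw : ∀ i, HasLaw (X i) Q P) {c : ℝ} (hc : 0 < c)
    (hI : ∀ h : EuclideanSpace ℝ (Fin k), c * ‖h‖ ^ 2 ≤ ∫ x, ⟪h, s x⟫ ^ 2 ∂Q) :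
    ∃ δ > 0, ∀ η > (0 : ℝ), ∃ M > (0 : ℝ), ∀ᶠ n : ℕ in atTop,
      P {ω | ∃ h : EuclideanSpace ℝ (Fin k), M ≤ ‖h‖ ∧ ‖h‖ < δ * √(n : ℝ) ∧
        0 ≤ ∑ i ∈ Finset.range n, L ((√(n : ℝ))⁻¹ • h) (X i ω)} ≤ ENNReal.ofReal η := by
  obtain ⟨δ₀, hδ₀, hδρ, hdec⟩ := H.exists_forall_abs_sum_sub_le (X := X)
    (show 0 < c / 16 by positivity)
  -- The radius must not depend on η, since consistency only places the maximizer in a fixed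
  -- neighbourhood. The second bound keeps the cube around each dyadic shell inside the domain of
  -- the model.
  refine ⟨min δ₀ (ρ / (2 * (k + 1))), lt_min hδ₀ (div_pos H.pos (by positivity)), fun η hη => ?_⟩
  set q := 2 * k + 2 with hq
  set C := tailConst k Q m with hC
  have hC0 : 0 ≤ C := tailConst_nonneg
  have hMlim : Tendsto (fun M : ℝ => C * (64 * (k + 1) / c / M) ^ q * 2) atTop (𝓝 0) := by
    have h1 : Tendsto (fun M : ℝ => 64 * (k + 1) / c / M) atTop (𝓝 0) :=
      tendsto_const_nhds.div_atTop tendsto_id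
    have h2 := ((h1.pow q).const_mul C).mul_const 2
    simpa [hq] using h2
  obtain ⟨M, hMη, hM1⟩ := (((tendsto_order.1 hMlim).2 (η / 2) (by positivity)).and
    (eventually_ge_atTop (1 : ℝ))).exists
  have hM0 : 0 < M := by linarith
  refine ⟨M, hM0, ?_⟩
  filter_upwards [eventually_gt_atTop 0,
    H.tendsto_tailMoment.eventually_le_const (show 0 < η / 2 by positivity),
    H.tendsto_tailMoment.eventually_le_const (show 0 < c / 16 by positivity)] with n hn hτη hτc
  have hsn : 0 < √(n : ℝ) := Real.sqrt_pos.2 (by exact_mod_cast hn)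
  let shell : ℕ → Set Ω := fun j => {ω | M * 2 ^ j < min δ₀ (ρ / (2 * (k + 1))) * √(n : ℝ) ∧
    ∃ h : EuclideanSpace ℝ (Fin k), ‖h‖ < M * 2 ^ (j + 1) ∧
      c * M * 2 ^ j / (64 * (k + 1)) * (4 * (M * 2 ^ (j + 1)) * (k + 1))
        < |truncIncrement Q L m X n h ω|}
  -- Peeling: on the shell M2ʲ ≤ ‖h‖ < M2ʲ⁺¹ the drift is of order 4ʲM² and the fluctuation of order
  -- 2ʲM, so the maximal inequality applies with a threshold t growing like 2ʲM.
  have hshell : ∀ j, P (shell j) ≤ ENNReal.ofReal (C * (64 * (k + 1) / c / M) ^ q * (1 / 2) ^ j) := by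
    intro j
    by_cases hj : M * 2 ^ j < min δ₀ (ρ / (2 * (k + 1))) * √(n : ℝ)
    · have hRn : M * 2 ^ (j + 1) * (k + 1) < ρ * √(n : ℝ) := by
        have h1 : M * 2 ^ j < ρ / (2 * (k + 1)) * √(n : ℝ) :=
          hj.trans_le (by gcongr; exact min_le_right _ _)
        calc M * 2 ^ (j + 1) * (k + 1) = M * 2 ^ j * (2 * (k + 1)) := by ring
          _ < ρ / (2 * (k + 1)) * √(n : ℝ) * (2 * (k + 1)) := by gcongr
          _ = _ := by field_simp
      refine (measure_mono fun ω hω => hω.2).trans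
        ((H.measure_exists_lt_abs_truncIncrement_le hindep hlaw hn (by positivity) hRn
          (by positivity)).trans (ENNReal.ofReal_le_ofReal ?_))
      have h2 : C / (c * M * 2 ^ j / (64 * (k + 1))) ^ q
          = C * (64 * (k + 1) / c / M) ^ q * ((1 / 2) ^ j) ^ q := by
        rw [div_eq_mul_inv, ← inv_pow, mul_assoc C, ← mul_pow]
        congr 2
        rw [one_div, inv_pow]
        field_simp
      rw [← hC, ← hq, h2]
      gcongr
      refine pow_le_of_le_one (by positivity) (pow_le_one₀ (by norm_num) (by norm_num)) (by omega)
    · refine le_of_eq_of_le (measure_mono_null (fun ω hω => (hj hω.1).elim) measure_empty) zero_le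
  have hsub : {ω | ∃ h : EuclideanSpace ℝ (Fin k), M ≤ ‖h‖ ∧
      ‖h‖ < min δ₀ (ρ / (2 * (k + 1))) * √(n : ℝ) ∧
      0 ≤ ∑ i ∈ Finset.range n, L ((√(n : ℝ))⁻¹ • h) (X i ω)}
      ⊆ {ω | ¬ ∀ i < n, m (X i ω) ≤ √(n : ℝ)} ∪ ⋃ j, shell j := by
    rintro ω ⟨h, hMh, hhδ, hpos⟩
    by_cases hω : ∀ i < n, m (X i ω) ≤ √(n : ℝ)
    · refine Or.inr (Set.mem_iUnion.2 ?_)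
      obtain ⟨j, hj1, hj2⟩ := exists_nat_pow_near ((one_le_div₀ hM0).2 hMh) one_lt_two
      rw [le_div_iff₀ hM0] at hj1
      rw [div_lt_iff₀ hM0] at hj2
      have hh0 : 0 < ‖h‖ := hM0.trans_le hMh
      have h1 := hdec n hn ω hω h (hhδ.trans_le (by gcongr; exact min_le_left _ _))
      have h2 := (_root_.abs_le.1 h1).2
      have h3 := hI h
      have h4 : tailMoment Q m n * ‖h‖ ≤ c / 16 * ‖h‖ ^ 2 := by
        have : ‖h‖ ≤ ‖h‖ ^ 2 := by nlinarith
        calc tailMoment Q m n * ‖h‖ ≤ c / 16 * ‖h‖ := by gcongr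
          _ ≤ _ := by gcongr
      -- The drift contributes c/2, and the expansion and truncation errors cost c/16 each.
      have h5 : 3 / 8 * c * ‖h‖ ^ 2 ≤ truncIncrement Q L m X n h ω := by nlinarith
      refine ⟨j, by linarith, h, by linarith, ?_⟩
      refine lt_of_lt_of_le ?_ (h5.trans (le_abs_self _))
      have h6 : (2 ^ j * M) ^ 2 ≤ ‖h‖ ^ 2 := by gcongr
      have e : c * M * 2 ^ j / (64 * (k + 1)) * (4 * (M * 2 ^ (j + 1)) * (k + 1))
          = c / 8 * (2 ^ j * M) ^ 2 := by
        rw [pow_succ]; field_simp; norm_num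
      rw [e]
      have h7 : 0 < c * ‖h‖ ^ 2 := by positivity
      nlinarith
    · exact Or.inl hω
  refine (measure_mono hsub).trans ((measure_union_le _ _).trans ?_)
  have h1 : P (⋃ j, shell j) ≤ ENNReal.ofReal (η / 2) := by
    refine (measure_iUnion_le _).trans ((ENNReal.tsum_le_tsum hshell).trans ?_)
    rw [← ENNReal.ofReal_tsum_of_nonneg (fun j => by positivity)
      ((summable_geometric_of_lt_one (by norm_num) (by norm_num)).mul_left _), tsum_mul_left,
      tsum_geometric_two]
    exact ENNReal.ofReal_le_ofReal hMη.le
  refine (add_le_add ((H.measure_exists_lt_le hlaw).trans (ENNReal.ofReal_le_ofReal hτη))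
    h1).trans_eq ?_
  rw [← ENNReal.ofReal_add (by positivity) (by positivity), add_halves]

/-- The normalized sum of the scores. -/
noncomputable def scoreSum (s : 𝓧 → EuclideanSpace ℝ (Fin k)) (X : ℕ → Ω → 𝓧) (n : ℕ) (ω : Ω) :
    EuclideanSpace ℝ (Fin k) :=
  (√(n : ℝ))⁻¹ • ∑ i ∈ Finset.range n, s (X i ω)

/-- Chebyshev at a fixed h: with g = h/√n, the summands L(g) - ⟪g, s⟫ have second moment o(‖g‖²) =
o(1/n), and truncation adds only ‖g‖² times a vanishing tail moment. The score needs no centring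
because its mean is 0. -/
lemma tendsto_measure_lt_abs_truncIncrement_sub (H : IsLocalModel Q L m s ρ)
    (hindep : iIndepFun X P) (hlaw : ∀ i, HasLaw (X i) Q P) (h : EuclideanSpace ℝ (Fin k))
    {ε : ℝ} (hε : 0 < ε) :
    Tendsto (fun n => P {ω | ε ≤ |truncIncrement Q L m X n h ω - ⟪h, scoreSum s X n ω⟫|})
      atTop (𝓝 0) := by
  refine ENNReal_tendsto_zero_of_ofReal fun η hη => ?_
  have hb : 0 < η * ε ^ 2 / (2 * (2 * (‖h‖ ^ 2 + 1))) := by positivity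
  have hev1 : ∀ᶠ n : ℕ in atTop, ∫ x, (L ((√(n : ℝ))⁻¹ • h) x - ⟪(√(n : ℝ))⁻¹ • h, s x⟫) ^ 2 ∂Q
      ≤ η * ε ^ 2 / (2 * (2 * (‖h‖ ^ 2 + 1))) * ‖(√(n : ℝ))⁻¹ • h‖ ^ 2 := by
    have hlim : Tendsto (fun n : ℕ => (√(n : ℝ))⁻¹ • h) atTop (𝓝 0) := by
      simpa using tendsto_inv_sqrt_natCast.smul_const h
    filter_upwards [hlim.eventually (isLittleO_iff.1 H.isLittleO_integral_sq_sub_inner hb)]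
      with n hn
    rw [Real.norm_eq_abs, Real.norm_eq_abs, abs_of_nonneg (sq_nonneg ‖_‖)] at hn
    exact (le_abs_self _).trans hn
  have hball : ∀ᶠ n : ℕ in atTop, ‖h‖ < ρ * √(n : ℝ) :=
    ((Real.tendsto_sqrt_atTop.comp tendsto_natCast_atTop_atTop).const_mul_atTop
      H.pos).eventually_gt_atTop _
  filter_upwards [hev1, hball, eventually_gt_atTop 0,
    H.tendsto_tailMoment.eventually_le_const hb] with n h1 h2 hn hτ
  have hsn : 0 < √(n : ℝ) := Real.sqrt_pos.2 (by exact_mod_cast hn)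
  have hn' : (0 : ℝ) < n := by exact_mod_cast hn
  have hmem := smul_mem_ball hn h2
  set g := (√(n : ℝ))⁻¹ • h with hg
  have hgn : ‖g‖ ^ 2 = (n : ℝ)⁻¹ * ‖h‖ ^ 2 := by
    rw [hg, norm_smul, norm_inv, Real.norm_eq_abs, abs_of_pos hsn, mul_pow, inv_pow,
      Real.sq_sqrt (Nat.cast_nonneg n)]
  have hS : MeasurableSet {x | m x ≤ √(n : ℝ)} := measurableSet_le H.meas_m measurable_const
  set f : 𝓧 → ℝ := fun x => trunc L m n g x - ⟪g, s x⟫ with hf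
  have hfm : Measurable f :=
    (H.measurable_trunc n hmem).sub (measurable_const.inner H.meas_s)
  have hf2 : MemLp f 2 Q := ((H.memLp_L hmem).indicator hS).sub (H.memLp_inner g)
  have hint : ∫ x, f x ∂Q = ∫ x, trunc L m n g x ∂Q := by
    rw [hf, integral_sub (H.integrable_trunc n hmem)
      ((H.memLp_inner g).integrable (by norm_num)), H.integral_inner_s, sub_zero]
  have hdiff : MemLp (fun x => L g x - ⟪g, s x⟫) 2 Q := (H.memLp_L hmem).sub (H.memLp_inner g)
  have hbound : ∫ x, f x ^ 2 ∂Q ≤ 2 * ∫ x, (L g x - ⟪g, s x⟫) ^ 2 ∂Q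
      + 2 * ‖g‖ ^ 2 * tailMoment Q m n := by
    rw [tailMoment, ← integral_const_mul, ← integral_const_mul,
      ← integral_add (hdiff.integrable_sq.const_mul 2) ((H.integrable_tail n).const_mul _)]
    refine integral_mono hf2.integrable_sq
      ((hdiff.integrable_sq.const_mul 2).add ((H.integrable_tail n).const_mul _)) fun x => ?_
    by_cases hx : √(n : ℝ) < m x
    · have hx' : ¬ m x ≤ √(n : ℝ) := not_le.2 hx
      simp only [hf, trunc, Set.indicator, Set.mem_ofPred_eq, hx, hx', if_true, if_false]
      have h3 := pow_le_pow_left₀ (abs_nonneg _) (H.abs_le hmem x) 2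
      rw [sq_abs, mul_pow] at h3
      nlinarith [sq_nonneg (2 * L g x - ⟪g, s x⟫)]
    · have hx' : m x ≤ √(n : ℝ) := not_lt.1 hx
      simp only [hf, trunc, Set.indicator, Set.mem_ofPred_eq, hx, hx', if_true, if_false]
      nlinarith [sq_nonneg (L g x - ⟪g, s x⟫)]
  have hset : {ω | ε ≤ |truncIncrement Q L m X n h ω - ⟪h, scoreSum s X n ω⟫|}
      = {ω | ε ≤ |∑ i ∈ Finset.range n, (f (X i ω) - ∫ x, f x ∂Q)|} := by
    ext ω
    simp only [Set.mem_ofPred_eq]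
    have e1 : ⟪h, scoreSum s X n ω⟫ = ∑ i ∈ Finset.range n, ⟪g, s (X i ω)⟫ := by
      rw [scoreSum, inner_smul_right, inner_sum, Finset.mul_sum]
      refine Finset.sum_congr rfl fun i _ => ?_
      rw [hg, inner_smul_left, RCLike.conj_to_real]
    rw [e1, truncIncrement, ← hg, ← Finset.sum_sub_distrib, hint]
    congr! 3
    simp only [hf]; ring
  rw [hset]
  refine (measure_le_abs_sum_sub_le hindep hlaw hfm hf2 n hε).trans (ENNReal.ofReal_le_ofReal ?_)
  rw [div_le_iff₀ (by positivity)]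
  have h4 : n * ∫ x, f x ^ 2 ∂Q ≤ n * (2 * (η * ε ^ 2 / (2 * (2 * (‖h‖ ^ 2 + 1))) * ‖g‖ ^ 2)
      + 2 * ‖g‖ ^ 2 * (η * ε ^ 2 / (2 * (2 * (‖h‖ ^ 2 + 1))))) := by
    refine mul_le_mul_of_nonneg_left (hbound.trans ?_) hn'.le
    gcongr
  refine h4.trans ?_
  rw [hgn]
  have e : (n : ℝ) * (2 * (η * ε ^ 2 / (2 * (2 * (‖h‖ ^ 2 + 1))) * ((n : ℝ)⁻¹ * ‖h‖ ^ 2))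
      + 2 * ((n : ℝ)⁻¹ * ‖h‖ ^ 2) * (η * ε ^ 2 / (2 * (2 * (‖h‖ ^ 2 + 1)))))
      = η * ε ^ 2 * (‖h‖ ^ 2 / (‖h‖ ^ 2 + 1)) := by
    field_simp; ring
  rw [e]
  refine mul_le_of_le_one_right (by positivity) ((div_le_one (by positivity)).2 (by linarith))

/-- The normalized sums of the scores are tight. -/
lemma exists_measure_lt_norm_scoreSum_le (H : IsLocalModel Q L m s ρ) (hindep : iIndepFun X P)
    (hlaw : ∀ i, HasLaw (X i) Q P) {η : ℝ} (hη : 0 < η) :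
    ∃ T > (0 : ℝ), ∀ n : ℕ, P {ω | T < ‖scoreSum s X n ω‖} ≤ ENNReal.ofReal η := by
  set B := ∫ x, ‖s x‖ ^ 2 ∂Q with hB
  have hB0 : 0 ≤ B := integral_nonneg fun _ => sq_nonneg _
  have hlim : Tendsto (fun T : ℝ => k * (B / (T / (k + 1)) ^ 2)) atTop (𝓝 0) := by
    have h1 : Tendsto (fun T : ℝ => (T / ((k : ℝ) + 1)) ^ 2) atTop atTop :=
      (tendsto_pow_atTop two_ne_zero).comp (tendsto_id.atTop_div_const (by positivity))
    simpa using (tendsto_const_nhds.div_atTop h1).const_mul (k : ℝ)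
  obtain ⟨T, hT1, hT0⟩ := (((tendsto_order.1 hlim).2 η hη).and (eventually_gt_atTop 0)).exists
  refine ⟨T, hT0, fun n => ?_⟩
  rcases Nat.eq_zero_or_pos n with rfl | hn
  · simp [scoreSum, not_lt.2 hT0.le]
  have hsn : 0 < √(n : ℝ) := Real.sqrt_pos.2 (by exact_mod_cast hn)
  have hn' : (0 : ℝ) < n := by exact_mod_cast hn
  -- The normalization is put into the summand, so Chebyshev's bound for each coordinate is free of
  -- n.
  let f : Fin k → 𝓧 → ℝ := fun j x => ⟪(√(n : ℝ))⁻¹ • EuclideanSpace.single j (1 : ℝ), s x⟫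
  have hT' : 0 < T / (k + 1) := by positivity
  have hsub : {ω | T < ‖scoreSum s X n ω‖} ⊆
      ⋃ j, {ω | T / (k + 1) ≤ |∑ i ∈ Finset.range n, (f j (X i ω) - ∫ x, f j x ∂Q)|} := by
    intro ω hω
    by_contra hcon
    simp only [Set.mem_iUnion, Set.mem_ofPred_eq, not_exists, not_le] at hcon hω
    have hco : ∀ j, |(scoreSum s X n ω) j| < T / (k + 1) := by
      intro j
      have h0 : ∫ x, f j x ∂Q = 0 := H.integral_inner_s _
      have h1 := hcon j
      simp only [h0, sub_zero] at h1
      have e : (scoreSum s X n ω) j = ∑ i ∈ Finset.range n, f j (X i ω) := by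
        simp [scoreSum, f, inner_smul_left, EuclideanSpace.inner_single_left, Finset.mul_sum]
      rwa [e]
    have h2 : ‖(scoreSum s X n ω)‖ ≤ (k + 1) * (T / (k + 1)) := by
      refine (norm_toLp_le (WithLp.ofLp (scoreSum s X n ω))).trans ?_
      gcongr
      rw [pi_norm_le_iff_of_nonneg hT'.le]
      exact fun j => (hco j).le
    rw [mul_div_cancel₀ _ (by positivity)] at h2
    exact absurd hω (not_lt.2 h2)
  refine (measure_mono hsub).trans ((measure_iUnion_fintype_le _ _).trans ?_)
  have hj : ∀ j, P {ω | T / (k + 1) ≤ |∑ i ∈ Finset.range n, (f j (X i ω) - ∫ x, f j x ∂Q)|}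
      ≤ ENNReal.ofReal (B / (T / (k + 1)) ^ 2) := by
    intro j
    refine (measure_le_abs_sum_sub_le hindep hlaw (measurable_const.inner H.meas_s)
      (H.memLp_inner _) n hT').trans (ENNReal.ofReal_le_ofReal ?_)
    gcongr
    refine (mul_le_mul_of_nonneg_left (H.integral_inner_sq_le _) hn'.le).trans_eq ?_
    rw [norm_smul, PiLp.norm_single, norm_one, mul_one, norm_inv, Real.norm_eq_abs,
      abs_of_pos hsn, inv_pow, Real.sq_sqrt (Nat.cast_nonneg n)]
    field_simp
    exact hB.symm
  refine (Finset.sum_le_sum fun j _ => hj j).trans ?_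
  rw [Finset.sum_const, nsmul_eq_mul, ← ENNReal.ofReal_natCast,
    ← ENNReal.ofReal_mul (Nat.cast_nonneg _)]
  refine ENNReal.ofReal_le_ofReal ?_
  simpa using hT1.le

/-- **Uniform local asymptotic normality** of the log-likelihood ratio on bounded sets. -/
theorem tendsto_measure_exists_lt_abs (H : IsLocalModel Q L m s ρ) (hindep : iIndepFun X P)
    (hlaw : ∀ i, HasLaw (X i) Q P) {M ε : ℝ} (hM : 0 ≤ M) (hε : 0 < ε) :
    Tendsto (fun n : ℕ => P {ω | ∃ h : EuclideanSpace ℝ (Fin k), ‖h‖ ≤ M ∧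
      ε < |∑ i ∈ Finset.range n, L ((√(n : ℝ))⁻¹ • h) (X i ω) - ⟪h, scoreSum s X n ω⟫
        + 1 / 2 * ∫ x, ⟪h, s x⟫ ^ 2 ∂Q|}) atTop (𝓝 0) := by
  refine ENNReal_tendsto_zero_of_ofReal fun η hη => ?_
  obtain ⟨δ, hδ, hδρ, hdec⟩ := H.exists_forall_abs_sum_sub_le (X := X)
    (show 0 < ε / (4 * (M ^ 2 + 1)) by positivity)
  obtain ⟨T, hT0, hT⟩ := H.exists_measure_lt_norm_scoreSum_le hindep hlaw
    (show 0 < η / 4 by positivity)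
  have hR : 0 < M + 1 := by positivity
  set R := M + 1 with hRdef
  set B := 2 * R * (k + 1) with hB
  have hB0 : 0 < B := by positivity
  obtain ⟨t, ht1, ht0⟩ : ∃ t : ℝ, tailConst k Q m / t ^ (2 * k + 2) < η / 4 ∧ 0 < t := by
    have h1 : Tendsto (fun t : ℝ => tailConst k Q m / t ^ (2 * k + 2)) atTop (𝓝 0) :=
      tendsto_const_nhds.div_atTop (tendsto_pow_atTop (by omega))
    exact (((tendsto_order.1 h1).2 _ (by positivity)).and (eventually_gt_atTop 0)).exists
  -- The mesh depends on t and T but not on n, so only finitely many pointwise limits are needed.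
  -- Passing from h to its grid point costs ε/8 for the process and ε/8 for the linear term.
  obtain ⟨i, hi1, hi2⟩ : ∃ i : ℕ, t * B * (3 / 4) ^ i ≤ ε / 8 ∧ B * (1 / 2) ^ i * T ≤ ε / 8 := by
    have h1 : Tendsto (fun i : ℕ => t * B * (3 / 4 : ℝ) ^ i) atTop (𝓝 0) := by
      simpa using (tendsto_pow_atTop_nhds_zero_of_lt_one (r := (3 / 4 : ℝ)) (by norm_num)
        (by norm_num)).const_mul (t * B)
    have h2 : Tendsto (fun i : ℕ => B * (1 / 2 : ℝ) ^ i * T) atTop (𝓝 0) := by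
      simpa using ((tendsto_pow_atTop_nhds_zero_of_lt_one (r := (1 / 2 : ℝ)) (by norm_num)
        (by norm_num)).const_mul B).mul_const T
    exact ((h1.eventually_le_const (by positivity)).and
      (h2.eventually_le_const (by positivity))).exists
  have hgrid : Tendsto (fun n => ∑ b : Fin k → Fin (2 ^ i),
      P {ω | ε / 8 ≤ |truncIncrement Q L m X n (cubeMap R (gridPoint i b)) ω
        - ⟪cubeMap R (gridPoint i b), scoreSum s X n ω⟫|}) atTop (𝓝 0) := by
    simpa using tendsto_finsetSum Finset.univ fun b _ =>
      H.tendsto_measure_lt_abs_truncIncrement_sub hindep hlaw (cubeMap R (gridPoint i b))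
        (show 0 < ε / 8 by positivity)
  have hsq := Real.tendsto_sqrt_atTop.comp (tendsto_natCast_atTop_atTop (R := ℝ))
  have hτM : Tendsto (fun n => tailMoment Q m n * M) atTop (𝓝 0) := by
    simpa using H.tendsto_tailMoment.mul_const M
  filter_upwards [eventually_gt_atTop 0, (hsq.const_mul_atTop hδ).eventually_gt_atTop M,
    (hsq.const_mul_atTop H.pos).eventually_gt_atTop (R * (k + 1)),
    eventually_le_ofReal_of_tendsto_zero hgrid (show 0 < η / 4 by positivity),
    H.tendsto_tailMoment.eventually_le_const (show 0 < η / 4 by positivity),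
    hτM.eventually_le_const (show 0 < ε / 8 by positivity)] with n hn hMn hRn hgr hτ hτM
  have hmod := H.measure_truncIncrement_modulus_le hindep hlaw hn hR hRn ht0
  have hsub : {ω | ∃ h : EuclideanSpace ℝ (Fin k), ‖h‖ ≤ M ∧
      ε < |∑ i ∈ Finset.range n, L ((√(n : ℝ))⁻¹ • h) (X i ω) - ⟪h, scoreSum s X n ω⟫
        + 1 / 2 * ∫ x, ⟪h, s x⟫ ^ 2 ∂Q|} ⊆
      ({ω | ¬ ∀ i < n, m (X i ω) ≤ √(n : ℝ)} ∪ {ω | T < ‖scoreSum s X n ω‖}) ∪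
      ({ω | ¬ ∀ v ∈ unitCube k, ∀ i, |truncIncrement Q L m X n (cubeMap R v) ω
        - truncIncrement Q L m X n (cubeMap R (dyadicFloor i v)) ω| ≤ t * B * (3 / 4) ^ i} ∪
      ⋃ b : Fin k → Fin (2 ^ i),
        {ω | ε / 8 ≤ |truncIncrement Q L m X n (cubeMap R (gridPoint i b)) ω
        - ⟪cubeMap R (gridPoint i b), scoreSum s X n ω⟫|}) := by
    rintro ω ⟨h, hhM, hlt⟩
    by_contra hcon
    simp only [Set.mem_union, not_or, Set.mem_ofPred_eq, not_not, Set.mem_iUnion, not_exists,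
      not_le, not_lt] at hcon
    obtain ⟨⟨hω1, hω2⟩, hω3, hω4⟩ := hcon
    obtain ⟨v, hv, rfl⟩ := exists_cubeMap_eq hR (hhM.trans_lt (by rw [hRdef]; linarith))
    obtain ⟨b, hb⟩ := exists_gridPoint_eq i hv
    have h1 := hdec n hn ω hω1 _ (hhM.trans_lt hMn)
    have h2 := hω3 v hv i
    have h3 := hω4 b
    rw [hb] at h3
    have h4 : |⟪cubeMap R v, scoreSum s X n ω⟫ - ⟪cubeMap R (dyadicFloor i v), scoreSum s X n ω⟫|
        ≤ ε / 8 := by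
      rw [← inner_sub_left]
      refine (abs_real_inner_le_norm _ _).trans (le_trans ?_ hi2)
      have h5 := norm_cubeMap_sub_le hR.le v (dyadicFloor i v)
      have h6 := norm_dyadicFloor_sub_le i hv
      gcongr
      exact h5.trans (by gcongr)
    have h7 : ε / (4 * (M ^ 2 + 1)) * ‖cubeMap R v‖ ^ 2 ≤ ε / 4 := by
      calc ε / (4 * (M ^ 2 + 1)) * ‖cubeMap R v‖ ^ 2 ≤ ε / (4 * (M ^ 2 + 1)) * M ^ 2 := by gcongr
        _ = ε / 4 * (M ^ 2 / (M ^ 2 + 1)) := by field_simp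
        _ ≤ ε / 4 := mul_le_of_le_one_right (by positivity)
            ((div_le_one (by positivity)).2 (by linarith))
    have h8 : tailMoment Q m n * ‖cubeMap R v‖ ≤ ε / 8 :=
      (mul_le_mul_of_nonneg_left hhM (tailMoment_nonneg n)).trans hτM
    rw [_root_.abs_le] at h1 h2 h4
    rw [abs_lt] at h3
    rw [lt_abs] at hlt
    rcases hlt with hlt | hlt <;>
      linarith [h1.1, h1.2, h2.1, h2.2, h3.1, h3.2, h4.1, h4.2]
  refine (measure_mono hsub).trans ((measure_union_le _ _).trans (add_le_add
    (measure_union_le _ _) (measure_union_le _ _))) |>.trans ?_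
  have e1 := (H.measure_exists_lt_le hlaw (n := n)).trans (ENNReal.ofReal_le_ofReal hτ)
  have e2 := hT n
  have e3 := hmod.trans (ENNReal.ofReal_le_ofReal ht1.le)
  have e4 := (measure_iUnion_fintype_le P fun b : Fin k → Fin (2 ^ i) =>
    {ω | ε / 8 ≤ |truncIncrement Q L m X n (cubeMap R (gridPoint i b)) ω
      - ⟪cubeMap R (gridPoint i b), scoreSum s X n ω⟫|}).trans hgr
  refine (add_le_add (add_le_add e1 e2) (add_le_add e3 e4)).trans_eq ?_
  rw [← ENNReal.ofReal_add (by positivity) (by positivity),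
    ← ENNReal.ofReal_add (by positivity) (by positivity)]
  congr 1; ring

end IsLocalModel

/-! ### From densities to a local model -/

section Model

set_option linter.unusedSectionVars false

variable {k : ℕ} {𝓧 : Type*} [MeasurableSpace 𝓧] {ν : Measure 𝓧}
  {p : EuclideanSpace ℝ (Fin k) → 𝓧 → ℝ≥0} {θs : EuclideanSpace ℝ (Fin k)}

/-- The log-likelihood ratio at `θs + h` against `θs`, where `p θs` is positive. -/
noncomputable def logRatio (p : EuclideanSpace ℝ (Fin k) → 𝓧 → ℝ≥0)
    (θs h : EuclideanSpace ℝ (Fin k)) : 𝓧 → ℝ :=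
  {x | p θs x ≠ 0}.indicator fun x => Real.log (p (θs + h) x) - Real.log (p θs x)

lemma log_coe_of_ne_zero {a : ℝ≥0} (ha : a ≠ 0) :
    ENNReal.log (a : ℝ≥0∞) = ((Real.log a : ℝ) : EReal) :=
  ENNReal.log_of_nnreal ha

lemma ne_zero_of_log_le {a b : ℝ≥0} {c : ℝ}
    (h : ENNReal.log (a : ℝ≥0∞) ≤ ENNReal.log (b : ℝ≥0∞) + (c : EReal)) (ha : a ≠ 0) : b ≠ 0 := by
  rintro rfl
  rw [ENNReal.coe_zero, ENNReal.log_zero, EReal.bot_add, le_bot_iff, ENNReal.log_eq_bot_iff,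
    ENNReal.coe_eq_zero] at h
  exact ha h

lemma log_sub_log_le_of_log_le {a b : ℝ≥0} {c : ℝ}
    (h : ENNReal.log (a : ℝ≥0∞) ≤ ENNReal.log (b : ℝ≥0∞) + (c : EReal)) (ha : a ≠ 0) :
    Real.log a - Real.log b ≤ c := by
  have hb := ne_zero_of_log_le h ha
  rw [log_coe_of_ne_zero ha, log_coe_of_ne_zero hb] at h
  have : Real.log a ≤ Real.log b + c := by exact_mod_cast h
  linarith

lemma isProbabilityMeasure_law (hm : ∫⁻ x, (p θs x : ℝ≥0∞) ∂ν = 1) :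
    IsProbabilityMeasure (law ν p θs) := ⟨by
  rw [law, withDensity_apply _ MeasurableSet.univ, Measure.restrict_univ, hm]⟩

lemma ae_law_ne_zero (hm : Measurable (p θs)) : ∀ᵐ x ∂law ν p θs, p θs x ≠ 0 := by
  rw [law, ae_withDensity_iff hm.coe_nnreal_ennreal]
  exact ae_of_all _ fun x hx => by simpa using hx

/-- A family of densities that is differentiable in quadratic mean, with locally Lipschitz
logarithm, gives rise to a local model; the densities near `θs` have the same support. -/
theorem exists_isLocalModel {Θ : Set (EuclideanSpace ℝ (Fin k))} (hp : IsDensityFamily ν p Θ)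
    {score : 𝓧 → EuclideanSpace ℝ (Fin k)} (hscore : Measurable score)
    (C2 : DiffQuadMean ν p θs score) (C3 : LipschitzLogDensity ν p Θ θs) :
    ∃ m ρ, IsLocalModel (law ν p θs) (logRatio p θs) m score ρ ∧
      ∀ h ∈ Metric.ball (0 : EuclideanSpace ℝ (Fin k)) ρ, ∀ x, p θs x ≠ 0 → p (θs + h) x ≠ 0 := by
  obtain ⟨U, hU, hUΘ, m, hm, hm2, hlip⟩ := C3
  obtain ⟨ρ, hρ, hball⟩ := Metric.mem_nhds_iff.1 hU
  have hmemU : ∀ h ∈ Metric.ball (0 : EuclideanSpace ℝ (Fin k)) ρ, θs + h ∈ U := fun h hh =>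
    hball (by simpa [dist_eq_norm] using hh)
  have h0U : θs ∈ U := mem_of_mem_nhds hU
  have hmp : Measurable (p θs) := (hp θs (hUΘ h0U)).1
  have hpos : ∀ h ∈ Metric.ball (0 : EuclideanSpace ℝ (Fin k)) ρ, ∀ x, p θs x ≠ 0 →
      p (θs + h) x ≠ 0 := fun h hh x hx =>
    ne_zero_of_log_le (hlip x θs h0U (θs + h) (hmemU h hh)) hx
  have hzero : ∀ h ∈ Metric.ball (0 : EuclideanSpace ℝ (Fin k)) ρ, ∀ x, p θs x = 0 →
      p (θs + h) x = 0 := fun h hh x hx => by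
    by_contra hne
    exact ne_zero_of_log_le (hlip x (θs + h) (hmemU h hh) θs h0U) hne hx
  have hS : MeasurableSet {x | p θs x ≠ 0} := (hmp (measurableSet_singleton 0)).compl
  have hmeas : ∀ h ∈ Metric.ball (0 : EuclideanSpace ℝ (Fin k)) ρ,
      Measurable (logRatio p θs h) := fun h hh =>
    ((Real.measurable_log.comp (hp _ (hUΘ (hmemU h hh))).1.coe_nnreal_real).sub
      (Real.measurable_log.comp hmp.coe_nnreal_real)).indicator hS
  have hexp : ∀ h ∈ Metric.ball (0 : EuclideanSpace ℝ (Fin k)) ρ, ∀ x, p θs x ≠ 0 →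
      Real.exp (logRatio p θs h x) = p (θs + h) x / p θs x := fun h hh x hx => by
    have h1 : (0 : ℝ) < p θs x := by exact_mod_cast pos_iff_ne_zero.2 hx
    have h2 : (0 : ℝ) < p (θs + h) x := by exact_mod_cast pos_iff_ne_zero.2 (hpos h hh x hx)
    simp only [logRatio, Set.indicator, Set.mem_ofPred_eq, hx, ne_eq, not_false_eq_true, if_true]
    rw [Real.exp_sub, Real.exp_log h2, Real.exp_log h1]
  have hz : ∀ x, logRatio p θs 0 x = 0 := fun x => by simp [logRatio, Set.indicator]
  refine ⟨fun x => |m x|, ρ, ⟨hρ, hmeas, ?_, hz, hm.abs, fun x => abs_nonneg _, ?_, hscore, ?_, ?_⟩,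
    hpos⟩
  · intro h hh h' hh' x
    by_cases hx : p θs x = 0
    · simp [logRatio, hx]; positivity
    · have h1 := log_sub_log_le_of_log_le
        (hlip x _ (hmemU h hh) _ (hmemU h' hh')) (hpos h hh x hx)
      have h2 := log_sub_log_le_of_log_le
        (hlip x _ (hmemU h' hh') _ (hmemU h hh)) (hpos h' hh' x hx)
      rw [add_sub_add_left_eq_sub] at h1 h2
      rw [norm_sub_rev] at h2
      have h3 : m x * ‖h - h'‖ ≤ |m x| * ‖h - h'‖ := by gcongr; exact le_abs_self _
      simp only [logRatio, Set.indicator, Set.mem_ofPred_eq, hx, ne_eq, not_false_eq_true, if_true]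
      rw [abs_le]
      constructor <;> linarith
  · rw [memLp_two_iff_integrable_sq hm.abs.aestronglyMeasurable]
    simpa using hm2
  · intro h hh
    -- The mass is exactly 1 because the Lipschitz bound with log 0 = -∞ forces p (θs + h) to vanish
    -- wherever p θs does.
    rw [law, lintegral_withDensity_eq_lintegral_mul _ hmp.coe_nnreal_ennreal
      (hmeas h hh).exp.ennreal_ofReal, ← (hp _ (hUΘ (hmemU h hh))).2]
    refine lintegral_congr fun x => ?_
    simp only [Pi.mul_apply]
    by_cases hx : p θs x = 0
    · simp [hx, hzero h hh x hx]
    · rw [hexp h hh x hx, ← ENNReal.ofReal_coe_nnreal, ← ENNReal.ofReal_coe_nnreal,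
        ← ENNReal.ofReal_mul (NNReal.coe_nonneg _)]
      congr 1
      have : (p θs x : ℝ) ≠ 0 := by exact_mod_cast hx
      field_simp
  · intro ε hε
    have h1 := (eventually_nhdsWithin_iff.1
      (C2.eventually_le_const (ENNReal.ofReal_pos.2 hε)))
    filter_upwards [h1, Metric.ball_mem_nhds (0 : EuclideanSpace ℝ (Fin k)) hρ] with h h1 hh
    -- Quadratic-mean differentiability is a limit over the punctured neighbourhood, so h = 0 is
    -- treated apart.
    rcases eq_or_ne h 0 with rfl | hne
    · simp [hz]
    · have h2 := h1 hne
      have hn : 0 < ‖h‖ ^ 2 := by positivity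
      rw [ENNReal.div_le_iff (ENNReal.ofReal_pos.2 hn).ne' ENNReal.ofReal_ne_top,
        ← ENNReal.ofReal_mul hε.le] at h2
      refine le_trans ?_ h2
      have hmd : Measurable fun x =>
          (Real.exp (logRatio p θs h x / 2) - 1 - 1 / 2 * ⟪h, score x⟫) ^ 2 :=
        (((((hmeas h hh).div_const 2).exp).sub_const 1).sub
          ((measurable_const.inner hscore).const_mul _)).pow_const 2
      rw [law, lintegral_withDensity_eq_lintegral_mul _ hmp.coe_nnreal_ennreal hmd.ennreal_ofReal]
      -- On the support √p(θs + h) = √p(θs) exp(L/2), so the integrands agree. Off the support the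
      -- left one carries weight 0.
      refine lintegral_mono fun x => ?_
      simp only [Pi.mul_apply]
      by_cases hx : p θs x = 0
      · simp [hx]
      · rw [← ENNReal.ofReal_coe_nnreal, ← ENNReal.ofReal_mul (NNReal.coe_nonneg _)]
        refine ENNReal.ofReal_le_ofReal (le_of_eq ?_)
        have hp0 : (0 : ℝ) < p θs x := by exact_mod_cast pos_iff_ne_zero.2 hx
        have he : √(p (θs + h) x : ℝ) = √(p θs x : ℝ) * Real.exp (logRatio p θs h x / 2) := by
          rw [Real.exp_half, hexp h hh x hx, ← Real.sqrt_mul hp0.le]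
          congr 1
          field_simp
        rw [he]
        nth_rewrite 1 [← Real.sq_sqrt hp0.le]
        ring

lemma logLik_eq {Ω : Type*} {X : ℕ → Ω → 𝓧} {N : ℕ} {ω : Ω} {θ : EuclideanSpace ℝ (Fin k)}
    (h : ∀ i, p θ (X i ω) ≠ 0) :
    logLik p X N ω θ = ((∑ i ∈ Finset.range N, Real.log (p θ (X i ω)) : ℝ) : EReal) := by
  rw [logLik]
  induction N with
  | zero => simp
  | succ n ih =>
    rw [Finset.sum_range_succ, ih, Finset.sum_range_succ, log_coe_of_ne_zero (h n), EReal.coe_add]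

lemma logLik_add_eq {Ω : Type*} {X : ℕ → Ω → 𝓧} {N : ℕ} {ω : Ω}
    {h : EuclideanSpace ℝ (Fin k)} (h0 : ∀ i, p θs (X i ω) ≠ 0)
    (hh : ∀ i, p (θs + h) (X i ω) ≠ 0) :
    logLik p X N ω (θs + h) = ((∑ i ∈ Finset.range N, Real.log (p θs (X i ω))
      + ∑ i ∈ Finset.range N, logRatio p θs h (X i ω) : ℝ) : EReal) := by
  rw [logLik_eq hh, ← Finset.sum_add_distrib]
  congr 1
  refine Finset.sum_congr rfl fun i _ => ?_
  simp [logRatio, h0 i]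

end Model

/-! ### Fisher information and its square root -/

section Fisher

variable {k : ℕ} {𝓧 : Type*} [MeasurableSpace 𝓧] {ν : Measure 𝓧}
  {p : EuclideanSpace ℝ (Fin k) → 𝓧 → ℝ≥0} {θs : EuclideanSpace ℝ (Fin k)}
  {s : 𝓧 → EuclideanSpace ℝ (Fin k)}

open scoped MatrixOrder Matrix in
-- The quadratic form of the information is the second moment of ⟪h, s⟫. This makes the matrix
-- positive semidefinite and identifies ‖A h‖² with the drift in the expansion.
lemma dotProduct_fisherInfo_mulVec (hs : MemLp s 2 (law ν p θs)) (h : EuclideanSpace ℝ (Fin k)) :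
    (h : Fin k → ℝ) ⬝ᵥ (fisherInfo ν p θs s *ᵥ (h : Fin k → ℝ))
      = ∫ x, ⟪h, s x⟫ ^ 2 ∂law ν p θs := by
  have hi : ∀ i, MemLp (fun x => s x i) 2 (law ν p θs) := fun i => hs.eval_piLp i
  have hint : ∀ i j, Integrable (fun x => s x i * s x j) (law ν p θs) := fun i j =>
    (hi i).integrable_mul (hi j)
  have e : ∀ x, ⟪h, s x⟫ ^ 2 = ∑ i, ∑ j, h i * h j * (s x i * s x j) := fun x => by
    rw [PiLp.inner_apply, sq, Finset.sum_mul_sum]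
    refine Finset.sum_congr rfl fun i _ => Finset.sum_congr rfl fun j _ => ?_
    simp; ring
  simp only [e]
  rw [integral_finsetSum _ fun i _ => integrable_finsetSum _ fun j _ => (hint i j).const_mul _]
  simp only [dotProduct, Matrix.mulVec, fisherInfo, Matrix.of_apply]
  refine Finset.sum_congr rfl fun i _ => ?_
  rw [integral_finsetSum _ fun j _ => (hint i j).const_mul _, Finset.mul_sum]
  refine Finset.sum_congr rfl fun j _ => ?_
  rw [integral_const_mul]; ring

open scoped MatrixOrder Matrix in
/-- The square root of an invertible Fisher information matrix is a self-adjoint isomorphism that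
transports the Euclidean norm to the standard deviation of the score. -/
lemma exists_inverse_sqrtMap (hs : MemLp s 2 (law ν p θs)) (hI : IsUnit (fisherInfo ν p θs s)) :
    ∃ B : EuclideanSpace ℝ (Fin k) →L[ℝ] EuclideanSpace ℝ (Fin k),
      (∀ x, B (sqrtMap (fisherInfo ν p θs s) x) = x) ∧
      (∀ x, sqrtMap (fisherInfo ν p θs s) (B x) = x) ∧
      (∀ x y, ⟪sqrtMap (fisherInfo ν p θs s) x, y⟫ = ⟪x, sqrtMap (fisherInfo ν p θs s) y⟫) ∧
      (∀ x, ‖sqrtMap (fisherInfo ν p θs s) x‖ ^ 2 = ∫ y, ⟪x, s y⟫ ^ 2 ∂law ν p θs) := by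
  set M := fisherInfo ν p θs s with hM
  have hsym : M.IsHermitian := by
    ext i j
    simp [hM, fisherInfo, mul_comm]
  have hpsd : 0 ≤ M := by
    rw [Matrix.nonneg_iff_posSemidef]
    refine Matrix.PosSemidef.of_dotProduct_mulVec_nonneg hsym fun x => ?_
    have := dotProduct_fisherInfo_mulVec hs (WithLp.toLp 2 x)
    simp only [star_trivial]
    rw [hM]
    exact this.symm ▸ integral_nonneg fun _ => sq_nonneg _
  have hmul : CFC.sqrt M * CFC.sqrt M = M := CFC.sqrt_mul_sqrt_self M hpsd
  have hsa : IsSelfAdjoint (CFC.sqrt M) := (CFC.sqrt_nonneg M).isSelfAdjoint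
  have hunit : IsUnit (CFC.sqrt M) := by
    rw [Matrix.isUnit_iff_isUnit_det] at hI ⊢
    rw [← hmul, Matrix.det_mul] at hI
    exact isUnit_of_mul_isUnit_left hI
  have hadj : ContinuousLinearMap.adjoint (sqrtMap M) = sqrtMap M := by
    rw [← ContinuousLinearMap.star_eq_adjoint, sqrtMap, ← map_star, hsa.star_eq]
  have hinner : ∀ x y, ⟪sqrtMap M x, y⟫ = ⟪x, sqrtMap M y⟫ := fun x y => by
    rw [← ContinuousLinearMap.adjoint_inner_right, hadj]
  obtain ⟨u, hu⟩ := hunit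
  have hcomp : ∀ (A C : Matrix (Fin k) (Fin k) ℝ) x, Matrix.toEuclideanCLM (𝕜 := ℝ) A
      (Matrix.toEuclideanCLM (𝕜 := ℝ) C x) = Matrix.toEuclideanCLM (𝕜 := ℝ) (A * C) x :=
    fun A C x => by rw [map_mul]; rfl
  refine ⟨Matrix.toEuclideanCLM (𝕜 := ℝ) (↑u⁻¹ : Matrix (Fin k) (Fin k) ℝ), fun x => ?_,
    fun x => ?_, hinner, fun x => ?_⟩
  · rw [sqrtMap, hcomp, ← hu, Units.inv_mul, map_one]; rfl
  · rw [sqrtMap, hcomp, ← hu, Units.mul_inv, map_one]; rfl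
  · rw [← real_inner_self_eq_norm_sq, hinner, sqrtMap, hcomp, hmul,
      ← dotProduct_fisherInfo_mulVec hs x, Matrix.inner_toEuclideanCLM]

end Fisher

/-! ### Convergence in distribution under negligible changes -/

section ConvergenceInDistribution

variable {Ω Ω' E : Type*} [MeasurableSpace Ω] [MeasurableSpace Ω'] {P : Measure Ω}
  [IsProbabilityMeasure P] {P' : Measure Ω'} [IsProbabilityMeasure P'] [TopologicalSpace E]
  [MeasurableSpace E] [BorelSpace E]

/-- Convergence in distribution is not affected by changes on events of vanishing probability. -/
lemma tendstoInDistribution_of_tendsto_measure_ne {X Y : ℕ → Ω → E} {Z : Ω' → E}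
    (hX : TendstoInDistribution X atTop Z (fun _ => P) P') (hY : ∀ n, AEMeasurable (Y n) P)
    (hXY : Tendsto (fun n => P {ω | Y n ω ≠ X n ω}) atTop (𝓝 0)) :
    TendstoInDistribution Y atTop Z (fun _ => P) P' where
  forall_aemeasurable := hY
  aemeasurable_limit := hX.aemeasurable_limit
  tendsto := by
    refine ProbabilityMeasure.tendsto_iff_forall_integral_tendsto.2 fun f => ?_
    have h1 := ProbabilityMeasure.tendsto_iff_forall_integral_tendsto.1 hX.tendsto f
    refine tendsto_of_tendsto_of_dist h1 ?_
    have h2 : Tendsto (fun n => 2 * ‖f‖ * (P {ω | Y n ω ≠ X n ω}).toReal) atTop (𝓝 0) := by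
      simpa using ((ENNReal.tendsto_toReal_zero_iff fun n => measure_ne_top P _).2 hXY).const_mul
        (2 * ‖f‖)
    refine squeeze_zero (fun _ => dist_nonneg) (fun n => ?_) h2
    simp only [ProbabilityMeasure.coe_mk]
    have hXn := hX.forall_aemeasurable n
    rw [integral_map hXn f.continuous.measurable.aestronglyMeasurable,
      integral_map (hY n) f.continuous.measurable.aestronglyMeasurable, dist_comm,
      Real.dist_eq]
    have hi : ∀ W : Ω → E, AEMeasurable W P → Integrable (fun ω => f (W ω)) P := fun W hW =>
      Integrable.of_bound (f.continuous.measurable.comp_aemeasurable hW).aestronglyMeasurable ‖f‖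
        (ae_of_all _ fun ω => f.norm_coe_le_norm _)
    rw [← integral_sub (hi _ (hY n)) (hi _ hXn)]
    -- The disagreement set need not be measurable, so a measurable hull of equal measure is
    -- integrated instead.
    set S := toMeasurable P {ω | Y n ω ≠ X n ω} with hS
    have hSm : MeasurableSet S := measurableSet_toMeasurable _ _
    calc |∫ ω, (f (Y n ω) - f (X n ω)) ∂P|
        ≤ ∫ ω, |f (Y n ω) - f (X n ω)| ∂P := abs_integral_le_integral_abs
      _ ≤ ∫ ω, S.indicator (fun _ => 2 * ‖f‖) ω ∂P := by
          refine integral_mono ((hi _ (hY n)).sub (hi _ hXn)).abs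
            ((integrable_const _).indicator hSm) fun ω => ?_
          by_cases hω : ω ∈ S
          · rw [Set.indicator_of_mem hω]
            have h3 := f.norm_coe_le_norm (Y n ω)
            have h4 := f.norm_coe_le_norm (X n ω)
            exact (abs_sub _ _).trans (by rw [two_mul]; exact add_le_add h3 h4)
          · have : Y n ω = X n ω := by
              by_contra hne
              exact hω (subset_toMeasurable P _ hne)
            simp [this, hω]
      _ = 2 * ‖f‖ * (P {ω | Y n ω ≠ X n ω}).toReal := by
          rw [integral_indicator_const _ hSm, measureReal_def, hS, measure_toMeasurable,
            smul_eq_mul, mul_comm]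

/-- An extended-real statistic that is, with probability tending to one, finite and close to
random variables converging in distribution, converges in distribution. -/
lemma tendstoInDistribution_ereal_of_close {Y : ℕ → Ω → EReal} {W : ℕ → Ω → ℝ} {Z : Ω' → ℝ}
    (hY : ∀ n, AEMeasurable (Y n) P) (hW : TendstoInDistribution W atTop Z (fun _ => P) P')
    (hYW : ∀ ε > (0 : ℝ), Tendsto
      (fun n => P {ω | ¬ ∃ y : ℝ, Y n ω = (y : EReal) ∧ |y - W n ω| ≤ ε}) atTop (𝓝 0)) :
    TendstoInDistribution Y atTop (fun ω => (Z ω : EReal)) (fun _ => P) P' := by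
  -- Slutsky's lemma applies in ℝ, so it is used for the real parts. Mapping back to the extended
  -- reals recovers Y outside an event of vanishing probability.
  have hV : TendstoInDistribution (fun n ω => (Y n ω).toReal) atTop Z (fun _ => P) P' := by
    refine tendstoInDistribution_of_tendstoInMeasure_sub (X := W) _ Z hW ?_ fun n =>
      (hY n).ereal_toReal
    rw [tendstoInMeasure_iff_norm]
    intro ε hε
    refine tendsto_of_tendsto_of_tendsto_of_le_of_le tendsto_const_nhds
      (hYW (ε / 2) (by positivity)) (fun _ => zero_le) fun n => measure_mono fun ω hω hcon => ?_
    obtain ⟨y, hy, hle⟩ := hcon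
    simp only [Set.mem_ofPred_eq, Pi.sub_apply, Pi.zero_apply, sub_zero, hy, EReal.toReal_coe,
      Real.norm_eq_abs] at hω
    linarith
  have hV' := hV.continuous_comp (g := Real.toEReal) continuous_coe_real_ereal
  refine tendstoInDistribution_of_tendsto_measure_ne hV' hY ?_
  refine tendsto_of_tendsto_of_tendsto_of_le_of_le tendsto_const_nhds
    (hYW 1 one_pos) (fun _ => zero_le) fun n => measure_mono fun ω hω hcon => ?_
  obtain ⟨y, hy, -⟩ := hcon
  exact hω (by simp [hy])

end ConvergenceInDistribution

/-! ### Expansion of the maximal log-likelihood -/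

section LikelihoodRatio

variable {k : ℕ} {Ω 𝓧 : Type*} [MeasurableSpace Ω] [MeasurableSpace 𝓧] {P : Measure Ω}
  [IsProbabilityMeasure P] {Q : Measure 𝓧} [IsProbabilityMeasure Q]
  {p : EuclideanSpace ℝ (Fin k) → 𝓧 → ℝ≥0} {θs : EuclideanSpace ℝ (Fin k)}
  {m : 𝓧 → ℝ} {s : 𝓧 → EuclideanSpace ℝ (Fin k)} {ρ : ℝ} {X : ℕ → Ω → 𝓧}
  {S : Set (EuclideanSpace ℝ (Fin k))}
  {A B : EuclideanSpace ℝ (Fin k) →L[ℝ] EuclideanSpace ℝ (Fin k)}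

lemma iSup₂_eq_of_isMaxOn {α : Type*} {f : α → EReal} {S : Set α} {a : α} (ha : a ∈ S)
    (h : IsMaxOn f S a) : ⨆ x ∈ S, f x = f a :=
  le_antisymm (iSup₂_le fun _ hx => h hx) (le_iSup₂_of_le a ha le_rfl)

/-- Quadratic expansion of the maximal log-likelihood over a Chernoff regular set: with
probability tending to one it is, up to the log-likelihood at the true parameter, half the
difference between `‖Z‖²` and the squared distance from `Z` to the image of the tangent cone. -/
theorem tendsto_measure_not_iSup_logLik_close (H : IsLocalModel Q (logRatio p θs) m s ρ)
    (hsupp : ∀ h ∈ Metric.ball (0 : EuclideanSpace ℝ (Fin k)) ρ, ∀ x, p θs x ≠ 0 →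
      p (θs + h) x ≠ 0)
    (hindep : iIndepFun X P) (hlaw : ∀ i, HasLaw (X i) Q P)
    (hpos : ∀ᵐ ω ∂P, ∀ i, p θs (X i ω) ≠ 0)
    (hBA : ∀ x, B (A x) = x) (hAB : ∀ x, A (B x) = x) (hAsymm : ∀ x y, ⟪A x, y⟫ = ⟪x, A y⟫)
    (hA : ∀ x, ‖A x‖ ^ 2 = ∫ y, ⟪x, s y⟫ ^ 2 ∂Q)
    (hθs : θs ∈ S) (hMLE : ConsistentMLE P p X S θs) (hS : ChernoffRegular S θs)
    {ε : ℝ} (hε : 0 < ε) :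
    Tendsto (fun N => P {ω | ¬ ∃ r : ℝ,
      ⨆ θ ∈ S, logLik p X N ω θ
        = ((∑ i ∈ Finset.range N, Real.log (p θs (X i ω)) + r : ℝ) : EReal) ∧
      |2 * r - (‖B (IsLocalModel.scoreSum s X N ω)‖ ^ 2
        - Metric.infDist (B (IsLocalModel.scoreSum s X N ω)) (A '' tangentCone S θs) ^ 2)| ≤ ε})
      atTop (𝓝 0) := by
  refine ENNReal_tendsto_zero_of_ofReal fun η hη => ?_
  -- Adding 1 keeps c positive also when B = 0, which occurs for k = 0.
  set c := (‖B‖ + 1)⁻¹ with hc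
  have hc0 : 0 < c := by positivity
  have hcA : ∀ x, c * ‖x‖ ≤ ‖A x‖ := fun x => by
    rw [hc, inv_mul_le_iff₀ (by positivity)]
    calc ‖x‖ = ‖B (A x)‖ := by rw [hBA]
      _ ≤ ‖B‖ * ‖A x‖ := B.le_opNorm _
      _ ≤ (‖B‖ + 1) * ‖A x‖ := by gcongr; linarith
  obtain ⟨δ, hδ, hrate⟩ := H.exists_measure_nonneg_le hindep hlaw (show 0 < c ^ 2 by positivity)
    (fun h => by
      rw [← hA, ← mul_pow]
      exact pow_le_pow_left₀ (by positivity) (hcA h) 2)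
  obtain ⟨M₁, hM₁, hrate⟩ := hrate (η / 5) (by positivity)
  obtain ⟨T, hT0, hT⟩ := H.exists_measure_lt_norm_scoreSum_le hindep hlaw
    (show 0 < η / 5 by positivity)
  set R := ‖B‖ * T with hR
  have hR0 : 0 ≤ R := by positivity
  -- The ball of radius M must contain both the rescaled maximizer, by the rate theorem, and every h
  -- with ‖Z - A h‖ ≤ D + 1, since c‖h‖ ≤ ‖A h‖ ≤ ‖Z‖ + D + 1 ≤ 2R + 1.
  set M := max M₁ ((2 * R + 1) / c) with hM
  have hM0 : 0 ≤ M := hM₁.le.trans (le_max_left _ _)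
  obtain ⟨θhat, hmax, hcons⟩ := hMLE
  have hcons' := (tendstoInMeasure_iff_dist.1 hcons) (min δ ρ) (lt_min hδ H.pos)
  have hsq := Real.tendsto_sqrt_atTop.comp (tendsto_natCast_atTop_atTop (R := ℝ))
  filter_upwards [hrate,
    eventually_le_ofReal_of_tendsto_zero hmax (show 0 < η / 5 by positivity),
    eventually_le_ofReal_of_tendsto_zero hcons' (show 0 < η / 5 by positivity),
    eventually_le_ofReal_of_tendsto_zero
      (H.tendsto_measure_exists_lt_abs hindep hlaw hM0 (show 0 < ε / 4 by positivity))
      (show 0 < η / 5 by positivity),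
    eventually_forall_sq_infDist_localSet hθs hS hc0 hcA R (show 0 < ε / 4 by positivity),
    eventually_gt_atTop 0, (hsq.const_mul_atTop H.pos).eventually_gt_atTop M]
    with N e1 e2 e3 e4 hdist hN hMN
  have hsn : 0 < √(N : ℝ) := Real.sqrt_pos.2 (by exact_mod_cast hN)
  have e5 : P {ω | ¬ ∀ i, p θs (X i ω) ≠ 0} = 0 := ae_iff.1 hpos
  refine (measure_mono (t := (({ω | ∃ h : EuclideanSpace ℝ (Fin k), M₁ ≤ ‖h‖ ∧
      ‖h‖ < δ * √(N : ℝ) ∧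
        0 ≤ ∑ i ∈ Finset.range N, logRatio p θs ((√(N : ℝ))⁻¹ • h) (X i ω)} ∪
      {ω | ¬ (θhat N ω ∈ S ∧ IsMaxOn (logLik p X N ω) S (θhat N ω))}) ∪
      ({ω | min δ ρ ≤ dist (θhat N ω) θs} ∪ {ω | ∃ h : EuclideanSpace ℝ (Fin k), ‖h‖ ≤ M ∧
      ε / 4 < |∑ i ∈ Finset.range N, logRatio p θs ((√(N : ℝ))⁻¹ • h) (X i ω)
        - ⟪h, IsLocalModel.scoreSum s X N ω⟫ + 1 / 2 * ∫ x, ⟪h, s x⟫ ^ 2 ∂Q|})) ∪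
      ({ω | T < ‖IsLocalModel.scoreSum s X N ω‖} ∪ {ω | ¬ ∀ i, p θs (X i ω) ≠ 0})) ?_).trans ?_
  · intro ω hω
    by_contra hcon
    apply hω
    simp only [Set.mem_union, not_or, Set.mem_ofPred_eq, not_not] at hcon
    obtain ⟨⟨⟨g1, g2, g3⟩, g4, g5⟩, g6, g7⟩ := hcon
    simp only [not_exists, not_and, not_le, not_lt] at g1 g4 g5 g6
    set Δ := IsLocalModel.scoreSum s X N ω with hΔ
    set Z := B Δ with hZ
    set l₀ := ∑ i ∈ Finset.range N, Real.log (p θs (X i ω)) with hl₀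
    have hZR : ‖Z‖ ≤ R := (B.le_opNorm _).trans (mul_le_mul_of_nonneg_left g6 (norm_nonneg _))
    -- Completing the square, using ⟪h, Δ⟫ = ⟪h, A Z⟫ = ⟪A h, Z⟫.
    have hquad : ∀ h, ⟪h, Δ⟫ - 1 / 2 * ∫ x, ⟪h, s x⟫ ^ 2 ∂Q
        = 1 / 2 * (‖Z‖ ^ 2 - ‖Z - A h‖ ^ 2) := fun h => by
      rw [← hA, norm_sub_sq_real, real_inner_comm (A h) Z, hAsymm, hZ, hAB]
      ring
    have hll : ∀ h, ‖h‖ < ρ * √(N : ℝ) → logLik p X N ω (θs + (√(N : ℝ))⁻¹ • h)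
        = ((l₀ + ∑ i ∈ Finset.range N, logRatio p θs ((√(N : ℝ))⁻¹ • h) (X i ω) : ℝ) : EReal) :=
      fun h hh => logLik_add_eq g7 fun i => hsupp _ (IsLocalModel.smul_mem_ball hN hh) _ (g7 i)
    set hhat := √(N : ℝ) • (θhat N ω - θs) with hhhat
    have hθhat : θs + (√(N : ℝ))⁻¹ • hhat = θhat N ω := by
      rw [hhhat, smul_smul, inv_mul_cancel₀ hsn.ne', one_smul, add_sub_cancel]
    have hhn : ‖hhat‖ < min δ ρ * √(N : ℝ) := by
      rw [hhhat, norm_smul, Real.norm_eq_abs, abs_of_pos hsn, ← dist_eq_norm, mul_comm]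
      gcongr
    have hhnδ : ‖hhat‖ < δ * √(N : ℝ) := hhn.trans_le (by gcongr; exact min_le_left _ _)
    have hhnρ : ‖hhat‖ < ρ * √(N : ℝ) := hhn.trans_le (by gcongr; exact min_le_right _ _)
    set r := ∑ i ∈ Finset.range N, logRatio p θs ((√(N : ℝ))⁻¹ • hhat) (X i ω) with hr
    have hsup : ⨆ θ ∈ S, logLik p X N ω θ = ((l₀ + r : ℝ) : EReal) := by
      rw [iSup₂_eq_of_isMaxOn g2 g3, ← hθhat, hll _ hhnρ]
    have hle : ∀ h ∈ localSet S θs N, ‖h‖ < ρ * √(N : ℝ) →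
        ∑ i ∈ Finset.range N, logRatio p θs ((√(N : ℝ))⁻¹ • h) (X i ω) ≤ r := by
      intro h hh hhρ
      have h1 : logLik p X N ω (θs + (√(N : ℝ))⁻¹ • h) ≤ ⨆ θ ∈ S, logLik p X N ω θ :=
        le_iSup₂_of_le _ hh le_rfl
      rw [hsup, hll h hhρ, EReal.coe_le_coe_iff] at h1
      linarith
    -- The true parameter competes in S, so the ratio at the maximizer is nonnegative, which the
    -- rate theorem excludes for ‖hhat‖ ≥ M₁.
    have hr0 : 0 ≤ r := by
      have h1 := hle 0 (zero_mem_localSet hθs N) (by rw [norm_zero]; exact mul_pos H.pos hsn)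
      simpa [H.zero] using h1
    have hhM : ‖hhat‖ ≤ M := by
      by_contra hcon
      push Not at hcon
      exact absurd hr0 (not_le.2 (g1 hhat ((le_max_left _ _).trans hcon.le) hhnδ))
    have hhatmem : hhat ∈ localSet S θs N := by
      simp only [localSet, Set.mem_ofPred_eq, hθhat]; exact g2
    set D := Metric.infDist Z (A '' localSet S θs N) with hD
    have hD0 : 0 ≤ D := Metric.infDist_nonneg
    have hDR : D ≤ R := (infDist_image_le_norm (zero_mem_localSet hθs N) Z).trans hZR
    have hupper : 2 * r ≤ ‖Z‖ ^ 2 - D ^ 2 + ε / 2 := by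
      have h1 := (_root_.abs_le.1 (g5 hhat hhM)).2
      have h2 := hquad hhat
      have h3 : D ≤ ‖Z - A hhat‖ := by
        rw [← dist_eq_norm]
        exact Metric.infDist_le_dist_of_mem (Set.mem_image_of_mem A hhatmem)
      have h4 : D ^ 2 ≤ ‖Z - A hhat‖ ^ 2 := pow_le_pow_left₀ hD0 h3 2
      rw [← hr] at h1
      linarith
    have hlower : ‖Z‖ ^ 2 - D ^ 2 - 3 / 4 * ε ≤ 2 * r := by
      -- The rescaled set need not be closed, so a near-minimizer of the distance is used: the bound
      -- 1 keeps it in the ball of radius M, and ε/4 keeps the loss within the error budget.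
      set γ := min 1 (ε / 4) with hγ
      have hγ0 : 0 < γ := lt_min one_pos (by positivity)
      have h1 : D < √(D ^ 2 + γ) := Real.lt_sqrt_of_sq_lt (by linarith)
      obtain ⟨_, ⟨h, hh, rfl⟩, hlt⟩ := (Metric.infDist_lt_iff
        (Set.Nonempty.image A ⟨0, zero_mem_localSet hθs N⟩)).1 h1
      rw [dist_eq_norm] at hlt
      have h2 : ‖Z - A h‖ ^ 2 < D ^ 2 + γ := (Real.lt_sqrt (norm_nonneg _)).1 hlt
      have h3 : ‖Z - A h‖ ≤ D + 1 := by
        refine abs_le_of_sq_le_sq' ?_ (by positivity) |>.2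
        have : γ ≤ 1 := min_le_left _ _
        nlinarith
      have h4 : ‖h‖ ≤ M := by
        refine le_trans ?_ (le_max_right _ _)
        rw [le_div_iff₀ hc0, mul_comm]
        have h5 := norm_le_norm_add_norm_sub' (A h) Z
        rw [norm_sub_rev] at h5
        linarith [hcA h]
      have h6 := (_root_.abs_le.1 (g5 h h4)).1
      have h7 := hle h hh (h4.trans_lt hMN)
      have h8 := hquad h
      have h9 : γ ≤ ε / 4 := min_le_right _ _
      linarith
    have hd := abs_lt.1 (hdist Z hZR)
    refine ⟨r, hsup, ?_⟩
    rw [_root_.abs_le]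
    constructor <;> linarith [hd.1, hd.2]
  · refine (measure_union_le _ _).trans (add_le_add ((measure_union_le _ _).trans (add_le_add
      ((measure_union_le _ _).trans (add_le_add e1 e2))
      ((measure_union_le _ _).trans (add_le_add e3 e4))))
      ((measure_union_le _ _).trans (add_le_add (hT N) e5.le))) |>.trans_eq ?_
    rw [add_zero, ← ENNReal.ofReal_add (by positivity) (by positivity),
      ← ENNReal.ofReal_add (by positivity) (by positivity),
      ← ENNReal.ofReal_add (by positivity) (by positivity)]
    congr 1; ring

end LikelihoodRatio

end LRT

/-! ### The limit law of the likelihood ratio statistic -/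

theorem theorem2 {J k : ℕ} {Ω Ω' : Type*} [MeasurableSpace Ω] [MeasurableSpace Ω']
    -- the model: densities `p θ` on `ℝ^J` with respect to a sigma-finite measure `ν`
    (ν : Measure (Fin J → ℝ)) [SigmaFinite ν]
    (p : EuclideanSpace ℝ (Fin k) → (Fin J → ℝ) → ℝ≥0)
    (Θ₀ Θ₁ Θ : Set (EuclideanSpace ℝ (Fin k))) (h₀₁ : Θ₀ ⊆ Θ₁) (h₁ : Θ₁ ⊆ Θ)
    (hp : LRT.IsDensityFamily ν p Θ)
    -- the true parameter, and i.i.d. observations with the true law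
    (θs : EuclideanSpace ℝ (Fin k)) (hθs : θs ∈ Θ₀)
    (P : Measure Ω) [IsProbabilityMeasure P] (X : ℕ → Ω → (Fin J → ℝ))
    (hindep : iIndepFun X P) (hlaw : ∀ i, HasLaw (X i) (LRT.law ν p θs) P)
    -- the statistic is a random variable
    (hmeas : ∀ N, AEMeasurable (LRT.lrtStat p X Θ₀ Θ₁ N) P)
    -- the true parameter is an interior point
    (C1 : θs ∈ interior Θ)
    -- differentiability in quadratic mean, with invertible Fisher information
    (score : (Fin J → ℝ) → EuclideanSpace ℝ (Fin k)) (hscore : Measurable score)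
    (C2 : LRT.DiffQuadMean ν p θs score) (C2' : IsUnit (LRT.fisherInfo ν p θs score))
    -- local Lipschitz bound on the log-density
    (C3 : LRT.LipschitzLogDensity ν p Θ θs)
    -- consistent maximum likelihood estimators
    (C4 : LRT.ConsistentMLE P p X Θ θs) (C4₀ : LRT.ConsistentMLE P p X Θ₀ θs)
    (C4₁ : LRT.ConsistentMLE P p X Θ₁ θs)
    -- Chernoff regularity
    (C5₀ : LRT.ChernoffRegular Θ₀ θs) (C5₁ : LRT.ChernoffRegular Θ₁ θs)
    -- a standard normal random vector
    (P' : Measure Ω') [IsProbabilityMeasure P'] (Z : Ω' → EuclideanSpace ℝ (Fin k))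
    (hZ : HasLaw Z (stdGaussian (EuclideanSpace ℝ (Fin k))) P') :
    -- both minima are attained, and the statistic converges in distribution to their difference
    (∀ z, IsLeast (LRT.sqDistSet (LRT.fisherInfo ν p θs score) (LRT.tangentCone Θ₀ θs) z)
        (LRT.minSqDist (LRT.fisherInfo ν p θs score) (LRT.tangentCone Θ₀ θs) z)) ∧
    (∀ z, IsLeast (LRT.sqDistSet (LRT.fisherInfo ν p θs score) (LRT.tangentCone Θ₁ θs) z)
        (LRT.minSqDist (LRT.fisherInfo ν p θs score) (LRT.tangentCone Θ₁ θs) z)) ∧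
    TendstoInDistribution (fun N => LRT.lrtStat p X Θ₀ Θ₁ N) atTop
      (fun ω' => ((LRT.minSqDist (LRT.fisherInfo ν p θs score) (LRT.tangentCone Θ₀ θs) (Z ω')
        - LRT.minSqDist (LRT.fisherInfo ν p θs score) (LRT.tangentCone Θ₁ θs) (Z ω') : ℝ) : EReal))
      (fun _ => P) P' := by

  have hθ : θs ∈ Θ := interior_subset C1
  have hQ : IsProbabilityMeasure (LRT.law ν p θs) := LRT.isProbabilityMeasure_law (hp θs hθ).2
  obtain ⟨m, ρ, H, hsupp⟩ := LRT.exists_isLocalModel hp hscore C2 C3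
  obtain ⟨B, hBA, hAB, hsymm, hA⟩ := LRT.exists_inverse_sqrtMap H.memLp_s C2'
  set M := LRT.fisherInfo ν p θs score
  set A := LRT.sqrtMap M
  have hcA : ∀ x, (‖B‖ + 1)⁻¹ * ‖x‖ ≤ ‖A x‖ := fun x => by
    rw [inv_mul_le_iff₀ (by positivity)]
    calc ‖x‖ = ‖B (A x)‖ := by rw [hBA]
      _ ≤ ‖B‖ * ‖A x‖ := B.le_opNorm _
      _ ≤ (‖B‖ + 1) * ‖A x‖ := by gcongr; linarith
  have hc : 0 < (‖B‖ + 1)⁻¹ := by positivity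
  have hmin₀ := LRT.minSqDist_eq_and_isLeast hθs M hc hcA
  have hmin₁ := LRT.minSqDist_eq_and_isLeast (h₀₁ hθs) M hc hcA
  refine ⟨fun z => (hmin₀ z).2, fun z => (hmin₁ z).2, ?_⟩
  have hpos : ∀ᵐ ω ∂P, ∀ i, p θs (X i ω) ≠ 0 := by
    refine ae_all_iff.2 fun i => ?_
    have h := LRT.ae_law_ne_zero (ν := ν) (hp θs hθ).1
    rw [← (hlaw i).map_eq] at h
    exact ae_of_ae_map (hlaw i).aemeasurable h
  have hBsymm : ∀ x y, ⟪x, B y⟫ = ⟪B x, y⟫ := fun x y => by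
    rw [← hAB x, hsymm, hAB, hBA]
  -- The vectors B s are standardized: E⟪t, B s⟫² = E⟪B t, s⟫² = ‖A (B t)‖² = ‖t‖².
  have hclt := LRT.tendstoInDistribution_inv_sqrt_smul_sum hindep hlaw
    (B.continuous.measurable.comp hscore)
    (fun t => by simpa only [Function.comp, hBsymm] using H.memLp_inner (B t))
    (fun t => by simpa only [Function.comp, hBsymm] using H.integral_inner_s (B t))
    (fun t => by simp only [Function.comp, hBsymm, ← hA, hAB]) hZ
  set g : EuclideanSpace ℝ (Fin k) → ℝ := fun z =>
    Metric.infDist z (A '' LRT.tangentCone Θ₀ θs) ^ 2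
      - Metric.infDist z (A '' LRT.tangentCone Θ₁ θs) ^ 2 with hg
  have hgc : Continuous g := ((Metric.continuous_infDist_pt _).pow 2).sub
    ((Metric.continuous_infDist_pt _).pow 2)
  have hW := hclt.continuous_comp hgc
  have hZg : (fun ω' => ((LRT.minSqDist M (LRT.tangentCone Θ₀ θs) (Z ω')
      - LRT.minSqDist M (LRT.tangentCone Θ₁ θs) (Z ω') : ℝ) : EReal))
      = fun ω' => ((g (Z ω') : ℝ) : EReal) := by
    funext ω'
    rw [(hmin₀ _).1, (hmin₁ _).1]
  rw [hZg]
  refine LRT.tendstoInDistribution_ereal_of_close hmeas hW fun ε hε => ?_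
  -- Both expansions involve the same score sum and the same finite log-likelihood at θs, so these
  -- common terms cancel in the difference. Each expansion contributes an error of ε/2.
  have k0 := LRT.tendsto_measure_not_iSup_logLik_close H hsupp hindep hlaw hpos hBA hAB hsymm hA
    hθs C4₀ C5₀ (half_pos hε)
  have k1 := LRT.tendsto_measure_not_iSup_logLik_close H hsupp hindep hlaw hpos hBA hAB hsymm hA
    (h₀₁ hθs) C4₁ C5₁ (half_pos hε)
  have k2 := k0.add k1
  rw [add_zero] at k2
  refine tendsto_of_tendsto_of_tendsto_of_le_of_le tendsto_const_nhds k2 (fun _ => zero_le)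
    fun N => (measure_mono fun ω hω => ?_).trans (measure_union_le _ _)
  by_contra hcon
  simp only [Set.mem_union, not_or, Set.mem_ofPred_eq, not_not] at hcon
  obtain ⟨⟨r₀, e₀, d₀⟩, r₁, e₁, d₁⟩ := hcon
  refine hω ⟨2 * r₁ - 2 * r₀, ?_, ?_⟩
  · rw [LRT.lrtStat, e₀, e₁, ← EReal.coe_sub, show (2 : EReal) = ((2 : ℝ) : EReal) from rfl,
      ← EReal.coe_mul]
    congr 1
    ring
  · have hz : (√(N : ℝ))⁻¹ • ∑ i ∈ Finset.range N, (B ∘ score) (X i ω)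
        = B (LRT.IsLocalModel.scoreSum score X N ω) := by
      simp [LRT.IsLocalModel.scoreSum, map_smul, map_sum]
    simp only [Function.comp_def, hg] at hz ⊢
    rw [hz]
    rw [abs_le] at d₀ d₁ ⊢
    constructor <;> linarith [d₀.1, d₀.2, d₁.1, d₁.2]
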